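/- Let $A$ be a unital commutative associative $\mathbb{C}$-algebra and $B$ a vertex $A$-algebroid with action $(a,v)\mapsto a\cdot v$, left Leibniz bracket $[u,v]=u_0v$, anchor $\pi:B\to\mathrm{Der}(A)$, $\pi(u)(a)=u_0a$, pairing $\langle u,v\rangle=u_1v\in A$ and map $\partial:A\to B$. Assume that $B$ is a cyclic non-Lie left Leibniz algebra, $\dim B\in\{2,3\}$, $B\neq A\partial(A):=\mathrm{span}\{a\cdot\partial(a')\mid a,a'\in A\}$ and $\ker\partial=\mathbb{C}1_A$. Let $b$ be a generator of $B$, i.e. $B=\mathrm{span}\{b,b_0b,b_0(b_0b),\dots\}$. Let $\mathcal{L}=\big((A\oplus B)\otimes\mathbb{C}[t,t^{-1}]\big)/\hat\partial\big(A\otimes\mathbb{C}[t,t^{-1}]\big)$, $\hat\partial=\partial\otimes1+1\otimes\frac{d}{dt}$, be the Lie algebra with $$[a(m),a'(n)]=0,\quad [u(m),a(n)]=(u_0a)(m+n),\quad [u(m),v(n)]=(u_0v)(m+n)+m(u_1v)(m+n-1)$$ for $a,a'\in A$, $u,v\in B$, where $x(n)$ is the class of $x\otimes t^n$; it is graded by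 $\deg a(n)=-n-1$, $\deg u(n)=-n$. Let $V_{\mathcal{L}}=U(\mathcal{L})/U(\mathcal{L})\mathcal{L}^{\ge0}$, where $\mathcal{L}^{\ge 0}$ is spanned by the $x(n)$ with $n\ge0$, let $\mathbf 1$ be the class of $1$, and let $D$ be the operator on $V_{\mathcal{L}}$ with $D\mathbf 1=0$, $[D,x(n)]=-n\,x(n-1)$. Let $V_B=V_{\mathcal{L}}/U(\mathcal{L})\mathbb{C}[D]E$, where $E$ is spanned by the vectors $1_A(-1)\mathbf 1-\mathbf 1$, $a(-1)a'(-1)\mathbf 1-(aa')(-1)\mathbf 1$ and $a(-1)u(-1)\mathbf 1-(a\cdot u)(-1)\mathbf 1$. It carries a unique structure of vertex algebra with vacuum vector $\mathbf 1$ and $Y(x(-1)\mathbf 1,z)=\sum_n x(n)z^{-n-1}$ for $x\in A\oplus B$, and it is graded by degree. For a module $U$ of the Lie $A$-algebroid $B/A\partial(A)$ let $M(U)$ be the $\mathcal{L}$-module induced from $U$, on which $a(-1)$ acts as $a$, $u(0)$ acts as $u$, and $a(n)$ ($n\ge0$) and $u(n)$ ($n\ge1$) act as zero ($a\in A$, $u\in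 B$); it is graded with $U$ in degree $0$. Let $L(U)=M(U)/J(U)$, where $J(U)$ is the largest graded submodule of $M(U)$ with $J(U)\cap U=0$. Then the following hold. (1) $A$ has a unique maximal ideal $\mathfrak{m}$, and for every finite-dimensional irreducible module $U$ of the Lie $A$-algebroid $B/A\partial(A)$ there is $v\in U$, $v\ne0$, with $U=\mathbb{C}v$, $\mathfrak{m}v=0$ and $b\cdot v=\lambda v$ for some $\lambda\in\mathbb{C}$. (2) For every $\lambda\in\mathbb{C}$ there is a module $\mathbb{C}v_\lambda$ of the Lie $A$-algebroid $B/A\partial(A)$ with $v_\lambda\neq0$, $\mathfrak{m}v_\lambda=0$ and $b\cdot v_\lambda=\lambda v_\lambda$. The modules $\mathbb{C}v_\lambda$, $\lambda\in\mathbb{C}$, are irreducible and pairwise non-isomorphic, and every finite-dimensional irreducible module of the Lie $A$-algebroid $B/A\partial(A)$ is isomorphic to one of them. (3) For every $\lambda\in\mathbb{C}$ the space $L(\mathbb{C}v_\lambda)$ carries a unique structure of $V_B$-module with $Y(x(-1)\mathbf 1,z)=\sum_n x(n)z^{-n-1}$ for $x\in A\oplus B$. The modules $L(\mathbb{C}v_\lambda)$,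 $\lambda\in\mathbb{C}$, are a complete set of representatives of the equivalence classes of irreducible $\mathbb{N}$-graded $V_B$-modules $W=\bigoplus_{n\ge0}W_{(n)}$ whose degree-zero space $W_{(0)}$ is nonzero and finite-dimensional: each of them is such a module, they are pairwise non-isomorphic, and every such $W$ (irreducible in the sense that it has no proper nonzero graded submodule) is isomorphic to some $L(\mathbb{C}v_\lambda)$ as a graded $V_B$-module. -/

import Mathlib

open scoped TensorProduct
open VertexOperator (ncoeff)

universe u v w

noncomputable section

/-! ### Vertex algebroids -/

/-- A vertex `A`-algebroid structure on the complex vector space `B`. -/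
class VertexAlgebroid (A : Type u) (B : Type v) [CommRing A] [Algebra ℂ A]
    [AddCommGroup B] [Module ℂ B] where
  /-- the (nonassociative) action `a · v` -/
  act : A →ₗ[ℂ] B →ₗ[ℂ] B
  /-- the left Leibniz bracket `[u, v] = u₀v` -/
  br : B →ₗ[ℂ] B →ₗ[ℂ] B
  /-- `π(u)(a) = u₀a` -/
  anchor : B →ₗ[ℂ] Derivation ℂ A A
  /-- the pairing `⟨u, v⟩ = u₁v` -/
  pair : B →ₗ[ℂ] B →ₗ[ℂ] A
  /-- the map `∂` -/
  der : A →ₗ[ℂ] B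
  one_act : ∀ x, act 1 x = x
  leibniz : ∀ x y z, br x (br y z) = br (br x y) z + br y (br x z)
  anchor_br : ∀ x y, anchor (br x y) = ⁅anchor x, anchor y⁆
  pair_comm : ∀ x y, pair x y = pair y x
  anchor_der : ∀ a, anchor (der a) = 0
  act_act : ∀ a a' x, act a (act a' x) - act (a * a') x
    = act (anchor x a) (der a') + act (anchor x a') (der a)
  br_act : ∀ x a y, br x (act a y) = act (anchor x a) y + act a (br x y)
  br_add_br : ∀ x y, br x y + br y x = der (pair x y)
  anchor_act : ∀ a x, anchor (act a x) = a • anchor x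
  pair_act : ∀ a x y, pair (act a x) y = a * pair x y - anchor x (anchor y a)
  anchor_pair : ∀ x y z, anchor x (pair y z) = pair (br x y) z + pair y (br x z)
  der_mul : ∀ a a', der (a * a') = act a (der a') + act a' (der a)
  br_der : ∀ x a, br x (der a) = der (anchor x a)
  pair_der : ∀ x a, pair x (der a) = anchor x a

namespace VertexAlgebroid

variable (A : Type u) (B : Type v) [CommRing A] [Algebra ℂ A]
  [AddCommGroup B] [Module ℂ B] [VertexAlgebroid A B]

/-- The powers `b¹ = b`, `bᵏ⁺¹ = [b, bᵏ]`; `power A b k` is `bᵏ⁺¹`. -/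
def power {B : Type v} [AddCommGroup B] [Module ℂ B] [VertexAlgebroid A B] (b : B) : ℕ → B
  | 0 => b
  | k + 1 => br A b (power b k)

/-- `b` generates the left Leibniz algebra `B` as a cyclic Leibniz algebra. -/
def IsGenerator {B : Type v} [AddCommGroup B] [Module ℂ B] [VertexAlgebroid A B] (b : B) : Prop :=
  Submodule.span ℂ (Set.range (power A b)) = ⊤

/-- The left Leibniz algebra `B` is a Lie algebra, i.e. its bracket is alternating. -/
def IsLie : Prop := ∀ x : B, br A x x = 0

/-- The subspace `A∂(A)`, the span of all `a · ∂(a')`. -/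
def AdA : Submodule ℂ B :=
  Submodule.span ℂ (Set.range fun p : A × A => act p.1 (der (B := B) p.2))

variable {A B}

theorem act_der_mem (a a' : A) : act a (der a') ∈ AdA A B :=
  Submodule.subset_span ⟨(a, a'), rfl⟩

theorem der_mem (a : A) : der a ∈ AdA A B := by
  have := act_der_mem (B := B) 1 a
  rwa [one_act] at this

theorem act_mem (a : A) {x : B} (hx : x ∈ AdA A B) : act a x ∈ AdA A B := by
  refine (Submodule.span_le (p := (AdA A B).comap (act a))).2 ?_ hx
  rintro _ ⟨⟨c, d⟩, rfl⟩
  have h := act_act a c (der (B := B) d)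
  simp only [anchor_der, Derivation.coe_zero, Pi.zero_apply, map_zero, LinearMap.zero_apply,
    add_zero, sub_eq_zero] at h
  simpa [h] using act_der_mem (B := B) (a * c) d

theorem br_mem_right (y : B) {x : B} (hx : x ∈ AdA A B) : br A y x ∈ AdA A B := by
  refine (Submodule.span_le (p := (AdA A B).comap (br A y))).2 ?_ hx
  rintro _ ⟨⟨c, d⟩, rfl⟩
  simpa [br_act, br_der] using add_mem (act_der_mem _ _) (act_der_mem (B := B) _ _)

theorem br_mem_left {x : B} (hx : x ∈ AdA A B) (y : B) : br A x y ∈ AdA A B := by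
  rw [eq_sub_of_add_eq (br_add_br (A := A) x y)]
  exact sub_mem (der_mem _) (br_mem_right y hx)

theorem anchor_eq_zero {x : B} (hx : x ∈ AdA A B) : anchor (A := A) x = 0 := by
  refine (Submodule.span_le (p := LinearMap.ker (anchor (A := A) (B := B)))).2 ?_ hx
  rintro _ ⟨⟨c, d⟩, rfl⟩
  simp [anchor_act, anchor_der]

theorem br_der_left (a : A) (y : B) : br A (der a) y = 0 := by
  have h := br_add_br (A := A) (der a) y
  rw [br_der, pair_comm, pair_der] at h
  simpa using h

end VertexAlgebroid

open VertexAlgebroid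

/-! ### The Lie `A`-algebroid `B / A∂(A)` -/

section LieQuot

variable (A : Type u) (B : Type v) [CommRing A] [Algebra ℂ A]
  [AddCommGroup B] [Module ℂ B] [VertexAlgebroid A B]

/-- The quotient `B / A∂(A)`. -/
def LieQuot : Type v := B ⧸ AdA A B

namespace LieQuot

instance : AddCommGroup (LieQuot A B) := inferInstanceAs (AddCommGroup (B ⧸ AdA A B))
instance : Module ℂ (LieQuot A B) := inferInstanceAs (Module ℂ (B ⧸ AdA A B))

/-- The projection `B → B / A∂(A)`. -/
def mk : B →ₗ[ℂ] LieQuot A B := (AdA A B).mkQ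

theorem mk_surjective : Function.Surjective (mk A B) := (AdA A B).mkQ_surjective

variable {A B} in
theorem mk_eq_zero {x : B} : mk A B x = 0 ↔ x ∈ AdA A B := Submodule.Quotient.mk_eq_zero _

/-- The bracket induced on `B / A∂(A)`. -/
def brQ : LieQuot A B →ₗ[ℂ] LieQuot A B →ₗ[ℂ] LieQuot A B :=
  ((AdA A B).liftQ ((AdA A B).liftQ ((br A).compr₂ (mk A B)) (fun x hx => by
    ext y; exact mk_eq_zero.2 (br_mem_left hx y))).flip (fun y hy => by
    refine LinearMap.ext fun x => ?_
    obtain ⟨x, rfl⟩ := mk_surjective A B x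
    exact mk_eq_zero.2 (br_mem_right x hy))).flip

/-- The action of `A` induced on `B / A∂(A)`. -/
def actQ : A →ₗ[ℂ] LieQuot A B →ₗ[ℂ] LieQuot A B :=
  ((AdA A B).liftQ ((act (A := A)).compr₂ (mk A B)).flip (fun y hy => by
    ext a; exact mk_eq_zero.2 (act_mem a hy))).flip

/-- The action of `B / A∂(A)` on `A` by derivations. -/
def anchorQ : LieQuot A B →ₗ[ℂ] Derivation ℂ A A :=
  (AdA A B).liftQ (anchor (A := A)) (fun _ hx => anchor_eq_zero hx)

@[simp] theorem brQ_mk (x y : B) : brQ A B (mk A B x) (mk A B y) = mk A B (br A x y) := rfl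
@[simp] theorem actQ_mk (a : A) (x : B) : actQ A B a (mk A B x) = mk A B (act a x) := rfl
@[simp] theorem anchorQ_mk (x : B) : anchorQ A B (mk A B x) = anchor x := rfl

theorem brQ_skew (x y : LieQuot A B) : brQ A B x y + brQ A B y x = 0 := by
  obtain ⟨x, rfl⟩ := mk_surjective A B x
  obtain ⟨y, rfl⟩ := mk_surjective A B y
  rw [brQ_mk, brQ_mk, ← map_add, br_add_br]
  exact mk_eq_zero.2 (der_mem _)

instance : LieRing (LieQuot A B) where
  bracket x y := brQ A B x y
  add_lie x y z := LinearMap.map_add₂ (brQ A B) x y z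
  lie_add x y z := map_add (brQ A B x) y z
  lie_self x := by
    have h := brQ_skew A B x x
    rw [← two_smul ℂ] at h
    exact (smul_eq_zero.1 h).resolve_left two_ne_zero
  leibniz_lie x y z := by
    obtain ⟨x, rfl⟩ := mk_surjective A B x
    obtain ⟨y, rfl⟩ := mk_surjective A B y
    obtain ⟨z, rfl⟩ := mk_surjective A B z
    change mk A B (br A x (br A y z)) = mk A B (br A (br A x y) z) + mk A B (br A y (br A x z))
    rw [leibniz (A := A) x y z, map_add]

instance : LieAlgebra ℂ (LieQuot A B) where
  lie_smul c x y := map_smul (brQ A B x) c y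

instance : Module A (LieQuot A B) where
  smul a x := actQ A B a x
  one_smul x := by
    obtain ⟨x, rfl⟩ := mk_surjective A B x
    exact congrArg (mk A B) (one_act x)
  mul_smul a a' x := by
    obtain ⟨x, rfl⟩ := mk_surjective A B x
    refine (sub_eq_zero.1 ?_).symm
    change mk A B (act a (act a' x)) - mk A B (act (a * a') x) = 0
    rw [← map_sub, act_act]
    exact mk_eq_zero.2 (add_mem (act_der_mem _ _) (act_der_mem _ _))
  smul_zero a := map_zero (actQ A B a)
  smul_add a x y := map_add (actQ A B a) x y
  add_smul a a' x := LinearMap.map_add₂ (actQ A B) a a' x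
  zero_smul x := LinearMap.map_zero₂ (actQ A B) x

instance : LieRingModule (LieQuot A B) A where
  bracket x a := anchorQ A B x a
  add_lie x y a := by
    change anchorQ A B (x + y) a = anchorQ A B x a + anchorQ A B y a
    simp
  lie_add x a a' := map_add (anchorQ A B x) a a'
  leibniz_lie x y a := by
    obtain ⟨x, rfl⟩ := mk_surjective A B x
    obtain ⟨y, rfl⟩ := mk_surjective A B y
    change anchor x (anchor y a) = anchor (br A x y) a + anchor y (anchor x a)
    simp [anchor_br, Derivation.commutator_apply]

theorem lie_mk (x y : B) : ⁅mk A B x, mk A B y⁆ = mk A B (br A x y) := rfl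
theorem smul_mk (a : A) (x : B) : a • mk A B x = mk A B (act a x) := rfl
theorem mk_lie (x : B) (a : A) : ⁅mk A B x, a⁆ = anchor x a := rfl

instance : LieRinehartRing A (LieQuot A B) where
  lie_smul_eq_mul' a a' x := by
    obtain ⟨x, rfl⟩ := mk_surjective A B x
    simp [smul_mk, mk_lie, anchor_act]
  leibniz_mul_right' x a a' := by
    obtain ⟨x, rfl⟩ := mk_surjective A B x
    simp [mk_lie, mul_comm]
  leibniz_smul_right' x y a := by
    obtain ⟨x, rfl⟩ := mk_surjective A B x
    obtain ⟨y, rfl⟩ := mk_surjective A B y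
    simp only [smul_mk, lie_mk, mk_lie, br_act, map_add]
    exact add_comm _ _

instance : LieRinehartAlgebra ℂ A (LieQuot A B) where
  smul_assoc c a x := LinearMap.map_smul₂ (actQ A B) c a x
  smul_lie c x a := by
    change anchorQ A B (c • x) a = c • anchorQ A B x a
    simp
  lie_smul c x a := by
    change anchorQ A B x (c • a) = c • anchorQ A B x a
    simp

end LieQuot

end LieQuot

/-! ### Modules of Lie `A`-algebroids -/

/-- A module structure on the complex vector space `U` over the Lie `A`-algebroid `g`
(Lie `A`-algebroids are the Lie–Rinehart algebras over `ℂ`). -/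
structure LieAlgebroidModule (A : Type u) (g : Type v) [CommRing A] [Algebra ℂ A]
    [LieRing g] [LieAlgebra ℂ g] [Module A g] [LieRingModule g A] [LieRinehartRing A g]
    [LieRinehartAlgebra ℂ A g] (U : Type w) [AddCommGroup U] [Module ℂ U] where
  /-- the action of `A` -/
  aAct : A →ₐ[ℂ] Module.End ℂ U
  /-- the action of the Lie algebra `g` -/
  gAct : g →ₗ[ℂ] Module.End ℂ U
  gAct_lie : ∀ (x x' : g) (y : U),
    gAct ⁅x, x'⁆ y = gAct x (gAct x' y) - gAct x' (gAct x y)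
  gAct_aAct : ∀ (x : g) (a : A) (y : U), gAct x (aAct a y) - aAct a (gAct x y) = aAct ⁅x, a⁆ y
  aAct_gAct : ∀ (x : g) (a : A) (y : U), aAct a (gAct x y) = gAct (a • x) y

namespace LieAlgebroidModule

variable {A : Type u} {g : Type v} [CommRing A] [Algebra ℂ A]
    [LieRing g] [LieAlgebra ℂ g] [Module A g] [LieRingModule g A] [LieRinehartRing A g]
    [LieRinehartAlgebra ℂ A g] {U : Type w} [AddCommGroup U] [Module ℂ U]
    {U' : Type*} [AddCommGroup U'] [Module ℂ U']

/-- `U` is a nonzero module without proper nonzero submodules. -/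
def IsIrreducible (ρ : LieAlgebroidModule A g U) : Prop :=
  Nontrivial U ∧ ∀ N : Submodule ℂ U,
    (∀ a, ∀ y ∈ N, ρ.aAct a y ∈ N) → (∀ x, ∀ y ∈ N, ρ.gAct x y ∈ N) → N = ⊥ ∨ N = ⊤

/-- The two modules are isomorphic. -/
def Iso (ρ : LieAlgebroidModule A g U) (ρ' : LieAlgebroidModule A g U') : Prop :=
  ∃ f : U ≃ₗ[ℂ] U', (∀ a y, f (ρ.aAct a y) = ρ'.aAct a (f y)) ∧
    ∀ x y, f (ρ.gAct x y) = ρ'.gAct x (f y)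

end LieAlgebroidModule

/-! ### Vertex algebras and their modules -/

/-- The Jacobi identity, in terms of the modes `uₙ = ncoeff (Y u) n`: the coefficient form of
`z₀⁻¹δ((z₁-z₂)/z₀) Y(u,z₁)Y(v,z₂)w - z₀⁻¹δ((z₂-z₁)/(-z₀)) Y(v,z₂)Y(u,z₁)w
  = z₂⁻¹δ((z₁-z₀)/z₂) Y(Y(u,z₀)v,z₂)w`.
All sums are finite, since vertex operators have values in Laurent series. -/
def JacobiIdentity {V : Type v} [AddCommGroup V] [Module ℂ V] {W : Type w} [AddCommGroup W]
    [Module ℂ W] (Y : V →ₗ[ℂ] VertexOperator ℂ V) (YW : V →ₗ[ℂ] VertexOperator ℂ W) : Prop :=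
  ∀ (x y : V) (z : W) (l m n : ℤ),
    ∑ᶠ i : ℕ, ((-1) ^ i * Ring.choose l i : ℤ) •
      (ncoeff (YW x) (m + l - i) (ncoeff (YW y) (n + i) z)
        - (l.negOnePow : ℤ) • ncoeff (YW y) (n + l - i) (ncoeff (YW x) (m + i) z))
    = ∑ᶠ i : ℕ, (Ring.choose m i : ℤ) • ncoeff (YW (ncoeff (Y x) (l + i) y)) (m + n - i) z

/-- A vertex algebra structure on the complex vector space `V`. -/
structure VertexAlgebra (V : Type v) [AddCommGroup V] [Module ℂ V] where
  /-- the state-field correspondence -/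
  Y : V →ₗ[ℂ] VertexOperator ℂ V
  /-- the vacuum vector -/
  vac : V
  Y_vac : ∀ (n : ℤ) (x : V), ncoeff (Y vac) n x = if n = -1 then x else 0
  creation : ∀ x : V, ncoeff (Y x) (-1) vac = x
  creation_nonneg : ∀ (x : V) (n : ℤ), 0 ≤ n → ncoeff (Y x) n vac = 0
  jacobi : JacobiIdentity Y Y

/-- A module structure on the complex vector space `W` over the vertex algebra `𝒱`. -/
structure VertexModule {V : Type v} [AddCommGroup V] [Module ℂ V] (𝒱 : VertexAlgebra V)
    (W : Type w) [AddCommGroup W] [Module ℂ W] where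
  /-- the vertex operators on `W` -/
  Y : V →ₗ[ℂ] VertexOperator ℂ W
  Y_vac : ∀ (n : ℤ) (x : W), ncoeff (Y 𝒱.vac) n x = if n = -1 then x else 0
  jacobi : JacobiIdentity 𝒱.Y Y

namespace VertexModule

variable {V : Type v} [AddCommGroup V] [Module ℂ V] {𝒱 : VertexAlgebra V}
    {W : Type w} [AddCommGroup W] [Module ℂ W] {W' : Type*} [AddCommGroup W'] [Module ℂ W']

/-- The subspace `N` is a submodule of the `𝒱`-module `W`. -/
def IsSubmodule (M : VertexModule 𝒱 W) (N : Submodule ℂ W) : Prop :=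
  ∀ (x : V) (n : ℤ), ∀ y ∈ N, ncoeff (M.Y x) n y ∈ N

/-- `W` is nonzero and has no proper nonzero submodules. -/
def IsSimple (M : VertexModule 𝒱 W) : Prop :=
  Nontrivial W ∧ ∀ N, M.IsSubmodule N → N = ⊥ ∨ N = ⊤

/-- `W = ⨁ₙ W₍ₙ₎` is an `ℕ`-graded module, where `grV` is the grading of the vertex algebra:
`xₘ W₍ₙ₎ ⊆ W₍ₖ₊ₙ₋ₘ₋₁₎` for `x ∈ V₍ₖ₎`, the components of negative degree being zero. -/
structure IsGraded (M : VertexModule 𝒱 W) (grV : ℕ → Submodule ℂ V)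
    (gr : ℕ → Submodule ℂ W) : Prop where
  isInternal : DirectSum.IsInternal gr
  mode_mem : ∀ (k n p : ℕ) (m : ℤ), (p : ℤ) = k + n - m - 1 → ∀ x ∈ grV k, ∀ y ∈ gr n,
    ncoeff (M.Y x) m y ∈ gr p
  mode_eq_zero : ∀ (k n : ℕ) (m : ℤ), (k : ℤ) + n - m - 1 < 0 → ∀ x ∈ grV k, ∀ y ∈ gr n,
    ncoeff (M.Y x) m y = 0

/-- `W` is nonzero and has no proper nonzero graded submodules. -/
def IsGradedSimple (M : VertexModule 𝒱 W) (gr : ℕ → Submodule ℂ W) : Prop :=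
  Nontrivial W ∧ ∀ N, M.IsSubmodule N → N ≤ ⨆ n, N ⊓ gr n → N = ⊥ ∨ N = ⊤

/-- The two `𝒱`-modules are isomorphic. -/
def Iso (M : VertexModule 𝒱 W) (M' : VertexModule 𝒱 W') : Prop :=
  ∃ f : W ≃ₗ[ℂ] W', ∀ x n y, f (ncoeff (M.Y x) n y) = ncoeff (M'.Y x) n (f y)

/-- The two graded `𝒱`-modules are isomorphic by an isomorphism that preserves degrees. -/
def GradedIso (M : VertexModule 𝒱 W) (gr : ℕ → Submodule ℂ W)
    (M' : VertexModule 𝒱 W') (gr' : ℕ → Submodule ℂ W') : Prop :=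
  ∃ f : W ≃ₗ[ℂ] W', (∀ x n y, f (ncoeff (M.Y x) n y) = ncoeff (M'.Y x) n (f y)) ∧
    ∀ n, (gr n).map f.toLinearMap = gr' n

end VertexModule

/-! ### The Lie algebra `ℒ = L(A ⊕ B) / ∂̂ L(A)` -/

section Loop

variable (A : Type u) (B : Type v) [CommRing A] [Algebra ℂ A]
  [AddCommGroup B] [Module ℂ B] [VertexAlgebroid A B]

/-- `L(A ⊕ B) = (A ⊕ B) ⊗ ℂ[t, t⁻¹]`; the element `x ⊗ tⁿ` is `Finsupp.single n x`. -/
abbrev LoopAB : Type (max u v) := ℤ →₀ (A × B)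

/-- The product `x₀y` on `A ⊕ B`. -/
def prod0 : (A × B) →ₗ[ℂ] (A × B) →ₗ[ℂ] (A × B) :=
  LinearMap.mk₂ ℂ (fun x y => (anchor x.2 y.1 - anchor y.2 x.1, br A x.2 y.2))
    (fun x x' y => by ext <;> simp; ring)
    (fun c x y => by ext <;> simp [smul_sub])
    (fun x y y' => by ext <;> simp; ring)
    (fun c x y => by ext <;> simp [smul_sub])

/-- The product `x₁y` on `A ⊕ B`. -/
def prod1 : (A × B) →ₗ[ℂ] (A × B) →ₗ[ℂ] (A × B) :=
  LinearMap.mk₂ ℂ (fun x y => (pair x.2 y.2, 0))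
    (fun x x' y => by ext <;> simp)
    (fun c x y => by ext <;> simp)
    (fun x y y' => by ext <;> simp)
    (fun c x y => by ext <;> simp)

/-- The bracket on `L(A ⊕ B)`, see `loopBr_single`. -/
def loopBr : LoopAB A B →ₗ[ℂ] LoopAB A B →ₗ[ℂ] LoopAB A B :=
  Finsupp.lsum ℂ fun m : ℤ => LinearMap.flip (Finsupp.lsum ℂ fun n : ℤ => LinearMap.flip
    ((prod0 A B).compr₂ (Finsupp.lsingle (m + n))
      + (m : ℂ) • (prod1 A B).compr₂ (Finsupp.lsingle (m + n - 1))))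

theorem loopBr_single (m n : ℤ) (x y : A × B) :
    loopBr A B (Finsupp.single m x) (Finsupp.single n y)
      = Finsupp.single (m + n) (prod0 A B x y)
        + (m : ℂ) • Finsupp.single (m + n - 1) (prod1 A B x y) := by
  simp [loopBr]

/-- `∂̂ = ∂ ⊗ 1 + 1 ⊗ d/dt : L(A) → L(A ⊕ B)`. -/
def dHat : (ℤ →₀ A) →ₗ[ℂ] LoopAB A B :=
  Finsupp.lsum ℂ fun n : ℤ =>
    Finsupp.lsingle n ∘ₗ LinearMap.inr ℂ A B ∘ₗ der
      + (n : ℂ) • Finsupp.lsingle (n - 1) ∘ₗ LinearMap.inl ℂ A B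

theorem dHat_single (n : ℤ) (a : A) :
    dHat A B (Finsupp.single n a)
      = Finsupp.single n (0, der a) + (n : ℂ) • Finsupp.single (n - 1) (a, 0) := by
  rw [dHat, Finsupp.lsum_single]
  simp

variable {A B}

@[simp] theorem prod0_apply (x y : A × B) :
    prod0 A B x y = (anchor x.2 y.1 - anchor y.2 x.1, br A x.2 y.2) := rfl

@[simp] theorem prod1_apply (x y : A × B) : prod1 A B x y = (pair x.2 y.2, 0) := rfl

theorem prod0_prod0 (x y z : A × B) : prod0 A B x (prod0 A B y z)
    = prod0 A B (prod0 A B x y) z + prod0 A B y (prod0 A B x z) := by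
  ext
  · simp [anchor_br, Derivation.commutator_apply]; ring
  · simp [leibniz (A := A) x.2 y.2 z.2]

theorem prod0_prod1 (x y z : A × B) : prod0 A B x (prod1 A B y z)
    = prod1 A B (prod0 A B x y) z + prod1 A B y (prod0 A B x z) := by
  ext
  · simp [anchor_pair]
  · simp

theorem prod1_prod0 (x y z : A × B) : prod1 A B x (prod0 A B y z)
    = prod1 A B (prod0 A B x y) z + prod0 A B (prod1 A B x y) z
      + prod0 A B y (prod1 A B x z) := by
  ext
  · have h : br A y.2 x.2 = der (pair (A := A) x.2 y.2) - br A x.2 y.2 := by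
      rw [← br_add_br (A := A) x.2 y.2]; abel
    simp [anchor_pair y.2 x.2 z.2, h, pair_comm (der _) z.2, pair_der]; ring
  · simp

theorem loopBr_leibniz (x y z : LoopAB A B) :
    loopBr A B x (loopBr A B y z)
      = loopBr A B (loopBr A B x y) z + loopBr A B y (loopBr A B x z) := by
  induction x using Finsupp.induction_linear with
  | zero => simp
  | add x x' hx hx' => simp only [map_add, LinearMap.add_apply, hx, hx']; abel
  | single m x =>
  induction y using Finsupp.induction_linear with
  | zero => simp
  | add y y' hy hy' => simp only [map_add, LinearMap.add_apply, hy, hy']; abel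
  | single n y =>
  induction z using Finsupp.induction_linear with
  | zero => simp
  | add z z' hz hz' => simp only [map_add, hz, hz']; abel
  | single k z =>
  have e1 : prod1 A B x (prod1 A B y z) = 0 := by ext <;> simp
  have e2 : prod1 A B (prod1 A B x y) z = 0 := by ext <;> simp
  have e3 : prod1 A B y (prod1 A B x z) = 0 := by ext <;> simp
  simp only [loopBr_single, map_add, map_smul, LinearMap.add_apply, LinearMap.smul_apply,
    e1, e2, e3, prod0_prod0 x y z, prod0_prod1 x y z, prod1_prod0 x y z,
    Finsupp.single_zero, smul_zero, add_zero, Finsupp.single_add, smul_add]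
  rw [show m + (n + k) = m + n + k by ring, show n + (m + k) = m + n + k by ring,
    show m + (n + k - 1) = m + n + k - 1 by ring, show n + (m + k - 1) = m + n + k - 1 by ring,
    show m + n - 1 + k = m + n + k - 1 by ring]
  push_cast
  module

theorem loopBr_dHat_left (x : ℤ →₀ A) (y : LoopAB A B) : loopBr A B (dHat A B x) y = 0 := by
  induction x using Finsupp.induction_linear with
  | zero => simp
  | add x x' hx hx' => simp only [map_add, LinearMap.add_apply, hx, hx', add_zero]
  | single m x =>
  induction y using Finsupp.induction_linear with
  | zero => simp
  | add y y' hy hy' => simp only [map_add, hy, hy', add_zero]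
  | single n y =>
  have e1 : prod0 A B (0, der x) y = 0 := by ext <;> simp [anchor_der, br_der_left]
  have e2 : prod1 A B (0, der x) y = (anchor y.2 x, 0) := by
    simp [pair_comm (der x), pair_der]
  have e3 : prod0 A B (x, 0) y = - (anchor y.2 x, 0) := by ext <;> simp
  have e4 : prod1 A B (x, 0) y = 0 := by ext <;> simp
  simp only [dHat_single, map_add, map_smul, LinearMap.add_apply, LinearMap.smul_apply,
    loopBr_single, e1, e2, e3, e4, Finsupp.single_zero, smul_zero, add_zero, zero_add,
    Finsupp.single_neg]
  rw [show m - 1 + n = m + n - 1 by ring]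
  module

theorem loopBr_dHat_right (x : LoopAB A B) (y : ℤ →₀ A) :
    loopBr A B x (dHat A B y) ∈ LinearMap.range (dHat A B) := by
  induction x using Finsupp.induction_linear with
  | zero => simp
  | add x x' hx hx' => simpa only [map_add, LinearMap.add_apply] using add_mem hx hx'
  | single m x =>
  induction y using Finsupp.induction_linear with
  | zero => simp
  | add y y' hy hy' => simpa only [map_add] using add_mem hy hy'
  | single n y =>
  refine ⟨Finsupp.single (m + n) (anchor x.2 y), ?_⟩
  have e1 : prod0 A B x (0, der y) = (0, der (anchor x.2 y)) := by
    simp [anchor_der, br_der]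
  have e2 : prod1 A B x (0, der y) = (anchor x.2 y, 0) := by simp [pair_der]
  have e3 : prod0 A B x (y, 0) = (anchor x.2 y, 0) := by simp
  have e4 : prod1 A B x (y, 0) = 0 := by ext <;> simp
  simp only [dHat_single, map_add, map_smul, loopBr_single, e1, e2, e3, e4,
    Finsupp.single_zero, smul_zero, add_zero]
  rw [show m + (n - 1) = m + n - 1 by ring]
  push_cast
  module

theorem loopBr_skew (x y : LoopAB A B) :
    loopBr A B x y + loopBr A B y x ∈ LinearMap.range (dHat A B) := by
  induction x using Finsupp.induction_linear with
  | zero => simp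
  | add x x' hx hx' =>
    simpa only [map_add, LinearMap.add_apply, add_add_add_comm] using add_mem hx hx'
  | single m x =>
  induction y using Finsupp.induction_linear with
  | zero => simp
  | add y y' hy hy' =>
    simpa only [map_add, LinearMap.add_apply, add_add_add_comm] using add_mem hy hy'
  | single n y =>
  refine ⟨Finsupp.single (m + n) (pair x.2 y.2), ?_⟩
  have e1 : prod0 A B y x = (0, der (pair (A := A) x.2 y.2)) - prod0 A B x y := by
    ext
    · simp
    · simp [← br_add_br (A := A) x.2 y.2]
  have e2 : prod1 A B y x = (pair x.2 y.2, 0) := by simp [pair_comm y.2]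
  have e3 : prod1 A B x y = (pair x.2 y.2, 0) := rfl
  rw [dHat_single, loopBr_single, loopBr_single, e1, e2, e3, Finsupp.single_sub,
    show n + m = m + n by ring]
  push_cast
  module

variable (A B)

/-- `ℒ = L(A ⊕ B) / ∂̂ L(A)`. -/
def LieL : Type (max u v) := LoopAB A B ⧸ LinearMap.range (dHat A B)

namespace LieL

instance : AddCommGroup (LieL A B) :=
  inferInstanceAs (AddCommGroup (LoopAB A B ⧸ LinearMap.range (dHat A B)))
instance : Module ℂ (LieL A B) :=
  inferInstanceAs (Module ℂ (LoopAB A B ⧸ LinearMap.range (dHat A B)))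

/-- The projection `L(A ⊕ B) → ℒ`. -/
def mk : LoopAB A B →ₗ[ℂ] LieL A B := (LinearMap.range (dHat A B)).mkQ

theorem mk_surjective : Function.Surjective (mk A B) :=
  (LinearMap.range (dHat A B)).mkQ_surjective

variable {A B} in
theorem mk_eq_zero {x : LoopAB A B} : mk A B x = 0 ↔ x ∈ LinearMap.range (dHat A B) :=
  Submodule.Quotient.mk_eq_zero _

/-- The bracket of `ℒ`. -/
def brL : LieL A B →ₗ[ℂ] LieL A B →ₗ[ℂ] LieL A B :=
  ((LinearMap.range (dHat A B)).liftQ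
    ((LinearMap.range (dHat A B)).liftQ ((loopBr A B).compr₂ (mk A B)) (by
      rintro _ ⟨x, rfl⟩
      refine LinearMap.ext fun y => ?_
      change mk A B (loopBr A B (dHat A B x) y) = 0
      rw [loopBr_dHat_left, map_zero])).flip (by
    rintro _ ⟨y, rfl⟩
    refine LinearMap.ext fun x => ?_
    obtain ⟨x, rfl⟩ := mk_surjective A B x
    exact mk_eq_zero.2 (loopBr_dHat_right x y))).flip

theorem brL_mk (x y : LoopAB A B) :
    brL A B (mk A B x) (mk A B y) = mk A B (loopBr A B x y) := rfl

theorem brL_self (x : LieL A B) : brL A B x x = 0 := by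
  obtain ⟨x, rfl⟩ := mk_surjective A B x
  have h : mk A B (loopBr A B x x + loopBr A B x x) = 0 := mk_eq_zero.2 (loopBr_skew x x)
  rw [map_add, ← two_smul ℂ] at h
  exact (smul_eq_zero.1 h).resolve_left two_ne_zero

instance : LieRing (LieL A B) where
  bracket x y := brL A B x y
  add_lie x y z := LinearMap.map_add₂ (brL A B) x y z
  lie_add x y z := map_add (brL A B x) y z
  lie_self x := brL_self A B x
  leibniz_lie x y z := by
    obtain ⟨x, rfl⟩ := mk_surjective A B x
    obtain ⟨y, rfl⟩ := mk_surjective A B y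
    obtain ⟨z, rfl⟩ := mk_surjective A B z
    change mk A B (loopBr A B x (loopBr A B y z))
      = mk A B (loopBr A B (loopBr A B x y) z) + mk A B (loopBr A B y (loopBr A B x z))
    rw [loopBr_leibniz x y z, map_add]

instance : LieAlgebra ℂ (LieL A B) where
  lie_smul c x y := map_smul (brL A B x) c y

theorem lie_mk (x y : LoopAB A B) : ⁅mk A B x, mk A B y⁆ = mk A B (loopBr A B x y) := rfl

/-- `-d/dt` on `L(A ⊕ B)`. -/
def loopD : LoopAB A B →ₗ[ℂ] LoopAB A B :=
  Finsupp.lsum ℂ fun n : ℤ => (-n : ℂ) • Finsupp.lsingle (n - 1)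

theorem loopD_single (n : ℤ) (x : A × B) :
    loopD A B (Finsupp.single n x) = (-n : ℂ) • Finsupp.single (n - 1) x := by
  rw [loopD, Finsupp.lsum_single]; rfl

theorem loopD_loopBr (x y : LoopAB A B) :
    loopD A B (loopBr A B x y) = loopBr A B (loopD A B x) y + loopBr A B x (loopD A B y) := by
  induction x using Finsupp.induction_linear with
  | zero => simp
  | add x x' hx hx' => simp only [map_add, LinearMap.add_apply, hx, hx']; abel
  | single m x =>
  induction y using Finsupp.induction_linear with
  | zero => simp
  | add y y' hy hy' => simp only [map_add, hy, hy']; abel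
  | single n y =>
  simp only [loopBr_single, loopD_single, map_add, map_smul, LinearMap.smul_apply]
  rw [show m - 1 + n = m + n - 1 by ring, show m + (n - 1) = m + n - 1 by ring]
  push_cast
  module

theorem loopD_dHat (x : ℤ →₀ A) : loopD A B (dHat A B x) ∈ LinearMap.range (dHat A B) := by
  induction x using Finsupp.induction_linear with
  | zero => simp
  | add x x' hx hx' => simpa only [map_add] using add_mem hx hx'
  | single n a =>
  refine ⟨(-n : ℂ) • Finsupp.single (n - 1) a, ?_⟩
  simp only [dHat_single, loopD_single, map_add, map_smul]
  push_cast
  module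

/-- The derivation `-d/dt` of `ℒ`. -/
def D : LieL A B →ₗ[ℂ] LieL A B :=
  (LinearMap.range (dHat A B)).mapQ (LinearMap.range (dHat A B)) (loopD A B) (by
    rintro _ ⟨x, rfl⟩; exact loopD_dHat A B x)

theorem D_mk (x : LoopAB A B) : D A B (mk A B x) = mk A B (loopD A B x) := rfl

theorem D_lie (x y : LieL A B) : D A B ⁅x, y⁆ = ⁅D A B x, y⁆ + ⁅x, D A B y⁆ := by
  obtain ⟨x, rfl⟩ := mk_surjective A B x
  obtain ⟨y, rfl⟩ := mk_surjective A B y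
  simp only [lie_mk, D_mk, loopD_loopBr, map_add]

end LieL

end Loop

/-! ### The vertex algebra `V_B` -/

section VB

variable (A : Type u) (B : Type v) [CommRing A] [Algebra ℂ A]
  [AddCommGroup B] [Module ℂ B] [VertexAlgebroid A B]

/-- The universal enveloping algebra `U(ℒ)`. -/
abbrev UL : Type (max u v) := UniversalEnvelopingAlgebra ℂ (LieL A B)

/-- The element `x(n)` of `U(ℒ)`, for `x ∈ A ⊕ B`. -/
def md (x : A × B) (n : ℤ) : UL A B :=
  UniversalEnvelopingAlgebra.ι ℂ (LieL.mk A B (Finsupp.single n x))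

variable {A B}

/-- `IsMonomial d p`: `p` is a product of elements `a(n)`, of degree `-n-1`, and `b(n)`,
of degree `-n`, with total degree `d`. -/
inductive IsMonomial : ℤ → UL A B → Prop
  | one : IsMonomial 0 1
  | mulA (a : A) (n d : ℤ) (p : UL A B) (h : IsMonomial d p) :
      IsMonomial (d - n - 1) (md A B (a, 0) n * p)
  | mulB (b : B) (n d : ℤ) (p : UL A B) (h : IsMonomial d p) :
      IsMonomial (d - n) (md A B (0, b) n * p)

variable (A B)

section Deriv

attribute [local instance 100] LieRing.ofAssociativeRing

/-- The homomorphism `p ↦ p + ε D(p)` from `U(ℒ)` to `U(ℒ)[ε]`, where `D` is the derivation of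
`U(ℒ)` that extends the derivation `-d/dt` of `ℒ`. -/
def ULDual : UL A B →ₐ[ℂ] DualNumber (UL A B) :=
  UniversalEnvelopingAlgebra.lift ℂ
    { toFun := fun x => (TrivSqZeroExt.inl (UniversalEnvelopingAlgebra.ι ℂ x)
        + TrivSqZeroExt.inr (UniversalEnvelopingAlgebra.ι ℂ (LieL.D A B x)) :
          DualNumber (UL A B))
      map_add' := fun x y => by ext <;> simp
      map_smul' := fun c x => by ext <;> simp
      map_lie' := fun {x y} => by
        ext
        · simp [LieRing.of_associative_ring_bracket]
        · simp only [LieL.D_lie, LieHom.map_lie, LieRing.of_associative_ring_bracket, map_add,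
            TrivSqZeroExt.snd_add, TrivSqZeroExt.snd_sub, TrivSqZeroExt.snd_mul,
            TrivSqZeroExt.fst_add, TrivSqZeroExt.fst_inl, TrivSqZeroExt.fst_inr,
            TrivSqZeroExt.snd_inl, TrivSqZeroExt.snd_inr, smul_eq_mul, op_smul_eq_mul,
            zero_add, add_zero]
          abel }

theorem ULDual_ι (x : LieL A B) :
    ULDual A B (UniversalEnvelopingAlgebra.ι ℂ x)
      = TrivSqZeroExt.inl (UniversalEnvelopingAlgebra.ι ℂ x)
        + TrivSqZeroExt.inr (UniversalEnvelopingAlgebra.ι ℂ (LieL.D A B x)) := by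
  rw [ULDual, UniversalEnvelopingAlgebra.lift_ι_apply]; rfl

theorem fst_ULDual (p : UL A B) : (ULDual A B p).fst = p := by
  have h : (TrivSqZeroExt.fstHom ℂ (UL A B) (UL A B)).comp (ULDual A B) = AlgHom.id ℂ _ := by
    apply UniversalEnvelopingAlgebra.hom_ext
    ext x
    simp only [LieHom.comp_apply, AlgHom.coe_toLieHom, AlgHom.comp_apply, ULDual_ι]
    simp
  exact DFunLike.congr_fun h p

end Deriv

/-- The derivation `D` of `U(ℒ)` that extends the derivation `-d/dt` of `ℒ`. -/
def DU : UL A B →ₗ[ℂ] UL A B where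
  toFun p := (ULDual A B p).snd
  map_add' p q := by simp
  map_smul' c p := by simp

theorem DU_mul (p q : UL A B) : DU A B (p * q) = DU A B p * q + p * DU A B q := by
  simp [DU, fst_ULDual, add_comm]

theorem DU_md (x : A × B) (n : ℤ) : DU A B (md A B x n) = (-n : ℂ) • md A B x (n - 1) := by
  change (ULDual A B (UniversalEnvelopingAlgebra.ι ℂ _)).snd = _
  rw [ULDual_ι, LieL.D_mk, LieL.loopD_single, map_smul, map_smul]
  simp only [TrivSqZeroExt.snd_add, TrivSqZeroExt.snd_inl, TrivSqZeroExt.snd_inr, zero_add, md]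

/-- The left ideal `U(ℒ) ℒ^{≥0}`. -/
def idealNonneg : Submodule (UL A B) (UL A B) :=
  Submodule.span (UL A B) {p | ∃ (x : A × B) (n : ℤ), 0 ≤ n ∧ p = md A B x n}

/-- `V_ℒ = U(ℒ) ⊗_{U(ℒ^{≥0})} ℂ = U(ℒ) / U(ℒ) ℒ^{≥0}`, with `ℂ` the trivial module. -/
abbrev VL : Type (max u v) := UL A B ⧸ idealNonneg A B

/-- The vector `𝟏` of `V_ℒ`. -/
def VL.one : VL A B := (idealNonneg A B).mkQ 1

theorem DU_mem {p : UL A B} (hp : p ∈ idealNonneg A B) : DU A B p ∈ idealNonneg A B := by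
  refine Submodule.span_induction ?_ ?_ ?_ ?_ hp
  · rintro _ ⟨x, n, hn, rfl⟩
    rw [DU_md]
    rcases hn.eq_or_lt with rfl | hn
    · simp
    · exact Submodule.smul_of_tower_mem _ _ (Submodule.subset_span ⟨x, n - 1, by omega, rfl⟩)
  · simp
  · intro p q _ _ hp hq
    rw [map_add]; exact add_mem hp hq
  · intro r p hp' hp
    rw [smul_eq_mul, DU_mul]
    exact add_mem (Submodule.smul_mem _ (DU A B r) hp') (Submodule.smul_mem _ r hp)

/-- The operator `D` on `V_ℒ`: `D 𝟏 = 0` and `[D, x(n)] = -n x(n-1)`. -/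
def VL.D : VL A B →ₗ[ℂ] VL A B :=
  ((idealNonneg A B).restrictScalars ℂ).mapQ ((idealNonneg A B).restrictScalars ℂ) (DU A B)
    (fun _ hp => DU_mem A B hp)

theorem VL.D_one : VL.D A B (VL.one A B) = 0 := by
  have h := DU_mul A B 1 1
  simp only [mul_one, one_mul, left_eq_add] at h
  change (idealNonneg A B).mkQ (DU A B 1) = 0
  rw [h, map_zero]

theorem VL.D_md (x : A × B) (n : ℤ) (v : VL A B) :
    VL.D A B (md A B x n • v) = md A B x n • VL.D A B v - (n : ℂ) • md A B x (n - 1) • v := by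
  obtain ⟨p, rfl⟩ := (idealNonneg A B).mkQ_surjective v
  change (idealNonneg A B).mkQ (DU A B (md A B x n * p)) = (idealNonneg A B).mkQ (md A B x n * DU A B p)
    - (n : ℂ) • (idealNonneg A B).mkQ (md A B x (n - 1) * p)
  rw [DU_mul, DU_md, add_comm, map_add, neg_smul, neg_mul, map_neg, ← sub_eq_add_neg,
    smul_mul_assoc]
  rfl

/-- The set of generators of `E = E₀ ⊕ E₁`. -/
def setE : Set (VL A B) :=
  {md A B (1, 0) (-1) • VL.one A B - VL.one A B}
  ∪ {v | ∃ a a' : A, v = md A B (a, 0) (-1) • md A B (a', 0) (-1) • VL.one A B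
      - md A B (a * a', 0) (-1) • VL.one A B}
  ∪ {v | ∃ (a : A) (b : B), v = md A B (a, 0) (-1) • md A B (0, b) (-1) • VL.one A B
      - md A B (0, act a b) (-1) • VL.one A B}

/-- `I_B = U(ℒ) ℂ[D] E`. -/
def idealB : Submodule (UL A B) (VL A B) :=
  Submodule.span (UL A B) {v | ∃ e ∈ setE A B, ∃ k : ℕ, v = (VL.D A B ^ k) e}

/-- `V_B = V_ℒ / I_B`. -/
abbrev VB : Type (max u v) := VL A B ⧸ idealB A B

/-- The vector `𝟏` of `V_B`. -/
def VB.one : VB A B := (idealB A B).mkQ (VL.one A B)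

/-- The component of degree `n` of `V_B`. -/
def VB.gr (n : ℕ) : Submodule ℂ (VB A B) :=
  Submodule.span ℂ {v | ∃ p : UL A B, IsMonomial n p ∧ v = p • VB.one A B}

variable {A B}

/-- The vertex algebra structure is the one of `V_B`: the vacuum vector is `𝟏`, and
`Y(x, z) = ∑ₙ x(n) z⁻ⁿ⁻¹` for `x ∈ A ⊕ B`, where `x` is identified with `x(-1)𝟏`. -/
def IsVBStructure (𝒱 : VertexAlgebra (VB A B)) : Prop :=
  𝒱.vac = VB.one A B ∧ ∀ (x : A × B) (n : ℤ) (v : VB A B),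
    ncoeff (𝒱.Y (md A B x (-1) • VB.one A B)) n v = md A B x n • v

/-! ### The modules `M(U)` and `L(U)` -/

variable {U : Type w} [AddCommGroup U] [Module ℂ U] (ρ : LieAlgebroidModule A (LieQuot A B) U)

/-- The relations of the induced module: `a(-1) ⊗ y = 1 ⊗ ay`, `b(0) ⊗ y = 1 ⊗ by`, while `a(n)`
for `n ≥ 0` and `b(n)` for `n ≥ 1` act on `1 ⊗ U` as zero. -/
def indRel : Submodule (UL A B) (UL A B ⊗[ℂ] U) :=
  Submodule.span (UL A B)
    ({t | ∃ (a : A) (y : U), t = md A B (a, 0) (-1) ⊗ₜ[ℂ] y - 1 ⊗ₜ[ℂ] ρ.aAct a y}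
    ∪ {t | ∃ (b : B) (y : U), t = md A B (0, b) 0 ⊗ₜ[ℂ] y - 1 ⊗ₜ[ℂ] ρ.gAct (LieQuot.mk A B b) y}
    ∪ {t | ∃ (a : A) (n : ℤ) (y : U), 0 ≤ n ∧ t = md A B (a, 0) n ⊗ₜ[ℂ] y}
    ∪ {t | ∃ (b : B) (n : ℤ) (y : U), 1 ≤ n ∧ t = md A B (0, b) n ⊗ₜ[ℂ] y})

/-- `M(U) = U(ℒ) ⊗_{U(ℒ_{≤0})} U`, presented as a quotient of `U(ℒ) ⊗_ℂ U`. -/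
abbrev IndM : Type (max u v w) := (UL A B ⊗[ℂ] U) ⧸ indRel ρ

/-- The subspace `U` (that is, `1 ⊗ U`) of `M(U)`. -/
def IndM.bot : Submodule ℂ (IndM ρ) :=
  Submodule.span ℂ {v | ∃ y : U, v = (indRel ρ).mkQ (1 ⊗ₜ[ℂ] y)}

/-- The component of degree `n` of `M(U)`. -/
def IndM.gr (n : ℕ) : Submodule ℂ (IndM ρ) :=
  Submodule.span ℂ {v | ∃ (p : UL A B) (y : U), IsMonomial n p ∧ v = (indRel ρ).mkQ (p ⊗ₜ[ℂ] y)}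

/-- `J(U)`, the largest graded `U(ℒ)`-submodule of `M(U)` with `J(U) ∩ U = 0`. -/
def maxJ : Submodule (UL A B) (IndM ρ) :=
  sSup {N | N.restrictScalars ℂ ≤ ⨆ n, N.restrictScalars ℂ ⊓ IndM.gr ρ n ∧
    N.restrictScalars ℂ ⊓ IndM.bot ρ = ⊥}

/-- `L(U) = M(U) / J(U)`. -/
abbrev SimpleL : Type (max u v w) := IndM ρ ⧸ maxJ ρ

/-- The component of degree `n` of `L(U)`. -/
def SimpleL.gr (n : ℕ) : Submodule ℂ (SimpleL ρ) :=
  (IndM.gr ρ n).map ((maxJ ρ).mkQ.restrictScalars ℂ)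

/-- The `V_B`-module structure on `L(U)` is the standard one: `Y(x, z) = ∑ₙ x(n) z⁻ⁿ⁻¹` for
`x ∈ A ⊕ B`. -/
def IsLStructure {𝒱 : VertexAlgebra (VB A B)} (M : VertexModule 𝒱 (SimpleL ρ)) : Prop :=
  ∀ (x : A × B) (n : ℤ) (v : SimpleL ρ),
    ncoeff (M.Y (md A B x (-1) • VB.one A B)) n v = md A B x n • v

end VB

end

/-! Algebra. The map `∂` kills idempotents of `A` and `ker ∂ = ℂ`, so the finite-dimensional algebra
`A` has no idempotents besides `0` and `1`: it is local, with residue map `χ : A → ℂ` and nilpotent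
maximal ideal `𝔪`. In characteristic zero a derivation never sends a nilpotent to a unit of a
nonzero ring, so every anchor maps `A` into `𝔪`. Since `[b, b] = ½ ∂⟨b, b⟩` and `[b, ∂a] = ∂(b₀a)`,
we have `B = ℂb + ∂(A)`, and `b ∉ A∂(A)` because `B ≠ A∂(A)`. So `B / A∂(A)` is the line of `b`,
with coordinate `ℓ`. `exists_localSplitting` extracts these data, and everything later depends only
on them. In a nonzero finite-dimensional module of the Lie algebroid the vectors killed by `𝔪` form
a nonzero `b`-stable subspace; an eigenvector of `b` in it spans a submodule (`exists_eigenvector`).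
This gives (1) and (2).

Vertex algebras. Identities involving `(z₁ - z₂)ˡ` for all integers `l` are reduced to `l = 0` by
Pascal's rule and truncation (`eq_zero_of_pascal`). This yields Dong's lemma (`IsLocal.nprod`),
Borcherds' identity for local pairs (`IsLocal.expComm_eq_finsum`) and the reconstruction theorem
(`GeneratingFields.toVertexAlgebra`), which makes `V_B` a vertex algebra. Applied to the product
operators on a space of mutually local fields, reconstruction also gives Li's theorem
(`LocalClosure.vertexAlgebra`). A restricted `ℒ`-module whose fields satisfy the relations of `E`
therefore receives a homomorphism from `V_B` into a vertex algebra of fields on it, which is a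
`V_B`-module structure (`vertexModuleOfRestricted`). Uniqueness holds because `A ⊕ B` generates
`V_B`.

The modules `L(ℂv)`. The induced module `M(ℂv)` maps to a Fock space on which `a(n)` acts as
`δ_{n,-1} χ(a)` and `u(n)` as `ℓ(u)` times a Heisenberg mode of level `k = χ⟨b, b⟩`. This map is
injective on `ℂv` and kills the submodule generated by the vectors `a(n)w`, `a ∈ 𝔪`; that submodule
thus misses `ℂv` and lies in `J` (`md_fst_smul_mem_maxJ`). So on `L(ℂv)` the field of `a` is the
scalar `χ(a)` and that of `u` is `ℓ(u) b(z)`, which makes the relations of `E` evident. Moreover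
`b(0)` acts on all of `L(ℂv)` by the scalar `λ`, so different `λ` give non-isomorphic modules.

Conversely, the degree-zero space of a graded `V_B`-module `W` is a module of the Lie algebroid. If
it is nonzero and finite-dimensional it contains an eigenvector as above, which determines a
homomorphism `M(ℂv) → W`. For irreducible `W` this is onto, and its kernel is `J`
(`IsLowestWeight.ker_hom`), so `W ≅ L(ℂv)`. -/

open VertexAlgebroid VertexOperator

/-! ### Difference operators on families indexed by integers -/

/-- The operator `f ↦ ((m, n) ↦ f (m + 1) n - f m (n + 1))`; on coefficients of formal series in
two variables it is multiplication by `z₁ - z₂`. -/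
def modeDiff (X : Type*) [AddCommGroup X] [Module ℂ X] : Module.End ℂ (ℤ → ℤ → X) where
  toFun f m n := f (m + 1) n - f m (n + 1)
  map_add' f g := by ext m n; simp only [Pi.add_apply]; abel
  map_smul' c f := by ext m n; simp only [Pi.smul_apply, smul_sub, RingHom.id_apply]

section ModeDiff

variable {X : Type*} [AddCommGroup X] [Module ℂ X] {Z : Type*} [AddCommGroup Z] [Module ℂ Z]

theorem modeDiff_apply (f : ℤ → ℤ → X) (m n : ℤ) :
    modeDiff X f m n = f (m + 1) n - f m (n + 1) := rfl

theorem modeDiff_pow_succ_apply (k : ℕ) (f : ℤ → ℤ → X) (m n : ℤ) :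
    (modeDiff X ^ (k + 1)) f m n
      = (modeDiff X ^ k) f (m + 1) n - (modeDiff X ^ k) f m (n + 1) := by
  rw [pow_succ']; rfl

/-- Linear maps commute with the difference operator. -/
theorem modeDiff_pow_map (g : X →ₗ[ℂ] Z) (k : ℕ) (f : ℤ → ℤ → X) (m n : ℤ) :
    (modeDiff Z ^ k) (fun m n => g (f m n)) m n = g ((modeDiff X ^ k) f m n) := by
  induction k generalizing m n with
  | zero => rfl
  | succ k ih => rw [modeDiff_pow_succ_apply, modeDiff_pow_succ_apply, ih, ih, map_sub]

theorem modeDiff_pow_swap (k : ℕ) (f : ℤ → ℤ → X) (m n : ℤ) :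
    (modeDiff X ^ k) (fun m n => f n m) m n = (-1 : ℂ) ^ k • (modeDiff X ^ k) f n m := by
  induction k generalizing m n with
  | zero => simp
  | succ k ih =>
    rw [modeDiff_pow_succ_apply, modeDiff_pow_succ_apply, ih, ih, pow_succ]
    module

theorem modeDiff_pow_eq_zero_of_le {k k' : ℕ} (h : k ≤ k') {f : ℤ → ℤ → X}
    (hf : (modeDiff X ^ k) f = 0) : (modeDiff X ^ k') f = 0 := by
  obtain ⟨j, rfl⟩ := Nat.exists_eq_add_of_le h
  rw [add_comm, pow_add, Module.End.mul_apply, hf, map_zero]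

/-- A family that satisfies Pascal's rule, vanishes at `l = 0`, and is truncated in the last
variable, is zero. -/
theorem eq_zero_of_pascal {X : Type*} [AddCommGroup X] {E : ℤ → ℤ → ℤ → X}
    (h0 : ∀ m n, E 0 m n = 0)
    (hP : ∀ l m n, E (l + 1) m n = E l (m + 1) n - E l m (n + 1))
    (ht : ∀ l, ∃ N : ℤ, ∀ m n, N ≤ n → E l m n = 0) (l m n : ℤ) : E l m n = 0 := by
  induction l using Int.induction_on generalizing m n with
  | zero => exact h0 m n
  | succ l ih => rw [hP, ih, ih, sub_zero]
  | pred l ih =>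
    -- Pascal's rule at level `-l - 1` has left side zero by induction, so `E (-l - 1)` is constant
    -- along `(m, n) ↦ (m - 1, n + 1)`. The shifts push `n` past the truncation bound, which does
    -- not depend on `m`.
    have step : ∀ m n, E (-l - 1) m n = E (-l - 1) (m - 1) (n + 1) := fun m n => by
      have h := hP (-l - 1) (m - 1) n
      rw [sub_add_cancel, sub_add_cancel, ih, eq_comm, sub_eq_zero] at h
      exact h
    have steps : ∀ (k : ℕ) (m n : ℤ), E (-l - 1) m n = E (-l - 1) (m - k) (n + k) := fun k => by
      induction k with
      | zero => simp
      | succ k ihk =>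
        intro m n
        rw [step, ihk]
        push_cast
        congr 1 <;> ring
    obtain ⟨N, hN⟩ := ht (-l - 1)
    rw [steps (N - n).toNat]
    exact hN _ _ (by omega)

end ModeDiff

/-! ### Sums over `ℕ` that terminate -/

theorem finsum_nat_eq_sum_range {X : Type*} [AddCommMonoid X] {f : ℕ → X} {K : ℕ}
    (h : ∀ i, K ≤ i → f i = 0) : ∑ᶠ i, f i = ∑ i ∈ Finset.range K, f i := by
  apply finsum_eq_sum_of_support_subset
  intro i hi
  simp only [Finset.coe_range, Set.mem_Iio]
  by_contra hK
  exact hi (h i (not_lt.1 hK))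

theorem finsum_nat_succ {X : Type*} [AddCommMonoid X] {f : ℕ → X} {K : ℕ}
    (h : ∀ i, K ≤ i → f i = 0) : ∑ᶠ i, f i = f 0 + ∑ᶠ i, f (i + 1) := by
  rw [finsum_nat_eq_sum_range (K := K + 1) (fun i hi => h i (by omega)),
    finsum_nat_eq_sum_range (K := K) (fun i hi => h _ (by omega)), Finset.sum_range_succ', add_comm]

/-! ### Vertex operators given by their modes -/

namespace VertexOperator

variable {W : Type w} [AddCommGroup W] [Module ℂ W]

theorem ext_ncoeff {a b : VertexOperator ℂ W} (h : ∀ n u, ncoeff a n u = ncoeff b n u) :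
    a = b := by
  apply HVertexOperator.coeff_inj
  funext n
  ext u
  have := h (-n - 1) u
  rwa [ncoeff_apply, ncoeff_apply, show -(-n - 1) - 1 = n by ring] at this

theorem exists_ncoeff_eq_zero (a : VertexOperator ℂ W) (u : W) :
    ∃ N : ℤ, ∀ n, N ≤ n → ncoeff a n u = 0 :=
  ⟨-(HahnSeries.order ((HahnModule.of ℂ).symm (a u))), fun n hn =>
    ncoeff_eq_zero_of_lt_order a n u (by omega)⟩

/-- The vertex operator with given modes. -/
noncomputable def ofModes (f : ℤ → Module.End ℂ W)
    (hf : ∀ u, ∃ N : ℤ, ∀ n, N ≤ n → f n u = 0) : VertexOperator ℂ W :=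
  of_coeff (fun n => f (-n - 1)) fun u => by
    obtain ⟨N, hN⟩ := hf u
    refine ⟨-N, fun n hn => ?_⟩
    by_contra h
    exact hn (hN _ (by omega))

@[simp] theorem ncoeff_ofModes (f : ℤ → Module.End ℂ W)
    (hf : ∀ u, ∃ N : ℤ, ∀ n, N ≤ n → f n u = 0) (n : ℤ) : ncoeff (ofModes f hf) n = f n := by
  rw [ofModes, ncoeff_of_coeff, show -(-n - 1) - 1 = n by ring]

/-! ### Products of vertex operators -/

theorem exists_nat_ncoeff_eq_zero (a : VertexOperator ℂ W) (n : ℤ) (u : W) :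
    ∃ K : ℕ, ∀ i : ℕ, K ≤ i → ncoeff a (n + i) u = 0 := by
  obtain ⟨N, hN⟩ := exists_ncoeff_eq_zero a u
  exact ⟨(N - n).toNat, fun i hi => hN _ (by omega)⟩

theorem finite_support_modes {X : Type*} [AddCommGroup X] (a : VertexOperator ℂ W) (n : ℤ) (u : W)
    (f : ℕ → W →+ X) : (Function.support fun i : ℕ => f i (ncoeff a (n + i) u)).Finite := by
  obtain ⟨K, hK⟩ := exists_nat_ncoeff_eq_zero a n u
  refine (Finset.range K).finite_toSet.subset fun i hi => ?_
  simp only [Finset.coe_range, Set.mem_Iio]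
  by_contra h
  exact hi (by simp [hK i (not_lt.1 h)])

/-- The coefficients of `(z₁ - z₂)ˡ a(z₁) b(z₂)`, expanded in nonnegative powers of `z₂`. -/
noncomputable def expProd (a b : VertexOperator ℂ W) (l m n : ℤ) : Module.End ℂ W where
  toFun u := ∑ᶠ i : ℕ, ((-1) ^ i * Ring.choose l i : ℤ) •
    ncoeff a (m + l - i) (ncoeff b (n + i) u)
  map_add' u v := by
    rw [← finsum_add_distrib]
    · simp only [map_add, smul_add]
    · exact finite_support_modes b n u fun i => (((-1) ^ i * Ring.choose l i : ℤ) •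
        ncoeff a (m + l - i)).toAddMonoidHom
    · exact finite_support_modes b n v fun i => (((-1) ^ i * Ring.choose l i : ℤ) •
        ncoeff a (m + l - i)).toAddMonoidHom
  map_smul' c u := by
    rw [RingHom.id_apply, smul_finsum]
    simp only [map_smul, smul_comm c]

theorem expProd_apply (a b : VertexOperator ℂ W) (l m n : ℤ) (u : W) :
    expProd a b l m n u = ∑ᶠ i : ℕ, ((-1) ^ i * Ring.choose l i : ℤ) •
      ncoeff a (m + l - i) (ncoeff b (n + i) u) := rfl

theorem expProd_eq_sum (a b : VertexOperator ℂ W) (l m n : ℤ) {u : W} {K : ℕ}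
    (hK : ∀ i : ℕ, K ≤ i → ncoeff b (n + i) u = 0) :
    expProd a b l m n u = ∑ i ∈ Finset.range K, ((-1) ^ i * Ring.choose l i : ℤ) •
      ncoeff a (m + l - i) (ncoeff b (n + i) u) :=
  finsum_nat_eq_sum_range fun i hi => by rw [hK i hi, map_zero, smul_zero]

theorem expProd_eq_zero (a b : VertexOperator ℂ W) (l m n : ℤ) {u : W}
    (h : ∀ n', n ≤ n' → ncoeff b n' u = 0) : expProd a b l m n u = 0 := by
  rw [expProd_eq_sum (K := 0)]
  · simp
  · intro i _; exact h _ (by omega)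

theorem expProd_zero (a b : VertexOperator ℂ W) (m n : ℤ) :
    expProd a b 0 m n = ncoeff a m * ncoeff b n := by
  ext u
  obtain ⟨K, hK⟩ := exists_nat_ncoeff_eq_zero b n u
  rw [expProd_apply, finsum_nat_succ (K := K) (fun i hi => by rw [hK i hi, map_zero, smul_zero])]
  simp [Ring.choose_zero_succ]

/-- Pascal's rule for the binomial coefficients: multiplying by one more factor `z₁ - z₂`. With
`expProd_zero` and truncation it determines `expProd` for all integers `l`, negative ones included,
so later identities are checked only at `l = 0`. -/
theorem expProd_succ (a b : VertexOperator ℂ W) (l m n : ℤ) :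
    expProd a b (l + 1) m n = expProd a b l (m + 1) n - expProd a b l m (n + 1) := by
  ext u
  obtain ⟨K, hK⟩ := exists_nat_ncoeff_eq_zero b n u
  have hz : ∀ (f : ℕ → ℤ) (g : ℕ → Module.End ℂ W) (i : ℕ), K ≤ i →
      f i • g i (ncoeff b (n + i) u) = 0 := fun f g i hi => by rw [hK i hi, map_zero, smul_zero]
  rw [LinearMap.sub_apply, expProd_apply, expProd_apply, finsum_nat_succ (K := K) (hz _ _),
    finsum_nat_succ (K := K) (hz _ (fun i => ncoeff a (m + 1 + l - i))), expProd_apply,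
    finsum_nat_eq_sum_range (K := K), finsum_nat_eq_sum_range (K := K),
    finsum_nat_eq_sum_range (K := K), add_sub_assoc (_ • _ : W), ← Finset.sum_sub_distrib]
  · congr 1
    · simp [show m + (l + 1) = m + 1 + l by ring]
    · refine Finset.sum_congr rfl fun i _ => ?_
      rw [Ring.choose_succ_succ, show m + (l + 1) - ((i + 1 : ℕ) : ℤ) = m + l - i by push_cast; ring,
        show m + 1 + l - ((i + 1 : ℕ) : ℤ) = m + l - i by push_cast; ring,
        show n + ((i + 1 : ℕ) : ℤ) = n + 1 + i by push_cast; ring, ← sub_smul]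
      congr 1
      ring
  all_goals intro i hi
  · have := hK (i + 1) (by omega)
    push_cast at this
    rw [show n + 1 + (i : ℤ) = n + (i + 1) by ring, this, map_zero, smul_zero]
  · rw [hK _ (by omega), map_zero, smul_zero]
  · rw [hK _ (by omega), map_zero, smul_zero]

theorem expProd_add_left (a a' b : VertexOperator ℂ W) (l m n : ℤ) :
    expProd (a + a') b l m n = expProd a b l m n + expProd a' b l m n := by
  ext u
  obtain ⟨K, hK⟩ := exists_nat_ncoeff_eq_zero b n u
  simp [expProd_eq_sum _ _ _ _ _ hK, Finset.sum_add_distrib]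

theorem expProd_smul_left (c : ℂ) (a b : VertexOperator ℂ W) (l m n : ℤ) :
    expProd (c • a) b l m n = c • expProd a b l m n := by
  ext u
  obtain ⟨K, hK⟩ := exists_nat_ncoeff_eq_zero b n u
  simp only [expProd_eq_sum _ _ _ _ _ hK, LinearMap.smul_apply, Finset.smul_sum, map_smul,
    Pi.smul_apply, smul_comm c]

theorem expProd_add_right (a b b' : VertexOperator ℂ W) (l m n : ℤ) :
    expProd a (b + b') l m n = expProd a b l m n + expProd a b' l m n := by
  ext u
  obtain ⟨K, hK⟩ := exists_nat_ncoeff_eq_zero b n u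
  obtain ⟨K', hK'⟩ := exists_nat_ncoeff_eq_zero b' n u
  have h1 : ∀ i : ℕ, max K K' ≤ i → ncoeff b (n + i) u = 0 := fun i hi =>
    hK i (le_trans (le_max_left _ _) hi)
  have h2 : ∀ i : ℕ, max K K' ≤ i → ncoeff b' (n + i) u = 0 := fun i hi =>
    hK' i (le_trans (le_max_right _ _) hi)
  rw [LinearMap.add_apply, expProd_eq_sum a b l m n h1, expProd_eq_sum a b' l m n h2,
    expProd_eq_sum a (b + b') l m n (K := max K K'), ← Finset.sum_add_distrib]
  · simp
  · intro i hi
    simp [h1 i hi, h2 i hi]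

theorem expProd_smul_right (c : ℂ) (a b : VertexOperator ℂ W) (l m n : ℤ) :
    expProd a (c • b) l m n = c • expProd a b l m n := by
  ext u
  obtain ⟨K, hK⟩ := exists_nat_ncoeff_eq_zero b n u
  rw [LinearMap.smul_apply, expProd_eq_sum _ _ _ _ _ hK,
    expProd_eq_sum a (c • b) l m n (K := K) (fun i hi => by simp [hK i hi]), Finset.smul_sum]
  simp only [map_smul, Pi.smul_apply, LinearMap.smul_apply, smul_comm c]

/-- The coefficients of `(z₁ - z₂)ˡ a(z₁) b(z₂) - (-z₂ + z₁)ˡ b(z₂) a(z₁)`. -/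
noncomputable def expComm (a b : VertexOperator ℂ W) (l m n : ℤ) : Module.End ℂ W :=
  expProd a b l m n - (l.negOnePow : ℤ) • expProd b a l n m

theorem expComm_zero (a b : VertexOperator ℂ W) (m n : ℤ) :
    expComm a b 0 m n = ncoeff a m * ncoeff b n - ncoeff b n * ncoeff a m := by
  simp [expComm, expProd_zero]

theorem expComm_succ (a b : VertexOperator ℂ W) (l m n : ℤ) :
    expComm a b (l + 1) m n = expComm a b l (m + 1) n - expComm a b l m (n + 1) := by
  simp only [expComm, expProd_succ, Int.negOnePow_succ, Units.val_neg]
  module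

/-- For `l ≥ 0` both expansions of `(z₁ - z₂)ˡ` are the same polynomial, so locality amounts to the
vanishing of `expComm a b l` for large `l`. -/
theorem expComm_natCast (a b : VertexOperator ℂ W) (k : ℕ) (m n : ℤ) :
    expComm a b k m n = (modeDiff _ ^ k) (expComm a b 0) m n := by
  induction k generalizing m n with
  | zero => rfl
  | succ k ih => rw [modeDiff_pow_succ_apply, Nat.cast_succ, expComm_succ, ih, ih]

theorem exists_expProd_eq_zero_left (a b : VertexOperator ℂ W) (l n : ℤ) (u : W) :
    ∃ N : ℤ, ∀ m, N ≤ m → expProd a b l m n u = 0 := by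
  obtain ⟨K, hK⟩ := exists_nat_ncoeff_eq_zero b n u
  choose N' hN' using fun i : ℕ => exists_ncoeff_eq_zero a (ncoeff b (n + i) u)
  -- Only the indices `i < K` contribute, and the sum dominates each of the bounds `N' i - (l - i)`.
  refine ⟨∑ i ∈ Finset.range K, (|N' i| + |l - i|), fun m hm => ?_⟩
  rw [expProd_eq_sum a b l m n hK, Finset.sum_eq_zero]
  intro i hi
  rw [hN' i, smul_zero]
  have := Finset.single_le_sum (f := fun i : ℕ => |N' i| + |l - i|)
    (fun i _ => by positivity) hi
  have h1 := le_abs_self (N' i)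
  have h2 := neg_abs_le (l - i)
  omega

theorem exists_expComm_eq_zero (a b : VertexOperator ℂ W) (l m : ℤ) (u : W) :
    ∃ N : ℤ, ∀ n, N ≤ n → expComm a b l m n u = 0 := by
  obtain ⟨N, hN⟩ := exists_ncoeff_eq_zero b u
  obtain ⟨N', hN'⟩ := exists_expProd_eq_zero_left b a l m u
  refine ⟨max N N', fun n hn => ?_⟩
  rw [expComm, LinearMap.sub_apply, LinearMap.smul_apply, hN' n (by omega),
    expProd_eq_zero a b l m n fun n' hn' => hN _ (by omega), smul_zero, sub_zero]

/-- The `l`-th product `aₗb` of two vertex operators. -/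
noncomputable def nprod (l : ℤ) (a b : VertexOperator ℂ W) : VertexOperator ℂ W :=
  ofModes (fun n => expComm a b l 0 n) (exists_expComm_eq_zero a b l 0)

theorem ncoeff_nprod (l : ℤ) (a b : VertexOperator ℂ W) (n : ℤ) :
    ncoeff (nprod l a b) n = expComm a b l 0 n := by rw [nprod, ncoeff_ofModes]

theorem nprod_smul_left (l : ℤ) (c : ℂ) (a b : VertexOperator ℂ W) :
    nprod l (c • a) b = c • nprod l a b := by
  refine ext_ncoeff fun n u => ?_
  simp only [map_smul, Pi.smul_apply, LinearMap.smul_apply, ncoeff_nprod, expComm,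
    expProd_smul_left, expProd_smul_right, LinearMap.sub_apply, smul_sub, smul_comm c]

theorem nprod_add_right (l : ℤ) (a b b' : VertexOperator ℂ W) :
    nprod l a (b + b') = nprod l a b + nprod l a b' := by
  refine ext_ncoeff fun n u => ?_
  simp only [map_add, Pi.add_apply, LinearMap.add_apply, ncoeff_nprod, expComm, expProd_add_left,
    expProd_add_right, LinearMap.sub_apply, LinearMap.smul_apply]
  module

theorem nprod_smul_right (l : ℤ) (c : ℂ) (a b : VertexOperator ℂ W) :
    nprod l a (c • b) = c • nprod l a b := by
  refine ext_ncoeff fun n u => ?_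
  simp only [map_smul, Pi.smul_apply, LinearMap.smul_apply, ncoeff_nprod, expComm,
    expProd_smul_left, expProd_smul_right, LinearMap.sub_apply, smul_sub, smul_comm c]

/-- The operator `b ↦ aₗb`. -/
noncomputable def nprodLin (l : ℤ) (a : VertexOperator ℂ W) :
    Module.End ℂ (VertexOperator ℂ W) where
  toFun := nprod l a
  map_add' := nprod_add_right l a
  map_smul' c b := nprod_smul_right l c a b

/-- The identity operator as a (constant) vertex operator. -/
noncomputable def idOp : VertexOperator ℂ W :=
  ofModes (fun n => if n = -1 then 1 else 0) fun u => ⟨0, fun n hn => by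
    rw [if_neg (by omega)]; rfl⟩

theorem ncoeff_idOp (n : ℤ) (u : W) : ncoeff (idOp : VertexOperator ℂ W) n u
    = if n = -1 then u else 0 := by
  rw [idOp, ncoeff_ofModes]; split_ifs <;> rfl

/-- The derivative `d/dz` of a vertex operator. -/
noncomputable def derivOp : Module.End ℂ (VertexOperator ℂ W) where
  toFun a := ofModes (fun n => (-n : ℂ) • ncoeff a (n - 1)) fun u => by
    obtain ⟨N, hN⟩ := exists_ncoeff_eq_zero a u
    exact ⟨N + 1, fun n hn => by simp [hN (n - 1) (by omega)]⟩
  map_add' a b := ext_ncoeff fun n u => by simp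
  map_smul' c a := ext_ncoeff fun n u => by simp [smul_comm c]

theorem ncoeff_derivOp (a : VertexOperator ℂ W) (n : ℤ) :
    ncoeff (derivOp a) n = (-n : ℂ) • ncoeff a (n - 1) := by
  simp only [derivOp, LinearMap.coe_mk, AddHom.coe_mk, ncoeff_ofModes]

/-- The product rule for `∂/∂z₂` applied to `(z₁ - z₂)ˡ a(z₁) b(z₂)`. Both sides obey Pascal's rule
and agree at `l = 0`. The left version has the opposite sign at `l`, because `∂/∂z₁` differentiates
the kernel with the opposite sign. -/
theorem expProd_derivOp_right (a b : VertexOperator ℂ W) (l m n : ℤ) :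
    expProd a (derivOp b) l m n
      = (l : ℂ) • expProd a b (l - 1) m n - (n : ℂ) • expProd a b l m (n - 1) := by
  rw [← sub_eq_zero]
  ext u
  refine eq_zero_of_pascal (E := fun l m n => (expProd a (derivOp b) l m n
      - ((l : ℂ) • expProd a b (l - 1) m n - (n : ℂ) • expProd a b l m (n - 1))) u) ?_ ?_ ?_ l m n
  · intro m n
    simp [expProd_zero, ncoeff_derivOp]
  · intro l m n
    have h := expProd_succ a b (l - 1) m n
    have h' := expProd_succ a b l m (n - 1)
    rw [sub_add_cancel, eq_sub_iff_add_eq, eq_comm] at h h'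
    rw [expProd_succ a (derivOp b), add_sub_cancel_right, add_sub_cancel_right, h, h',
      ← LinearMap.sub_apply]
    congr 1
    push_cast
    module
  · intro l
    obtain ⟨N, hN⟩ := exists_ncoeff_eq_zero b u
    refine ⟨N + 1, fun m n hn => ?_⟩
    simp only [LinearMap.sub_apply, LinearMap.smul_apply]
    rw [expProd_eq_zero, expProd_eq_zero, expProd_eq_zero]
    · simp
    · intro n' hn'; exact hN _ (by omega)
    · intro n' hn'; exact hN _ (by omega)
    · intro n' hn'; simp [ncoeff_derivOp, hN (n' - 1) (by omega)]

theorem expProd_derivOp_left (a b : VertexOperator ℂ W) (l m n : ℤ) :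
    expProd (derivOp a) b l m n
      = -((l : ℂ) • expProd a b (l - 1) m n) - (m : ℂ) • expProd a b l (m - 1) n := by
  rw [← sub_eq_zero]
  ext u
  refine eq_zero_of_pascal (E := fun l m n => (expProd (derivOp a) b l m n
      - (-((l : ℂ) • expProd a b (l - 1) m n) - (m : ℂ) • expProd a b l (m - 1) n)) u) ?_ ?_ ?_ l m n
  · intro m n
    simp [expProd_zero, ncoeff_derivOp]
  · intro l m n
    have h := expProd_succ a b (l - 1) m n
    have h' := expProd_succ a b l (m - 1) n
    rw [sub_add_cancel, eq_sub_iff_add_eq, eq_comm] at h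
    rw [sub_add_cancel] at h'
    rw [expProd_succ (derivOp a) b, add_sub_cancel_right, add_sub_cancel_right, h, h',
      ← LinearMap.sub_apply]
    congr 1
    push_cast
    module
  · intro l
    obtain ⟨N, hN⟩ := exists_ncoeff_eq_zero b u
    refine ⟨N, fun m n hn => ?_⟩
    simp only [LinearMap.sub_apply, LinearMap.smul_apply, LinearMap.neg_apply]
    rw [expProd_eq_zero, expProd_eq_zero, expProd_eq_zero]
    · simp
    all_goals intro n' hn'; exact hN _ (by omega)

end VertexOperator

/-! ### Difference operators in three variables -/

section ModeDiff3

variable (X : Type*) [AddCommGroup X] [Module ℂ X]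

/-- Multiplication by `z₀ - z₂` on coefficients of formal series in three variables. -/
def modeDiff02 : Module.End ℂ (ℤ → ℤ → ℤ → X) where
  toFun f p m n := f (p + 1) m n - f p m (n + 1)
  map_add' f g := by ext p m n; simp only [Pi.add_apply]; abel
  map_smul' c f := by ext p m n; simp only [Pi.smul_apply, smul_sub, RingHom.id_apply]

/-- Multiplication by `z₁ - z₂` on coefficients of formal series in three variables. -/
def modeDiff12 : Module.End ℂ (ℤ → ℤ → ℤ → X) where
  toFun f p m n := f p (m + 1) n - f p m (n + 1)
  map_add' f g := by ext p m n; simp only [Pi.add_apply]; abel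
  map_smul' c f := by ext p m n; simp only [Pi.smul_apply, smul_sub, RingHom.id_apply]

/-- Multiplication by `z₀ - z₁` on coefficients of formal series in three variables. -/
abbrev modeDiff01 : Module.End ℂ (ℤ → ℤ → ℤ → X) := modeDiff (ℤ → X)

theorem modeDiff02_eq : modeDiff02 X = modeDiff01 X + modeDiff12 X := by
  ext f p m n
  change _ = f (p + 1) m n - f p (m + 1) n + (f p (m + 1) n - f p m (n + 1))
  rw [sub_add_sub_cancel]; rfl

theorem commute_modeDiff01_modeDiff12 : Commute (modeDiff01 X) (modeDiff12 X) := by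
  ext f p m n
  change f (p + 1) (m + 1) n - f (p + 1) m (n + 1) - (f p (m + 1 + 1) n - f p (m + 1) (n + 1))
    = f (p + 1) (m + 1) n - f p (m + 1 + 1) n - (f (p + 1) m (n + 1) - f p (m + 1) (n + 1))
  abel

theorem commute_modeDiff01_modeDiff02 : Commute (modeDiff01 X) (modeDiff02 X) := by
  rw [modeDiff02_eq]
  exact (Commute.refl _).add_right (commute_modeDiff01_modeDiff12 X)

theorem commute_modeDiff02_modeDiff12 : Commute (modeDiff02 X) (modeDiff12 X) := by
  rw [modeDiff02_eq]
  exact (commute_modeDiff01_modeDiff12 X).add_left (Commute.refl _)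

variable {X}

theorem modeDiff02_pow_apply (k : ℕ) (f : ℤ → ℤ → ℤ → X) (p m n : ℤ) :
    (modeDiff02 X ^ k) f p m n = (modeDiff X ^ k) (fun p n => f p m n) p n := by
  induction k generalizing p n with
  | zero => rfl
  | succ k ih =>
    rw [modeDiff_pow_succ_apply, ← ih, ← ih, pow_succ']
    rfl

theorem modeDiff01_pow_apply (k : ℕ) (f : ℤ → ℤ → ℤ → X) (p m n : ℤ) :
    (modeDiff01 X ^ k) f p m n = (modeDiff X ^ k) (fun p m => f p m n) p m :=
  (modeDiff_pow_map (LinearMap.proj n) k f p m).symm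

/-- If `d₀₂ = d₀₁ + d₁₂` for commuting operators, a family with `d₁₂ Tₗ = Tₗ₊₁` that is eventually
zero and killed by a power of `d₀₁d₀₂` is killed by powers of `d₀₂`. -/
theorem exists_pow_apply_eq_zero_of_add {Y : Type*} [AddCommGroup Y] [Module ℂ Y]
    {d01 d02 d12 : Module.End ℂ Y} (hd : d02 = d01 + d12) (hc : Commute d01 d02) {T : ℤ → Y}
    (hT : ∀ l, d12 (T l) = T (l + 1)) {N : ℤ} (hN : ∀ l, N ≤ l → T l = 0) {M : ℕ}
    (hM : ∀ l, (d01 ^ M * d02 ^ M) (T l) = 0) (l : ℤ) : ∃ K : ℕ, (d02 ^ K) (T l) = 0 := by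
  have mono : ∀ {j K K' : ℕ} {y : Y}, K ≤ K' → (d01 ^ j * d02 ^ K) y = 0 →
      (d01 ^ j * d02 ^ K') y = 0 := by
    intro j K K' y hK hy
    obtain ⟨i, rfl⟩ := Nat.exists_eq_add_of_le hK
    rw [add_comm, pow_add, ← mul_assoc, (hc.pow_pow j i).eq, mul_assoc, Module.End.mul_apply, hy,
      map_zero]
  have key : ∀ (s j : ℕ) (l : ℤ), (M - j) + (N - l).toNat ≤ s →
      ∃ K : ℕ, (d01 ^ j * d02 ^ K) (T l) = 0 := by
    intro s
    induction s with
    | zero =>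
      intro j l h
      exact ⟨0, by rw [hN l (by omega), map_zero]⟩
    | succ s ih =>
      intro j l h
      by_cases hl : N ≤ l
      · exact ⟨0, by rw [hN l hl, map_zero]⟩
      by_cases hj : M ≤ j
      · refine ⟨M, ?_⟩
        obtain ⟨i, rfl⟩ := Nat.exists_eq_add_of_le hj
        rw [add_comm, pow_add, mul_assoc, Module.End.mul_apply, hM, map_zero]
      obtain ⟨K₁, h₁⟩ := ih (j + 1) l (by omega)
      obtain ⟨K₂, h₂⟩ := ih j (l + 1) (by omega)
      refine ⟨max K₁ K₂ + 1, ?_⟩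
      -- One factor `d02` is split as `d01 + d12`. The first summand raises `j`, which stops at `M`
      -- by `hM`; the second raises `l`, which stops at `N` by `hN`. The measure `(M - j) + (N - l)`
      -- drops either way.
      have e : d01 ^ j * d02 ^ (max K₁ K₂ + 1)
          = d01 ^ (j + 1) * d02 ^ max K₁ K₂ + d01 ^ j * d02 ^ max K₁ K₂ * d12 := by
        rw [pow_succ d02]
        nth_rw 2 [hd]
        rw [← mul_assoc, mul_add, mul_assoc,
          ← (hc.pow_right (max K₁ K₂)).eq, ← mul_assoc, ← pow_succ]
      rw [e, LinearMap.add_apply, mono (le_max_left _ _) h₁, Module.End.mul_apply, hT,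
        mono (le_max_right _ _) h₂, add_zero]
  obtain ⟨K, hK⟩ := key _ 0 l le_rfl
  exact ⟨K, by simpa using hK⟩

end ModeDiff3

namespace VertexOperator

variable {W : Type w} [AddCommGroup W] [Module ℂ W] {a b c : VertexOperator ℂ W}

/-! ### Locality -/

/-- `a` and `b` are mutually local: `(z₁ - z₂)ᴺ [a(z₁), b(z₂)] = 0` for some `N`. -/
def IsLocal (a b : VertexOperator ℂ W) : Prop :=
  ∃ N : ℕ, (modeDiff _ ^ N) (expComm a b 0) = 0

theorem expComm_zero_swap (a b : VertexOperator ℂ W) (m n : ℤ) :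
    expComm b a 0 n m = -expComm a b 0 m n := by
  rw [expComm_zero, expComm_zero, neg_sub]

theorem IsLocal.symm (h : IsLocal a b) : IsLocal b a := by
  obtain ⟨N, hN⟩ := h
  refine ⟨N, ?_⟩
  have : expComm b a 0 = -fun m n => expComm a b 0 n m := by
    funext m n
    exact expComm_zero_swap a b n m
  rw [this, map_neg, neg_eq_zero]
  funext m n
  rw [modeDiff_pow_swap, hN]
  simp

theorem isLocal_of_expComm_eq_zero (h : ∀ m n, expComm a b 0 m n = 0) : IsLocal a b :=
  ⟨0, by funext m n; exact h m n⟩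

/-- The space of vertex operators that are local with `b`. -/
def localSubmodule (b : VertexOperator ℂ W) : Submodule ℂ (VertexOperator ℂ W) where
  carrier := {a | IsLocal a b}
  zero_mem' := isLocal_of_expComm_eq_zero fun m n => by simp [expComm_zero]
  add_mem' := by
    rintro a a' ⟨N, hN⟩ ⟨N', hN'⟩
    refine ⟨max N N', ?_⟩
    have : expComm (a + a') b 0 = expComm a b 0 + expComm a' b 0 := by
      funext m n
      simp only [expComm_zero, map_add, Pi.add_apply, add_mul, mul_add]
      abel
    rw [this, map_add, modeDiff_pow_eq_zero_of_le (le_max_left _ _) hN,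
      modeDiff_pow_eq_zero_of_le (le_max_right _ _) hN', add_zero]
  smul_mem' := by
    rintro c a ⟨N, hN⟩
    refine ⟨N, ?_⟩
    have : expComm (c • a) b 0 = c • expComm a b 0 := by
      funext m n
      simp [expComm_zero, smul_sub]
    rw [this, map_smul, hN, smul_zero]

theorem isLocal_idOp (a : VertexOperator ℂ W) : IsLocal idOp a := by
  refine isLocal_of_expComm_eq_zero fun m n => ?_
  ext u
  rw [expComm_zero]
  simp only [LinearMap.sub_apply, Module.End.mul_apply, ncoeff_idOp]
  split_ifs <;> simp

theorem IsLocal.exists_expComm_eq_zero (h : IsLocal a b) :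
    ∃ N : ℤ, ∀ l, N ≤ l → ∀ m n, expComm a b l m n = 0 := by
  obtain ⟨N, hN⟩ := h
  refine ⟨N, fun l hl m n => ?_⟩
  obtain ⟨k, rfl⟩ := Int.eq_ofNat_of_zero_le (le_trans (Int.natCast_nonneg N) hl)
  rw [expComm_natCast, modeDiff_pow_eq_zero_of_le (Int.ofNat_le.1 hl) hN]
  rfl

theorem IsLocal.exists_nprod_eq_zero (h : IsLocal a b) :
    ∃ N : ℤ, ∀ l, N ≤ l → nprod l a b = 0 := by
  obtain ⟨N, hN⟩ := h.exists_expComm_eq_zero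
  exact ⟨N, fun l hl => ext_ncoeff fun n u => by simp [ncoeff_nprod, hN l hl]⟩

/-- `f p m n` vanishes on each vector for large `n`, uniformly in `m`. -/
def IsTruncated (f : ℤ → ℤ → ℤ → Module.End ℂ W) : Prop :=
  ∀ u p, ∃ N : ℤ, ∀ m n, N ≤ n → f p m n u = 0

theorem IsTruncated.modeDiff01_pow {f : ℤ → ℤ → ℤ → Module.End ℂ W} (hf : IsTruncated f) (k : ℕ) :
    IsTruncated ((modeDiff01 _ ^ k) f) := by
  induction k with
  | zero => exact hf
  | succ k ih =>
    intro u p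
    obtain ⟨N, hN⟩ := ih u p
    obtain ⟨N', hN'⟩ := ih u (p + 1)
    refine ⟨max N N', fun m n hn => ?_⟩
    rw [pow_succ', Module.End.mul_apply]
    change ((modeDiff01 _ ^ k) f (p + 1) m n - (modeDiff01 _ ^ k) f p (m + 1) n) u = 0
    rw [LinearMap.sub_apply, hN _ _ (by omega), hN' _ _ (by omega), sub_zero]

theorem IsTruncated.modeDiff02_pow {f : ℤ → ℤ → ℤ → Module.End ℂ W} (hf : IsTruncated f) (k : ℕ) :
    IsTruncated ((modeDiff02 _ ^ k) f) := by
  induction k with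
  | zero => exact hf
  | succ k ih =>
    intro u p
    obtain ⟨N, hN⟩ := ih u p
    obtain ⟨N', hN'⟩ := ih u (p + 1)
    refine ⟨max N N', fun m n hn => ?_⟩
    rw [pow_succ', Module.End.mul_apply]
    change ((modeDiff02 _ ^ k) f (p + 1) m n - (modeDiff02 _ ^ k) f p m (n + 1)) u = 0
    rw [LinearMap.sub_apply, hN _ _ (by omega), hN' _ _ (by omega), sub_zero]

/-- At `l = 0` the commutator is `[c, a]b + a[c, b]`, and `(z₀ - z₁)ᴹ` kills the first term while
`(z₀ - z₂)ᴹ` kills the second. Other `l`, including negative ones, follow by Pascal's rule, since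
these operators commute with multiplication by `z₁ - z₂`. -/
theorem modeDiff_commutator_expProd {M : ℕ} (hca : (modeDiff _ ^ M) (expComm c a 0) = 0)
    (hcb : (modeDiff _ ^ M) (expComm c b 0) = 0) (l : ℤ) :
    (modeDiff01 (Module.End ℂ W) ^ M * modeDiff02 (Module.End ℂ W) ^ M) (fun p m n =>
      ncoeff c p * expProd a b l m n - expProd a b l m n * ncoeff c p) = 0 := by
  set T : ℤ → ℤ → ℤ → ℤ → Module.End ℂ W := fun l p m n =>
      ncoeff c p * expProd a b l m n - expProd a b l m n * ncoeff c p with hT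
  have hT0 : (modeDiff01 (Module.End ℂ W) ^ M * modeDiff02 (Module.End ℂ W) ^ M) (T 0) = 0 := by
    have e : T 0 = (fun p m n => expComm c a 0 p m * ncoeff b n)
        + fun p m n => ncoeff a m * expComm c b 0 p n := by
      funext p m n
      simp only [hT, Pi.add_apply, expComm_zero, expProd_zero, sub_mul, mul_sub, mul_assoc]
      abel
    have h1 : (modeDiff01 _ ^ M) (fun p m n => expComm c a 0 p m * ncoeff b n) = 0 := by
      funext p m n
      rw [modeDiff01_pow_apply]
      change (modeDiff _ ^ M) (fun p m => LinearMap.mulRight ℂ (ncoeff b n) (expComm c a 0 p m)) p m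
        = 0
      rw [modeDiff_pow_map, hca]
      simp
    have h2 : (modeDiff02 _ ^ M) (fun p m n => ncoeff a m * expComm c b 0 p n) = 0 := by
      funext p m n
      rw [modeDiff02_pow_apply]
      change (modeDiff _ ^ M) (fun p n => LinearMap.mulLeft ℂ (ncoeff a m) (expComm c b 0 p n)) p n
        = 0
      rw [modeDiff_pow_map, hcb]
      simp
    rw [e, map_add, ((commute_modeDiff01_modeDiff02 _).pow_pow M M).eq, Module.End.mul_apply, h1,
      map_zero, ← ((commute_modeDiff01_modeDiff02 _).pow_pow M M).eq, Module.End.mul_apply, h2,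
      map_zero, add_zero]
  have hTs : ∀ l, T (l + 1) = modeDiff12 _ (T l) := fun l => by
    funext p m n
    change _ = T l p (m + 1) n - T l p m (n + 1)
    simp only [hT, expProd_succ, mul_sub, sub_mul]
    abel
  have hTt : ∀ l, IsTruncated (T l) := fun l u p => by
    obtain ⟨N, hN⟩ := exists_ncoeff_eq_zero b u
    obtain ⟨N', hN'⟩ := exists_ncoeff_eq_zero b (ncoeff c p u)
    refine ⟨max N N', fun m n hn => ?_⟩
    simp only [hT, LinearMap.sub_apply, Module.End.mul_apply]
    rw [expProd_eq_zero _ _ _ _ _ fun n' hn' => hN n' (by omega),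
      expProd_eq_zero _ _ _ _ _ fun n' hn' => hN' n' (by omega), map_zero, sub_zero]
  funext p m n
  ext u
  refine eq_zero_of_pascal (E := fun l m n =>
    (modeDiff01 (Module.End ℂ W) ^ M * modeDiff02 (Module.End ℂ W) ^ M) (T l) p m n u) ?_ ?_ ?_ l m n
  · intro m n; simp only [hT0]; rfl
  · intro l m n
    have hc : Commute (modeDiff01 (Module.End ℂ W) ^ M * modeDiff02 (Module.End ℂ W) ^ M) (modeDiff12 _) :=
      ((commute_modeDiff01_modeDiff12 _).pow_left M).mul_left
        ((commute_modeDiff02_modeDiff12 _).pow_left M)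
    simp only [hTs]
    rw [← Module.End.mul_apply, hc.eq]
    rfl
  · intro l
    exact ((hTt l).modeDiff02_pow M).modeDiff01_pow M u p

/-- Dong's lemma: if `a`, `b`, `c` are pairwise local, then `c` is local with `aₗb`. -/
theorem IsLocal.nprod (hab : IsLocal a b) (hca : IsLocal c a) (hcb : IsLocal c b) (l : ℤ) :
    IsLocal c (nprod l a b) := by
  obtain ⟨N, hN⟩ := hab.exists_expComm_eq_zero
  obtain ⟨M₁, hM₁⟩ := hca
  obtain ⟨M₂, hM₂⟩ := hcb
  set M := max M₁ M₂
  replace hM₁ := modeDiff_pow_eq_zero_of_le (le_max_left M₁ M₂) hM₁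
  replace hM₂ := modeDiff_pow_eq_zero_of_le (le_max_right M₁ M₂) hM₂
  let T : ℤ → ℤ → ℤ → ℤ → Module.End ℂ W := fun l p m n =>
      ncoeff c p * expComm a b l m n - expComm a b l m n * ncoeff c p
  have hM : ∀ l, (modeDiff01 (Module.End ℂ W) ^ M * modeDiff02 (Module.End ℂ W) ^ M) (T l) = 0 := fun l => by
    have e : T l = (fun p m n => ncoeff c p * expProd a b l m n - expProd a b l m n * ncoeff c p)
        - (l.negOnePow : ℤ) • fun p m n =>
          ncoeff c p * expProd b a l n m - expProd b a l n m * ncoeff c p := by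
      funext p m n
      simp only [T, expComm, Pi.sub_apply, Pi.smul_apply, mul_sub, sub_mul, smul_sub,
        mul_smul_comm, smul_mul_assoc]
      abel
    rw [e, map_sub, modeDiff_commutator_expProd hM₁ hM₂, map_zsmul, zero_sub, neg_eq_zero]
    -- The opposite ordering is the same statement with `a, b` and their indices exchanged. The
    -- exchange swaps the difference operators `01` and `02`, which commute, so the product of their
    -- `M`-th powers is unchanged.
    convert smul_zero _
    funext p m n
    have h := congrFun (congrFun (congrFun (modeDiff_commutator_expProd hM₂ hM₁ l) p) n) m
    rw [((commute_modeDiff01_modeDiff02 _).pow_pow M M).eq, Module.End.mul_apply,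
      modeDiff02_pow_apply] at h
    rw [Module.End.mul_apply, modeDiff01_pow_apply]
    simp only [modeDiff01_pow_apply] at h
    simp only [modeDiff02_pow_apply]
    exact h
  -- Locality of `a` and `b` enters here: it makes `T l` vanish for `l ≥ N`, which allows the factor
  -- `(z₀ - z₁)ᴹ` to be traded for a higher power of `z₀ - z₂`. The slice `m = 0` is then the
  -- commutator with `aₗb`.
  obtain ⟨K, hK⟩ := exists_pow_apply_eq_zero_of_add (modeDiff02_eq _)
    (commute_modeDiff01_modeDiff02 _) (T := T) (N := N) (M := M)
    (fun l => by
      funext p m n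
      change T l p (m + 1) n - T l p m (n + 1) = _
      simp only [T, expComm_succ, mul_sub, sub_mul]
      abel)
    (fun l hl => by
      funext p m n
      simp [T, hN l hl]) hM l
  refine ⟨K, ?_⟩
  have e : expComm c (VertexOperator.nprod l a b) 0 = fun p n => T l p 0 n := by
    funext p n
    rw [expComm_zero, ncoeff_nprod]
  rw [e]
  funext p n
  rw [← modeDiff02_pow_apply K (T l) p 0 n, hK]
  rfl

/-- Borcherds' identity for a pair of mutually local vertex operators. -/
theorem IsLocal.expComm_eq_finsum (h : IsLocal a b) (l m n : ℤ) (u : W) :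
    expComm a b l m n u = ∑ᶠ i : ℕ, (Ring.choose m i : ℤ) •
      ncoeff (VertexOperator.nprod (l + i) a b) (m + n - i) u := by
  obtain ⟨N, hN⟩ := h.exists_expComm_eq_zero
  have hz : ∀ (l : ℤ) (i : ℕ), (N - l).toNat ≤ i → VertexOperator.nprod (l + i) a b = 0 :=
    fun l i hi => ext_ncoeff fun n u => by simp [ncoeff_nprod, hN (l + i) (by omega)]
  set Q : ℤ → ℤ → ℤ → W := fun l m n => ∑ᶠ i : ℕ, (Ring.choose m i : ℤ) •
      ncoeff (VertexOperator.nprod (l + i) a b) (m + n - i) u with hQ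
  have hQ0 : ∀ l n, expComm a b l 0 n u = Q l 0 n := fun l n => by
    simp only [hQ]
    rw [finsum_nat_succ (K := (N - l).toNat) (fun i hi => by simp [hz l i hi])]
    simp [Ring.choose_zero_succ, ncoeff_nprod]
  have hQs : ∀ l m n, Q l (m + 1) n = Q l m (n + 1) + Q (l + 1) m n := fun l m n => by
    simp only [hQ]
    rw [finsum_nat_succ (K := (N - l).toNat) (fun i hi => by simp [hz l i hi]),
      finsum_nat_succ (f := fun i : ℕ => (Ring.choose m i : ℤ) •
        ncoeff (VertexOperator.nprod (l + i) a b) (m + (n + 1) - i) u) (K := (N - l).toNat)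
        (fun i hi => by simp [hz l i hi]), add_assoc (_ • _ : W),
      finsum_nat_eq_sum_range (K := (N - l).toNat), finsum_nat_eq_sum_range (K := (N - l).toNat),
      finsum_nat_eq_sum_range (K := (N - l).toNat), ← Finset.sum_add_distrib]
    · congr 1
      · simp [show m + 1 + n = m + (n + 1) by ring]
      · refine Finset.sum_congr rfl fun i _ => ?_
        rw [Ring.choose_succ_succ, show m + 1 + n - ((i + 1 : ℕ) : ℤ) = m + n - i by push_cast; ring,
          show m + (n + 1) - ((i + 1 : ℕ) : ℤ) = m + n - i by push_cast; ring,
          show l + ((i + 1 : ℕ) : ℤ) = l + 1 + i by push_cast; ring, add_smul, add_comm]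
    all_goals intro i hi
    · rw [hz (l + 1) i (by omega)]; simp
    · rw [hz l _ (by omega)]; simp
    · rw [hz l _ (by omega)]; simp
  -- Both sides satisfy the recursion `hQs`, agree at `m = 0` and vanish for `l ≥ N`. So one
  -- descends in `l`, and for each `l` moves away from `m = 0` in both directions.
  have key : ∀ (k : ℕ) (l m n : ℤ), (N - l).toNat ≤ k → expComm a b l m n u = Q l m n := by
    intro k
    induction k with
    | zero =>
      intro l m n hk
      rw [hN l (by omega)]
      simp only [hQ]
      rw [finsum_nat_eq_sum_range (K := 0)]
      · simp
      · intro i _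
        rw [hz l i (by omega)]; simp
    | succ k ih =>
      intro l m n hk
      induction m using Int.induction_on generalizing n with
      | zero => exact hQ0 l n
      | succ m ihm =>
        have := congrArg (· u) (expComm_succ a b l m n)
        simp only [LinearMap.sub_apply] at this
        rw [hQs, ← ihm, ← ih (l + 1) _ _ (by omega), this]
        abel
      | pred m ihm =>
        have := congrArg (· u) (expComm_succ a b l (-m - 1) (n - 1))
        simp only [LinearMap.sub_apply, sub_add_cancel] at this
        have h2 := hQs l (-m - 1) (n - 1)
        simp only [sub_add_cancel] at h2
        rw [← ihm, ← ih (l + 1) _ _ (by omega), this] at h2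
        rw [← sub_eq_zero] at h2 ⊢
        rw [← h2]
        abel
  exact key _ l m n le_rfl

/-- Links `expComm` with the left side of `JacobiIdentity`: truncation makes each of the two
orderings a finite sum on its own, so the sum of differences may be split. -/
theorem expComm_apply (a b : VertexOperator ℂ W) (l m n : ℤ) (u : W) :
    ∑ᶠ i : ℕ, ((-1) ^ i * Ring.choose l i : ℤ) •
      (ncoeff a (m + l - i) (ncoeff b (n + i) u)
        - (l.negOnePow : ℤ) • ncoeff b (n + l - i) (ncoeff a (m + i) u))
    = expComm a b l m n u := by
  rw [expComm, LinearMap.sub_apply, LinearMap.smul_apply, expProd_apply, expProd_apply,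
    smul_finsum', ← finsum_sub_distrib]
  · simp only [smul_sub, smul_comm (l.negOnePow : ℤ)]
  · exact finite_support_modes b n u fun i => (((-1) ^ i * Ring.choose l i : ℤ) •
        ncoeff a (m + l - i)).toAddMonoidHom
  · exact finite_support_modes a m u fun i => ((l.negOnePow : ℤ) •
      ((-1) ^ i * Ring.choose l i : ℤ) • ncoeff b (n + l - i)).toAddMonoidHom
  · exact finite_support_modes a m u fun i => (((-1) ^ i * Ring.choose l i : ℤ) •
        ncoeff b (n + l - i)).toAddMonoidHom

end VertexOperator

/-! ### The Jacobi identity and products of fields -/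

open VertexOperator

/-- Once `Y` turns modes of states into products of fields, the Jacobi identity is Borcherds'
identity for the local pair `YW x`, `YW y`. -/
theorem jacobiIdentity_of_isLocal {V : Type v} [AddCommGroup V] [Module ℂ V] {W : Type w}
    [AddCommGroup W] [Module ℂ W] {Y : V →ₗ[ℂ] VertexOperator ℂ V}
    {YW : V →ₗ[ℂ] VertexOperator ℂ W} (hloc : ∀ x y, IsLocal (YW x) (YW y))
    (hY : ∀ x y l, YW (ncoeff (Y x) l y) = nprod l (YW x) (YW y)) : JacobiIdentity Y YW := by
  intro x y z l m n
  rw [expComm_apply, (hloc x y).expComm_eq_finsum]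
  simp only [hY]

/-- The case `m = 0` of the Jacobi identity: only the term `i = 0` survives on the right, because
`choose 0 (i + 1) = 0`. -/
theorem JacobiIdentity.map_ncoeff {V : Type v} [AddCommGroup V] [Module ℂ V] {W : Type w}
    [AddCommGroup W] [Module ℂ W] {Y : V →ₗ[ℂ] VertexOperator ℂ V}
    {YW : V →ₗ[ℂ] VertexOperator ℂ W} (h : JacobiIdentity Y YW) (x y : V) (l : ℤ) :
    YW (ncoeff (Y x) l y) = nprod l (YW x) (YW y) := by
  refine ext_ncoeff fun n u => ?_
  rw [ncoeff_nprod, ← expComm_apply, h, finsum_eq_single _ 0]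
  · simp
  · rintro (_ | i) hi
    · exact absurd rfl hi
    · simp [Ring.choose_zero_succ]

/-! ### Reconstruction of a vertex algebra from generating fields -/

namespace VertexOperator

variable {W : Type w} [AddCommGroup W] [Module ℂ W]

/-- `[D, a(z)] = d/dz a(z)`. -/
def IsCovariant (D : Module.End ℂ W) (a : VertexOperator ℂ W) : Prop :=
  ∀ n u, D (ncoeff a n u) = ncoeff a n (D u) + ncoeff (derivOp a) n u

theorem IsCovariant.expProd {D : Module.End ℂ W} {a b : VertexOperator ℂ W}
    (ha : IsCovariant D a) (hb : IsCovariant D b) (l m n : ℤ) (u : W) :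
    D (expProd a b l m n u) = expProd a b l m n (D u)
      + (expProd (derivOp a) b l m n u + expProd a (derivOp b) l m n u) := by
  obtain ⟨K₁, h₁⟩ := exists_nat_ncoeff_eq_zero b n u
  obtain ⟨K₂, h₂⟩ := exists_nat_ncoeff_eq_zero b n (D u)
  obtain ⟨K₃, h₃⟩ := exists_nat_ncoeff_eq_zero (derivOp b) n u
  set K := K₁ + K₂ + K₃
  rw [expProd_eq_sum a b l m n (K := K) fun i hi => h₁ i (by omega),
    expProd_eq_sum a b l m n (K := K) fun i hi => h₂ i (by omega),
    expProd_eq_sum _ b l m n (K := K) fun i hi => h₁ i (by omega),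
    expProd_eq_sum a _ l m n (K := K) fun i hi => h₃ i (by omega), map_sum,
    ← Finset.sum_add_distrib, ← Finset.sum_add_distrib]
  refine Finset.sum_congr rfl fun i _ => ?_
  rw [map_zsmul, ha, hb, map_add]
  module

/-- In the sum of the two product rules the terms with `l` cancel, and the one from `∂/∂z₁` has
coefficient `0` because `aₗb` is taken at mode `0` in `z₁`. What is left is the derivative in `z₂`.
-/
theorem IsCovariant.nprod {D : Module.End ℂ W} {a b : VertexOperator ℂ W}
    (ha : IsCovariant D a) (hb : IsCovariant D b) (l : ℤ) : IsCovariant D (nprod l a b) := by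
  intro n u
  have h1 := ha.expProd hb l 0 n u
  have h2 := hb.expProd ha l n 0 u
  simp only [ncoeff_derivOp, ncoeff_nprod, expComm, LinearMap.sub_apply, LinearMap.smul_apply,
    map_sub, map_zsmul, h1, h2, expProd_derivOp_left, expProd_derivOp_right, LinearMap.neg_apply]
  push_cast
  module

theorem isCovariant_idOp (D : Module.End ℂ W) : IsCovariant D idOp := by
  intro n u
  rw [ncoeff_derivOp, LinearMap.smul_apply, ncoeff_idOp, ncoeff_idOp, ncoeff_idOp]
  by_cases h : n = 0
  · simp [h]
  · rw [if_neg (show n - 1 ≠ -1 by omega)]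
    split_ifs <;> simp

end VertexOperator

/-- A family of mutually local fields on `V` that generates `V` from the vector `vac`. -/
structure GeneratingFields (V : Type v) [AddCommGroup V] [Module ℂ V] (S : Type*) where
  /-- the fields -/
  X : S → VertexOperator ℂ V
  /-- the vacuum vector -/
  vac : V
  /-- the translation operator -/
  D : Module.End ℂ V
  isLocal : ∀ s t, IsLocal (X s) (X t)
  D_vac : D vac = 0
  covariant : ∀ s, IsCovariant D (X s)
  X_vac : ∀ s (n : ℤ), 0 ≤ n → ncoeff (X s) n vac = 0
  generates : ∀ N : Submodule ℂ V, vac ∈ N → (∀ s n, ∀ u ∈ N, ncoeff (X s) n u ∈ N) → N = ⊤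

namespace GeneratingFields

variable {V : Type v} [AddCommGroup V] [Module ℂ V] {S : Type*} (g : GeneratingFields V S)

/-- The fields that are local with the generating fields, covariant, and regular on the vacuum. -/
def fields : Submodule ℂ (VertexOperator ℂ V) where
  carrier := {a | (∀ s, IsLocal a (g.X s)) ∧ IsCovariant g.D a ∧
    ∀ n : ℤ, 0 ≤ n → ncoeff a n g.vac = 0}
  zero_mem' := ⟨fun s => (localSubmodule _).zero_mem, fun n u => by simp,
    fun n _ => by simp⟩
  add_mem' := by
    rintro a b ⟨ha1, ha2, ha3⟩ ⟨hb1, hb2, hb3⟩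
    refine ⟨fun s => (localSubmodule _).add_mem (ha1 s) (hb1 s), fun n u => ?_, fun n hn => ?_⟩
    · simp only [map_add, Pi.add_apply, LinearMap.add_apply, ha2 n u, hb2 n u]
      abel
    · simp [ha3 n hn, hb3 n hn]
  smul_mem' := by
    rintro c a ⟨ha1, ha2, ha3⟩
    refine ⟨fun s => (localSubmodule _).smul_mem c (ha1 s), fun n u => ?_, fun n hn => ?_⟩
    · simp only [map_smul, Pi.smul_apply, LinearMap.smul_apply, ha2 n u, smul_add]
    · simp [ha3 n hn]

/-- The map `a(z) ↦ a(-1)𝟏`. -/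
def eval : g.fields →ₗ[ℂ] V where
  toFun a := ncoeff a.1 (-1) g.vac
  map_add' a b := by simp
  map_smul' c a := by simp

theorem idOp_mem : idOp ∈ g.fields :=
  ⟨fun s => isLocal_idOp _, isCovariant_idOp _, fun n hn => by
    rw [ncoeff_idOp, if_neg (by omega)]⟩

theorem X_mem (s : S) : g.X s ∈ g.fields := ⟨g.isLocal s, g.covariant s, g.X_vac s⟩

variable {g} in
theorem expProd_vac {a b : VertexOperator ℂ V} (hb : b ∈ g.fields) (l m n : ℤ) (hn : 0 ≤ n) :
    expProd a b l m n g.vac = 0 :=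
  expProd_eq_zero _ _ _ _ _ fun n' hn' => hb.2.2 n' (by omega)

-- Regularity on the vacuum removes the ordering `b a` entirely, and all but the term `i = 0` of the
-- ordering `a b`. This is why evaluation at the vacuum turns products of fields into modes.
variable {g} in
theorem ncoeff_nprod_vac {a b : VertexOperator ℂ V} (ha : a ∈ g.fields) (hb : b ∈ g.fields)
    (l : ℤ) : ncoeff (nprod l a b) (-1) g.vac = ncoeff a l (ncoeff b (-1) g.vac) := by
  rw [ncoeff_nprod, expComm, LinearMap.sub_apply, LinearMap.smul_apply,
    expProd_vac ha _ _ _ le_rfl, expProd_eq_sum (K := 1)]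
  · simp
  · intro i hi
    exact hb.2.2 _ (by omega)

variable {g} in
theorem nprod_mem {a b : VertexOperator ℂ V} (ha : a ∈ g.fields) (hb : b ∈ g.fields)
    (hab : IsLocal a b) (l : ℤ) : nprod l a b ∈ g.fields := by
  refine ⟨fun s => (hab.nprod (ha.1 s).symm (hb.1 s).symm l).symm, ha.2.1.nprod hb.2.1 l,
    fun n hn => ?_⟩
  rw [ncoeff_nprod, expComm, LinearMap.sub_apply, LinearMap.smul_apply, expProd_vac hb _ _ _ hn,
    expProd_vac ha _ _ _ le_rfl, smul_zero, sub_zero]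

variable {g} in
/-- Goddard's uniqueness theorem. -/
theorem eq_zero_of_ncoeff_vac {a : VertexOperator ℂ V} (ha : a ∈ g.fields)
    (h : ncoeff a (-1) g.vac = 0) : a = 0 := by
  -- Covariance and `D 𝟏 = 0` give `(k + 1) a(-k-2)𝟏 = D(a(-k-1)𝟏)`, so in characteristic zero the
  -- vanishing propagates to all negative modes.
  have hneg : ∀ k : ℕ, ncoeff a (-k - 1) g.vac = 0 := by
    intro k
    induction k with
    | zero => simpa using h
    | succ k ih =>
      have hc := ha.2.1 (-k - 1) g.vac
      rw [ih, map_zero, g.D_vac, map_zero, zero_add, ncoeff_derivOp, LinearMap.smul_apply,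
        eq_comm, smul_eq_zero] at hc
      have := hc.resolve_left (by
        have : (k : ℂ) + 1 ≠ 0 := Nat.cast_add_one_ne_zero k
        push_cast
        rwa [neg_sub, sub_neg_eq_add, add_comm])
      rwa [show -((k + 1 : ℕ) : ℤ) - 1 = -k - 1 - 1 by push_cast; ring]
  have hvac : ∀ n, ncoeff a n g.vac = 0 := fun n => by
    rcases le_or_gt 0 n with hn | hn
    · exact ha.2.2 n hn
    · have := hneg (-n - 1).toNat
      rwa [show -((-n - 1).toNat : ℤ) - 1 = n by omega] at this
  -- The common kernel of all modes of `a` contains the vacuum; it remains to see that it is stable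
  -- under the generating fields.
  have htop := g.generates (⨅ n, LinearMap.ker (ncoeff a n)) (by simpa using hvac) (by
    intro s n u hu
    simp only [Submodule.mem_iInf, LinearMap.mem_ker] at hu ⊢
    intro m
    obtain ⟨N, hN⟩ := ha.1 s
    obtain ⟨L, hL⟩ := exists_ncoeff_eq_zero (g.X s) u
    -- The family vanishes for large `n` uniformly in `m`. Hence if `modeDiff` of such a family is
    -- zero the family is zero, and the powers of `modeDiff` can be removed one at a time. Locality
    -- supplies a power to start from, since on `u` the commutator with `a` is just `a(m) X(n) u`.
    have hE : ∀ (k : ℕ), (modeDiff _ ^ k) (fun m n => ncoeff a m (ncoeff (g.X s) n u)) = 0 →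
        ∀ m n, ncoeff a m (ncoeff (g.X s) n u) = 0 := by
      intro k hk
      suffices ∀ m n, (modeDiff _ ^ (0 : ℕ)) (fun m n => ncoeff a m (ncoeff (g.X s) n u)) m n = 0
        from this
      refine Nat.decreasingInduction (n := k) (motive := fun j _ => ∀ m n,
        (modeDiff _ ^ j) (fun m n => ncoeff a m (ncoeff (g.X s) n u)) m n = 0) ?_
        (fun m n => congrFun (congrFun hk m) n) (Nat.zero_le k)
      intro j _ hj
      set f := (modeDiff V ^ j) (fun m n => ncoeff a m (ncoeff (g.X s) n u)) with hf
      have hL' : ∀ m n, L ≤ n → f m n = 0 := by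
        rw [hf]
        clear hj hf f
        induction j with
        | zero => intro m n hn; simp [hL n hn]
        | succ j ih =>
          intro m n hn
          rw [modeDiff_pow_succ_apply, ih (by omega) _ _ hn, ih (by omega) _ _ (by omega), sub_zero]
      have hstep : ∀ m n, f m n = f (m - 1) (n + 1) := fun m n => by
        have := hj (m - 1) n
        rw [modeDiff_pow_succ_apply, sub_add_cancel, sub_eq_zero] at this
        exact this
      have hsteps : ∀ (i : ℕ) m n, f m n = f (m - i) (n + i) := fun i => by
        induction i with
        | zero => simp
        | succ i ihi =>
          intro m n
          rw [hstep, ihi]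
          push_cast
          congr 1 <;> ring
      intro m n
      rw [hsteps (L - n).toNat]
      exact hL' _ _ (by omega)
    refine hE N ?_ m n
    have hcomm : (fun m n => ncoeff a m (ncoeff (g.X s) n u))
        = fun m n => (LinearMap.applyₗ u : Module.End ℂ V →ₗ[ℂ] V) (expComm a (g.X s) 0 m n) := by
      funext m n
      simp [expComm_zero, hu]
    funext m n
    rw [hcomm, modeDiff_pow_map, hN]
    simp)
  refine ext_ncoeff fun n u => ?_
  have hu : u ∈ (⊤ : Submodule ℂ V) := trivial
  rw [← htop] at hu
  simp only [Submodule.mem_iInf, LinearMap.mem_ker] at hu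
  simp [hu n]

theorem eval_injective : Function.Injective g.eval := by
  rintro ⟨a, ha⟩ ⟨b, hb⟩ h
  change ncoeff a (-1) g.vac = ncoeff b (-1) g.vac at h
  have h0 : a + (-1 : ℂ) • b = 0 := by
    refine eq_zero_of_ncoeff_vac (add_mem ha (g.fields.smul_mem _ hb)) ?_
    simp [h]
  refine Subtype.ext (ext_ncoeff fun n u => ?_)
  have := congrArg (fun c => ncoeff c n u) h0
  simpa [← sub_eq_add_neg, sub_eq_zero] using this

theorem eval_surjective : Function.Surjective g.eval := by
  rw [← LinearMap.range_eq_top]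
  refine g.generates _ ⟨⟨idOp, g.idOp_mem⟩, by simp [eval, ncoeff_idOp]⟩ ?_
  rintro s n _ ⟨⟨a, ha⟩, rfl⟩
  -- The field attached to `X(n)u` is the `n`-th product of `X` with the field of `u`; Dong's lemma
  -- keeps it among the admissible fields.
  exact ⟨⟨nprod n (g.X s) a, nprod_mem (g.X_mem s) ha (ha.1 s).symm n⟩,
    ncoeff_nprod_vac (g.X_mem s) ha n⟩

/-- The state-field correspondence. -/
noncomputable def Y : V →ₗ[ℂ] VertexOperator ℂ V :=
  g.fields.subtype ∘ₗ (LinearEquiv.ofBijective g.eval ⟨g.eval_injective, g.eval_surjective⟩).symm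

theorem Y_mem (x : V) : g.Y x ∈ g.fields := Subtype.property _

theorem ncoeff_Y_vac (x : V) : ncoeff (g.Y x) (-1) g.vac = x :=
  (LinearEquiv.ofBijective g.eval ⟨g.eval_injective, g.eval_surjective⟩).apply_symm_apply x

theorem Y_eq {a : VertexOperator ℂ V} (ha : a ∈ g.fields) : g.Y (ncoeff a (-1) g.vac) = a := by
  have : (⟨_, g.Y_mem (ncoeff a (-1) g.vac)⟩ : g.fields) = ⟨a, ha⟩ :=
    g.eval_injective (g.ncoeff_Y_vac _)
  exact congrArg Subtype.val this

theorem Y_nprod_of_isLocal (x y : V) (h : IsLocal (g.Y x) (g.Y y)) (l : ℤ) :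
    g.Y (ncoeff (g.Y x) l y) = nprod l (g.Y x) (g.Y y) := by
  conv_lhs => rw [← g.ncoeff_Y_vac y, ← ncoeff_nprod_vac (g.Y_mem x) (g.Y_mem y) l]
  exact g.Y_eq (nprod_mem (g.Y_mem x) (g.Y_mem y) h l)

theorem Y_X (s : S) : g.Y (ncoeff (g.X s) (-1) g.vac) = g.X s := g.Y_eq (g.X_mem s)

/-- Admissible fields are only assumed local with the generators. The states whose field is local
with `Y x` contain the vacuum and, by Dong's lemma, are stable under the generating modes, so they
are all of `V`. -/
theorem isLocal_Y (x y : V) : IsLocal (g.Y x) (g.Y y) := by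
  have htop := g.generates ((localSubmodule (g.Y x)).comap g.Y) (by
    have h := g.Y_eq g.idOp_mem
    rw [ncoeff_idOp, if_pos rfl] at h
    rw [Submodule.mem_comap, h]
    exact isLocal_idOp _) (by
    intro s n u hu
    have hs := (g.Y_mem u).1 s
    have h := g.Y_nprod_of_isLocal (ncoeff (g.X s) (-1) g.vac) u (by rw [Y_X]; exact hs.symm) n
    rw [Y_X] at h
    rw [Submodule.mem_comap, h]
    exact (hs.symm.nprod ((g.Y_mem x).1 s) (IsLocal.symm hu) n).symm)
  have hy : y ∈ (⊤ : Submodule ℂ V) := trivial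
  rw [← htop] at hy
  exact IsLocal.symm hy

/-- The vertex algebra generated by the fields. -/
noncomputable def toVertexAlgebra : VertexAlgebra V where
  Y := g.Y
  vac := g.vac
  Y_vac n x := by
    have h := g.Y_eq g.idOp_mem
    rw [ncoeff_idOp, if_pos rfl] at h
    rw [h, ncoeff_idOp]
  creation := g.ncoeff_Y_vac
  creation_nonneg x n hn := (g.Y_mem x).2.2 n hn
  jacobi := jacobiIdentity_of_isLocal g.isLocal_Y
    fun x y l => g.Y_nprod_of_isLocal x y (g.isLocal_Y x y) l

end GeneratingFields

/-! ### The vertex algebra generated by a set of mutually local fields -/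

namespace VertexOperator

variable {W : Type w} [AddCommGroup W] [Module ℂ W]

/-- The field with the modes `a(n + 1)`. -/
noncomputable def shiftOp (a : VertexOperator ℂ W) : VertexOperator ℂ W :=
  ofModes (fun n => ncoeff a (n + 1)) fun u => by
    obtain ⟨N, hN⟩ := exists_ncoeff_eq_zero a u
    exact ⟨N, fun n hn => hN _ (by omega)⟩

theorem expProd_shiftOp_right (a b : VertexOperator ℂ W) (l m n : ℤ) :
    expProd a (shiftOp b) l m n = expProd a b l m (n + 1) := by
  ext u
  simp only [expProd_apply, shiftOp, ncoeff_ofModes, add_right_comm]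

theorem expProd_shiftOp_left (a b : VertexOperator ℂ W) (l m n : ℤ) :
    expProd (shiftOp a) b l m n = expProd a b l (m + 1) n := by
  ext u
  simp only [expProd_apply, shiftOp, ncoeff_ofModes]
  refine finsum_congr fun i => ?_
  rw [show m + l - (i : ℤ) + 1 = m + 1 + l - i by ring]

/-- The field `x(w) ↦ Res_z (z - w)ᵐ zᵖ a(z) x(w)`. -/
noncomputable def leftMul (a : VertexOperator ℂ W) (m p : ℤ) (x : VertexOperator ℂ W) :
    VertexOperator ℂ W :=
  ofModes (fun s => expProd a x m p s) fun u => by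
    obtain ⟨N, hN⟩ := exists_ncoeff_eq_zero x u
    exact ⟨N, fun n hn => expProd_eq_zero _ _ _ _ _ fun n' hn' => hN _ (by omega)⟩

/-- The field `x(w) ↦ Res_z (w - z)ᵐ zᵖ x(w) a(z)`. -/
noncomputable def rightMul (a : VertexOperator ℂ W) (m p : ℤ) (x : VertexOperator ℂ W) :
    VertexOperator ℂ W :=
  ofModes (fun s => expProd x a m s p) fun u => exists_expProd_eq_zero_left x a m p u

theorem ncoeff_leftMul (a : VertexOperator ℂ W) (m p : ℤ) (x : VertexOperator ℂ W) (s : ℤ) :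
    ncoeff (leftMul a m p x) s = expProd a x m p s := by rw [leftMul, ncoeff_ofModes]

theorem ncoeff_rightMul (a : VertexOperator ℂ W) (m p : ℤ) (x : VertexOperator ℂ W) (s : ℤ) :
    ncoeff (rightMul a m p x) s = expProd x a m s p := by rw [rightMul, ncoeff_ofModes]

/-- Pascal's rule for the kernel `z - w`; `shiftOp` is multiplication by `w`. -/
theorem leftMul_succ (a : VertexOperator ℂ W) (m p : ℤ) (x : VertexOperator ℂ W) :
    leftMul a (m + 1) p x = leftMul a m (p + 1) x + (-1 : ℂ) • shiftOp (leftMul a m p x) :=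
  ext_ncoeff fun n u => by
    simp [ncoeff_leftMul, expProd_succ, shiftOp, sub_eq_add_neg]

theorem rightMul_succ (a : VertexOperator ℂ W) (m p : ℤ) (x : VertexOperator ℂ W) :
    rightMul a (m + 1) p x = shiftOp (rightMul a m p x) + (-1 : ℂ) • rightMul a m (p + 1) x :=
  ext_ncoeff fun n u => by
    simp [ncoeff_rightMul, expProd_succ, shiftOp, sub_eq_add_neg]

theorem expProd_leftMul_succ (a b c : VertexOperator ℂ W) (m p n q s : ℤ) :
    expProd b (leftMul a (m + 1) p c) n q s
      = expProd b (leftMul a m (p + 1) c) n q s - expProd b (leftMul a m p c) n q (s + 1) := by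
  rw [leftMul_succ, expProd_add_right, expProd_smul_right, expProd_shiftOp_right, neg_one_smul,
    sub_eq_add_neg]

theorem expProd_leftMul_succ' (a b c : VertexOperator ℂ W) (m p n q s : ℤ) :
    expProd (leftMul a (m + 1) p c) b n s q
      = expProd (leftMul a m (p + 1) c) b n s q - expProd (leftMul a m p c) b n (s + 1) q := by
  rw [leftMul_succ, expProd_add_left, expProd_smul_left, expProd_shiftOp_left, neg_one_smul,
    sub_eq_add_neg]

theorem expProd_rightMul_succ (a b c : VertexOperator ℂ W) (m p n q s : ℤ) :
    expProd b (rightMul a (m + 1) p c) n q s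
      = expProd b (rightMul a m p c) n q (s + 1) - expProd b (rightMul a m (p + 1) c) n q s := by
  rw [rightMul_succ, expProd_add_right, expProd_smul_right, expProd_shiftOp_right, neg_one_smul,
    sub_eq_add_neg]

theorem expProd_rightMul_succ' (a b c : VertexOperator ℂ W) (m p n q s : ℤ) :
    expProd (rightMul a (m + 1) p c) b n s q
      = expProd (rightMul a m p c) b n (s + 1) q - expProd (rightMul a m (p + 1) c) b n s q := by
  rw [rightMul_succ, expProd_add_left, expProd_smul_left, expProd_shiftOp_left, neg_one_smul,
    sub_eq_add_neg]

/-- Left and right multiplications commute. -/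
theorem expProd_rightMul_eq (a b c : VertexOperator ℂ W) (m n p q s : ℤ) :
    expProd a (rightMul b n q c) m p s = expProd (leftMul a m p c) b n s q := by
  rw [← sub_eq_zero]
  ext u
  -- At `m = n = 0` the claim is associativity of composition. Pascal's rule extends it first in `m`
  -- with `n = 0`, then in `n`.
  have h0 : ∀ m p s q, (expProd a (rightMul b 0 q c) m p s
      - expProd (leftMul a m p c) b 0 s q) u = 0 := by
    intro m p s q
    refine eq_zero_of_pascal (E := fun m p s => (expProd a (rightMul b 0 q c) m p s
      - expProd (leftMul a m p c) b 0 s q) u) ?_ ?_ ?_ m p s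
    · intro p s
      simp [expProd_zero, ncoeff_leftMul, ncoeff_rightMul, mul_assoc]
    · intro m p s
      simp only [expProd_succ, expProd_leftMul_succ', LinearMap.sub_apply]
      abel
    · intro m
      obtain ⟨N, hN⟩ := exists_ncoeff_eq_zero (rightMul b 0 q c) u
      obtain ⟨N', hN'⟩ := exists_ncoeff_eq_zero c (ncoeff b q u)
      refine ⟨max N N', fun p s hs => ?_⟩
      rw [LinearMap.sub_apply, expProd_eq_zero _ _ _ _ _ fun s' hs' => hN s' (by omega),
        expProd_zero, Module.End.mul_apply, ncoeff_leftMul,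
        expProd_eq_zero _ _ _ _ _ fun s' hs' => hN' s' (by omega), sub_zero]
  refine eq_zero_of_pascal (E := fun n s q => (expProd a (rightMul b n q c) m p s
      - expProd (leftMul a m p c) b n s q) u) (fun s q => h0 m p s q) ?_ ?_ n s q
  · intro n s q
    simp only [expProd_succ, expProd_rightMul_succ, LinearMap.sub_apply]
    abel
  · intro n
    obtain ⟨N, hN⟩ := exists_ncoeff_eq_zero b u
    refine ⟨N, fun s q hq => ?_⟩
    rw [LinearMap.sub_apply, expProd_eq_zero (leftMul a m p c) _ _ _ _ fun s' hs' => hN s' (by omega),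
      expProd_eq_zero, sub_zero]
    intro s' _
    rw [ncoeff_rightMul, expProd_eq_zero _ _ _ _ _ fun s' hs' => hN s' (by omega)]

section Commutator

variable (a b c : VertexOperator ℂ W)

/-- The commutator of two left multiplications. -/
noncomputable def leftComm (m n p q s : ℤ) : Module.End ℂ W :=
  expProd a (leftMul b n q c) m p s - expProd b (leftMul a m p c) n q s

/-- The commutator of two right multiplications. -/
noncomputable def rightComm (m n p q s : ℤ) : Module.End ℂ W :=
  expProd (rightMul b n q c) a m s p - expProd (rightMul a m p c) b n s q

/-- With `p, q, s` read as the indices of `z₀, z₁, z₂`, raising `m` multiplies by `z₀ - z₂`, and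
raising `n` multiplies by `z₁ - z₂`. -/
theorem leftComm_succ_left (m n : ℤ) :
    leftComm a b c (m + 1) n = modeDiff02 _ (leftComm a b c m n) := by
  funext p q s
  change _ = leftComm a b c m n (p + 1) q s - leftComm a b c m n p q (s + 1)
  simp only [leftComm, expProd_succ, expProd_leftMul_succ]
  abel

theorem leftComm_succ_right (m n : ℤ) :
    leftComm a b c m (n + 1) = modeDiff12 _ (leftComm a b c m n) := by
  funext p q s
  change _ = leftComm a b c m n p (q + 1) s - leftComm a b c m n p q (s + 1)
  simp only [leftComm, expProd_succ, expProd_leftMul_succ]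
  abel

/-- The kernel of a right multiplication is `z₂ - z₀`, hence the minus sign. It is absorbed by the
signs `(-1)ᵐ(-1)ⁿ` in `nprod_nprod_sub`. -/
theorem rightComm_succ_left (m n : ℤ) :
    rightComm a b c (m + 1) n = -modeDiff02 _ (rightComm a b c m n) := by
  funext p q s
  change _ = -(rightComm a b c m n (p + 1) q s - rightComm a b c m n p q (s + 1))
  simp only [rightComm, expProd_succ, expProd_rightMul_succ']
  abel

theorem rightComm_succ_right (m n : ℤ) :
    rightComm a b c m (n + 1) = -modeDiff12 _ (rightComm a b c m n) := by
  funext p q s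
  change _ = -(rightComm a b c m n p (q + 1) s - rightComm a b c m n p q (s + 1))
  simp only [rightComm, expProd_succ, expProd_rightMul_succ']
  abel

variable {a b}

/-- At `m = n = 0` the family is `[a(p), b(q)] c(s)`, killed by locality of `a` and `b`.
Multiplication by `z₀ - z₁` commutes with that by `z₀ - z₂` and `z₁ - z₂`, so Pascal's rule carries
this to all `m`, `n`; truncation in `s` comes from `c`. -/
theorem modeDiff01_pow_leftComm {N : ℕ} (hN : (modeDiff _ ^ N) (expComm a b 0) = 0) (m n : ℤ) :
    (modeDiff01 _ ^ N) (leftComm a b c m n) = 0 := by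
  have htr : ∀ u, ∃ L : ℤ, ∀ (k : ℕ) m n p q s, L ≤ s →
      (modeDiff01 _ ^ k) (leftComm a b c m n) p q s u = 0 := by
    intro u
    obtain ⟨L, hL⟩ := exists_ncoeff_eq_zero c u
    refine ⟨L, fun k => ?_⟩
    induction k with
    | zero =>
      intro m n p q s hs
      change leftComm a b c m n p q s u = 0
      rw [leftComm, LinearMap.sub_apply, expProd_eq_zero, expProd_eq_zero, sub_zero]
      all_goals
        intro s' hs'
        rw [ncoeff_leftMul, expProd_eq_zero _ _ _ _ _ fun s' hs' => hL s' (by omega)]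
    | succ k ih =>
      intro m n p q s hs
      rw [pow_succ', Module.End.mul_apply, modeDiff_apply, Pi.sub_apply, LinearMap.sub_apply,
        ih _ _ _ _ _ hs, ih _ _ _ _ _ hs, sub_zero]
  have h00 : (modeDiff01 _ ^ N) (leftComm a b c 0 0) = 0 := by
    funext p q s
    rw [modeDiff01_pow_apply]
    have : (fun p q => leftComm a b c 0 0 p q s)
        = fun p q => LinearMap.mulRight ℂ (ncoeff c s) (expComm a b 0 p q) := by
      funext p q
      simp [leftComm, expProd_zero, ncoeff_leftMul, expComm_zero, sub_mul, mul_assoc]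
    rw [this, modeDiff_pow_map, hN]
    simp
  have h0 : ∀ m, (modeDiff01 _ ^ N) (leftComm a b c m 0) = 0 := by
    intro m
    funext p q s
    ext u
    refine eq_zero_of_pascal (E := fun m p s => (modeDiff01 _ ^ N) (leftComm a b c m 0) p q s u)
      ?_ ?_ ?_ m p s
    · intro p s; rw [h00]; rfl
    · intro m p s
      rw [leftComm_succ_left, ← Module.End.mul_apply,
        ((commute_modeDiff01_modeDiff02 _).pow_left N).eq]
      rfl
    · intro m
      obtain ⟨L, hL⟩ := htr u
      exact ⟨L, fun p s hs => hL _ _ _ _ _ _ hs⟩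
  funext p q s
  ext u
  refine eq_zero_of_pascal (E := fun n q s => (modeDiff01 _ ^ N) (leftComm a b c m n) p q s u)
    ?_ ?_ ?_ n q s
  · intro p s; rw [h0]; rfl
  · intro n q s
    rw [leftComm_succ_right, ← Module.End.mul_apply,
      ((commute_modeDiff01_modeDiff12 _).pow_left N).eq]
    rfl
  · intro m
    obtain ⟨L, hL⟩ := htr u
    exact ⟨L, fun p s hs => hL _ _ _ _ _ _ hs⟩

theorem exists_rightComm_eq_zero_left (m n q : ℤ) (u : W) :
    ∃ L : ℤ, ∀ p s, L ≤ p → rightComm a b c m n p q s u = 0 := by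
  obtain ⟨L, hL⟩ := exists_ncoeff_eq_zero a u
  obtain ⟨K, hK⟩ := exists_nat_ncoeff_eq_zero b q u
  choose L' hL' using fun i : ℕ => exists_ncoeff_eq_zero a (ncoeff b (q + i) u)
  refine ⟨max L (∑ i ∈ Finset.range K, |L' i|), fun p s hp => ?_⟩
  rw [rightComm, LinearMap.sub_apply, expProd_eq_zero _ _ _ _ _ fun s' hs' => hL s' (by omega),
    expProd_eq_sum _ _ _ _ _ hK, Finset.sum_eq_zero, sub_zero]
  intro i hi
  rw [ncoeff_rightMul, expProd_eq_zero, smul_zero]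
  intro p' hp'
  have := Finset.single_le_sum (f := fun i : ℕ => |L' i|) (fun i _ => by positivity) hi
  have h1 := le_abs_self (L' i)
  exact hL' i p' (by omega)

theorem exists_rightComm_eq_zero_right (m n p : ℤ) (u : W) :
    ∃ L : ℤ, ∀ q s, L ≤ q → rightComm a b c m n p q s u = 0 := by
  obtain ⟨L, hL⟩ := exists_rightComm_eq_zero_left (a := b) (b := a) c n m p u
  refine ⟨L, fun q s hq => ?_⟩
  have := hL q s hq
  rw [rightComm, LinearMap.sub_apply] at this ⊢
  rw [← neg_eq_zero, neg_sub]
  exact this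

/-- The argument for left multiplications, except that `a` and `b` now act first. So truncation is
available in `p` when `m` varies and in `q` when `n` varies, and Pascal's rule is run with the two
indices exchanged to absorb the sign. -/
theorem modeDiff01_pow_rightComm {N : ℕ} (hN : (modeDiff _ ^ N) (expComm a b 0) = 0) (m n : ℤ) :
    (modeDiff01 _ ^ N) (rightComm a b c m n) = 0 := by
  have htr₁ : ∀ (u : W) (m n : ℤ) (k : ℕ) (q : ℤ), ∃ L : ℤ, ∀ p s, L ≤ p →
      (modeDiff01 _ ^ k) (rightComm a b c m n) p q s u = 0 := by
    intro u m n k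
    induction k with
    | zero => exact fun q => exists_rightComm_eq_zero_left c m n q u
    | succ k ih =>
      intro q
      obtain ⟨L₁, h₁⟩ := ih q
      obtain ⟨L₂, h₂⟩ := ih (q + 1)
      refine ⟨max L₁ L₂, fun p s hp => ?_⟩
      rw [pow_succ', Module.End.mul_apply, modeDiff_apply, Pi.sub_apply, LinearMap.sub_apply,
        h₁ _ _ (by omega), h₂ _ _ (by omega), sub_zero]
  have htr₂ : ∀ (u : W) (m n : ℤ) (k : ℕ) (p : ℤ), ∃ L : ℤ, ∀ q s, L ≤ q →
      (modeDiff01 _ ^ k) (rightComm a b c m n) p q s u = 0 := by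
    intro u m n k
    induction k with
    | zero => exact fun p => exists_rightComm_eq_zero_right c m n p u
    | succ k ih =>
      intro p
      obtain ⟨L₁, h₁⟩ := ih p
      obtain ⟨L₂, h₂⟩ := ih (p + 1)
      refine ⟨max L₁ L₂, fun q s hq => ?_⟩
      rw [pow_succ', Module.End.mul_apply, modeDiff_apply, Pi.sub_apply, LinearMap.sub_apply,
        h₁ _ _ (by omega), h₂ _ _ (by omega), sub_zero]
  have h00 : (modeDiff01 _ ^ N) (rightComm a b c 0 0) = 0 := by
    funext p q s
    rw [modeDiff01_pow_apply]
    have : (fun p q => rightComm a b c 0 0 p q s)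
        = fun p q => (-LinearMap.mulLeft ℂ (ncoeff c s)) (expComm a b 0 p q) := by
      funext p q
      simp [rightComm, expProd_zero, ncoeff_rightMul, expComm_zero, mul_sub, mul_assoc]
    rw [this, modeDiff_pow_map, hN]
    simp
  have h0 : ∀ m, (modeDiff01 _ ^ N) (rightComm a b c m 0) = 0 := by
    intro m
    funext p q s
    ext u
    refine eq_zero_of_pascal (E := fun m s p => (modeDiff01 _ ^ N) (rightComm a b c m 0) p q s u)
      ?_ ?_ ?_ m s p
    · intro p s; rw [h00]; rfl
    · intro m s p
      rw [rightComm_succ_left, map_neg, ← Module.End.mul_apply,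
        ((commute_modeDiff01_modeDiff02 _).pow_left N).eq, Module.End.mul_apply,
        ← LinearMap.sub_apply]
      congr 1
      exact neg_sub _ _
    · intro m
      obtain ⟨L, hL⟩ := htr₁ u m 0 N q
      exact ⟨L, fun s p hp => hL _ _ hp⟩
  funext p q s
  ext u
  refine eq_zero_of_pascal (E := fun n s q => (modeDiff01 _ ^ N) (rightComm a b c m n) p q s u)
    ?_ ?_ ?_ n s q
  · intro s q; rw [h0]; rfl
  · intro n s q
    rw [rightComm_succ_right, map_neg, ← Module.End.mul_apply,
      ((commute_modeDiff01_modeDiff12 _).pow_left N).eq, Module.End.mul_apply,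
      ← LinearMap.sub_apply]
    congr 1
    exact neg_sub _ _
  · intro n
    obtain ⟨L, hL⟩ := htr₂ u m n N p
    exact ⟨L, fun s q hq => hL _ _ hq⟩

/-- The commutator `[aₘ, bₙ]` of product operators, applied to `c`. -/
theorem nprod_nprod_sub (a b c : VertexOperator ℂ W) (m n s : ℤ) :
    ncoeff (nprod m a (nprod n b c)) s - ncoeff (nprod n b (nprod m a c)) s
      = leftComm a b c m n 0 0 s
        + (m.negOnePow * n.negOnePow : ℤ) • rightComm a b c m n 0 0 s := by
  have e : ∀ (n : ℤ) (b : VertexOperator ℂ W), nprod n b c = leftMul b n 0 c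
      + (-(n.negOnePow : ℤ) : ℂ) • rightMul b n 0 c := fun n b =>
    ext_ncoeff fun s u => by
      simp only [ncoeff_nprod, expComm, LinearMap.sub_apply, LinearMap.smul_apply, map_add,
        Pi.add_apply, LinearMap.add_apply, map_smul, Pi.smul_apply, ncoeff_leftMul,
        ncoeff_rightMul]
      module
  rw [ncoeff_nprod, ncoeff_nprod, e n b, e m a]
  simp only [expComm, expProd_add_right, expProd_add_left, expProd_smul_left, expProd_smul_right,
    expProd_rightMul_eq, leftComm, rightComm]
  module

/-- The product operators of mutually local fields are mutually local. -/
theorem modeDiff_pow_nprod_comm {N : ℕ} (hN : (modeDiff _ ^ N) (expComm a b 0) = 0) (m n s : ℤ) :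
    (modeDiff _ ^ N) (fun m n => ncoeff (nprod m a (nprod n b c)) s
      - ncoeff (nprod n b (nprod m a c)) s) m n = 0 := by
  set H : ℤ → ℤ → ℤ → ℤ → ℤ → Module.End ℂ W := fun m n => leftComm a b c m n
      + (m.negOnePow * n.negOnePow : ℤ) • rightComm a b c m n with hH
  -- Raising `m` multiplies by `z₀ - z₂` and raising `n` by `z₁ - z₂`, so the difference in the
  -- product indices `(m, n)` is multiplication by `z₀ - z₁`. Thus locality of the product operators
  -- has the same order `N` as that of `a` and `b`.
  have hs : ∀ k m n, (modeDiff _ ^ k) H m n = (modeDiff01 _ ^ k) (H m n) := by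
    intro k
    induction k with
    | zero => exact fun _ _ => rfl
    | succ k ih =>
      intro m n
      rw [modeDiff_pow_succ_apply, ih, ih, ← map_sub, pow_succ, Module.End.mul_apply]
      congr 1
      have e2 : modeDiff01 (Module.End ℂ W) = modeDiff02 _ - modeDiff12 _ := by
        rw [modeDiff02_eq, add_sub_cancel_right]
      rw [e2]
      simp only [hH, leftComm_succ_left, leftComm_succ_right, rightComm_succ_left,
        rightComm_succ_right, map_add, map_zsmul, LinearMap.sub_apply, Int.negOnePow_succ,
        Units.val_neg]
      module
  have hz : ∀ m n, (modeDiff01 _ ^ N) (H m n) = 0 := fun m n => by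
    rw [hH]
    simp only
    rw [map_add, map_zsmul, modeDiff01_pow_leftComm c hN, modeDiff01_pow_rightComm c hN, smul_zero,
      add_zero]
  have h1 : (fun m n => ncoeff (nprod m a (nprod n b c)) s - ncoeff (nprod n b (nprod m a c)) s)
      = fun m n => (LinearMap.proj s ∘ₗ LinearMap.proj 0 ∘ₗ LinearMap.proj 0 :
        (ℤ → ℤ → ℤ → Module.End ℂ W) →ₗ[ℂ] Module.End ℂ W) (H m n) := by
    funext m n
    rw [nprod_nprod_sub]
    rfl
  rw [h1, modeDiff_pow_map, hs, hz, map_zero]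

end Commutator

/-- Says that the product operator of `a` is covariant for `d/dz` on the space of fields, one of the
inputs to reconstruction there. -/
theorem derivOp_nprod (l : ℤ) (a c : VertexOperator ℂ W) :
    derivOp (nprod l a c) = nprod l a (derivOp c) + (-l : ℂ) • nprod (l - 1) a c := by
  refine ext_ncoeff fun n u => ?_
  have e : ((l - 1).negOnePow : ℤ) = -(l.negOnePow : ℤ) := by
    rw [Int.negOnePow_sub, Int.negOnePow_one]; simp
  simp only [ncoeff_derivOp, map_add, map_smul, Pi.add_apply, Pi.smul_apply, LinearMap.add_apply,
    LinearMap.smul_apply, ncoeff_nprod, expComm, expProd_derivOp_right, expProd_derivOp_left,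
    LinearMap.sub_apply, LinearMap.neg_apply, e]
  module

theorem expComm_idOp (a : VertexOperator ℂ W) (m n : ℤ) : expComm a idOp 0 m n = 0 := by
  ext u
  simp only [expComm_zero, LinearMap.sub_apply, Module.End.mul_apply, ncoeff_idOp]
  split_ifs <;> simp

theorem nprod_idOp_of_nonneg (a : VertexOperator ℂ W) {l : ℤ} (hl : 0 ≤ l) :
    nprod l a idOp = 0 := by
  refine ext_ncoeff fun n u => ?_
  obtain ⟨k, rfl⟩ := Int.eq_ofNat_of_zero_le hl
  have : expComm a idOp 0 = 0 := by funext m n; exact expComm_idOp a m n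
  rw [ncoeff_nprod, expComm_natCast, this]
  simp

theorem neg_one_pow_mul_choose_neg_one (i : ℕ) : ((-1) ^ i * Ring.choose (-1 : ℤ) i : ℤ) = 1 := by
  induction i with
  | zero => simp
  | succ i ih =>
    have h := Ring.choose_succ_succ (-1 : ℤ) i
    rw [neg_add_cancel, Ring.choose_zero_succ] at h
    rw [pow_succ]
    linear_combination ih + (-1) ^ i * h

/-- The two expansions of `(z₁ - z₂)⁻¹` have all coefficients `1` up to an overall sign and add up
to a delta function. Each mode of `a` comes from exactly one of them: `n ≥ 0` from the second, at `i
= n`, and `n < 0` from the first, at `i = -1 - n`. -/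
theorem nprod_neg_one_idOp (a : VertexOperator ℂ W) : nprod (-1) a idOp = a := by
  refine ext_ncoeff fun n u => ?_
  have hneg : ((-1 : ℤ).negOnePow : ℤ) = -1 := by
    rw [Int.negOnePow_neg, Int.negOnePow_one]; rfl
  rw [ncoeff_nprod, expComm, LinearMap.sub_apply, LinearMap.smul_apply, expProd_apply,
    expProd_apply, hneg]
  simp only [neg_one_pow_mul_choose_neg_one, one_smul, ncoeff_idOp, zero_add, neg_smul,
    sub_neg_eq_add]
  rcases le_or_gt 0 n with hn | hn
  · rw [finsum_eq_single _ 0, finsum_eq_single _ n.toNat]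
    · rw [if_neg (by omega), if_pos (by omega), map_zero, zero_add, Int.toNat_of_nonneg hn]
    · intro i hi; rw [if_neg (by omega)]
    · intro i _; rw [if_neg (by omega), map_zero]
  · rw [finsum_eq_single _ (-1 - n).toNat, finsum_eq_single _ 0]
    · rw [if_pos (by omega), if_neg (by omega), add_zero, Int.toNat_of_nonneg (by omega),
        show (-1 : ℤ) - (-1 - n) = n by ring]
    · intro i _; rw [if_neg (by omega)]
    · intro i hi; rw [if_neg (by omega), map_zero]

theorem derivOp_idOp : derivOp (idOp : VertexOperator ℂ W) = 0 := by
  refine ext_ncoeff fun n u => ?_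
  rw [ncoeff_derivOp, LinearMap.smul_apply, ncoeff_idOp]
  by_cases h : n = 0
  · simp [h]
  · rw [if_neg (by omega)]; simp

theorem nprod_neg_two_idOp (a : VertexOperator ℂ W) : nprod (-2) a idOp = derivOp a := by
  have h := derivOp_nprod (-1) a idOp
  rw [nprod_neg_one_idOp, derivOp_idOp] at h
  rw [h]
  refine ext_ncoeff fun n u => ?_
  have h0 : nprod (-1) a (0 : VertexOperator ℂ W) = 0 := map_zero (nprodLin (-1) a)
  simp [h0]

end VertexOperator

/-! ### The closure of a local family and its vertex algebra structure -/

section LocalClosure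

variable {W : Type w} [AddCommGroup W] [Module ℂ W] {S : Type*} (X : S → VertexOperator ℂ W)

/-- The fields that are local with every field that is local with the family `X`. -/
def localClosure : Submodule ℂ (VertexOperator ℂ W) :=
  ⨅ (d : VertexOperator ℂ W) (_ : ∀ s, IsLocal d (X s)), localSubmodule d

variable {X}

theorem mem_localClosure {c : VertexOperator ℂ W} :
    c ∈ localClosure X ↔ ∀ d, (∀ s, IsLocal d (X s)) → IsLocal c d := by
  simp only [localClosure, Submodule.mem_iInf]
  rfl

theorem idOp_mem_localClosure : idOp ∈ localClosure X :=
  mem_localClosure.2 fun _ _ => isLocal_idOp _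

theorem mem_localClosure_self (s : S) : X s ∈ localClosure X :=
  mem_localClosure.2 fun _ hd => (hd s).symm

/-- A bicommutant argument: each `X s` is local with the family, so `d` is local with each `X s`,
and then `c` is local with `d` by definition of the closure. -/
theorem isLocal_of_mem_localClosure (hloc : ∀ s t, IsLocal (X s) (X t))
    {c d : VertexOperator ℂ W} (hc : c ∈ localClosure X) (hd : d ∈ localClosure X) :
    IsLocal c d :=
  mem_localClosure.1 hc d fun s => mem_localClosure.1 hd (X s) (hloc s)

theorem nprod_mem_localClosure (hloc : ∀ s t, IsLocal (X s) (X t))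
    {c d : VertexOperator ℂ W} (hc : c ∈ localClosure X) (hd : d ∈ localClosure X) (n : ℤ) :
    nprod n c d ∈ localClosure X :=
  mem_localClosure.2 fun e he => ((isLocal_of_mem_localClosure hloc hc hd).nprod
    (mem_localClosure.1 hc e he).symm (mem_localClosure.1 hd e he).symm n).symm

variable (X) in
/-- The closure of a family of fields under locality, as a vector space. -/
def LocalClosure : Type w := localClosure X

noncomputable instance : AddCommGroup (LocalClosure X) :=
  inferInstanceAs (AddCommGroup (localClosure X))
noncomputable instance : Module ℂ (LocalClosure X) := inferInstanceAs (Module ℂ (localClosure X))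

namespace LocalClosure

variable (X) in
/-- The inclusion into the space of all fields. -/
def val : LocalClosure X →ₗ[ℂ] VertexOperator ℂ W where
  toFun c := Subtype.val c
  map_add' _ _ := rfl
  map_smul' _ _ := rfl

theorem val_mem (c : LocalClosure X) : val X c ∈ localClosure X := Subtype.property c

theorem ext {c d : LocalClosure X} (h : val X c = val X d) : c = d := Subtype.ext h

/-- An element of the closure of `X` under locality. -/
def mk (c : VertexOperator ℂ W) (hc : c ∈ localClosure X) : LocalClosure X := ⟨c, hc⟩

@[simp] theorem val_mk (c : VertexOperator ℂ W) (hc : c ∈ localClosure X) :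
    val X (mk c hc) = c := rfl

variable (hloc : ∀ s t, IsLocal (X s) (X t))

/-- The operator `d ↦ cₙd`. -/
noncomputable def mode (c : LocalClosure X) (n : ℤ) : Module.End ℂ (LocalClosure X) where
  toFun d := mk (nprod n (val X c) (val X d)) (nprod_mem_localClosure hloc c.val_mem d.val_mem n)
  map_add' d e := ext (by simp [nprod_add_right])
  map_smul' r d := ext (by simp [nprod_smul_right])

theorem val_mode (c : LocalClosure X) (n : ℤ) (d : LocalClosure X) :
    val X (mode hloc c n d) = nprod n (val X c) (val X d) := rfl

/-- The derivation `d/dz`. -/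
noncomputable def deriv : Module.End ℂ (LocalClosure X) where
  toFun c := mk (derivOp (val X c)) (by
    rw [← nprod_neg_two_idOp]
    exact nprod_mem_localClosure hloc c.val_mem idOp_mem_localClosure _)
  map_add' c d := ext (by simp)
  map_smul' r c := ext (by simp)

theorem val_deriv (c : LocalClosure X) : val X (deriv hloc c) = derivOp (val X c) := rfl

/-- The field `∑ₙ cₙ z⁻ⁿ⁻¹`. -/
noncomputable def op (c : LocalClosure X) : VertexOperator ℂ (LocalClosure X) :=
  ofModes (mode hloc c) fun d => by
    obtain ⟨N, hN⟩ := (isLocal_of_mem_localClosure hloc c.val_mem d.val_mem).exists_nprod_eq_zero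
    exact ⟨N, fun n hn => ext (by rw [val_mode, hN n hn, map_zero])⟩

theorem ncoeff_op (c : LocalClosure X) (n : ℤ) : ncoeff (op hloc c) n = mode hloc c n := by
  rw [op, ncoeff_ofModes]

theorem ncoeff_op_idOp (c : LocalClosure X) :
    ncoeff (op hloc c) (-1) (mk idOp idOp_mem_localClosure) = c := by
  rw [ncoeff_op]
  exact ext (nprod_neg_one_idOp _)

/-- The product operators are generating fields on the closure of a mutually local family. -/
noncomputable def generators : GeneratingFields (LocalClosure X) (LocalClosure X) where
  X := op hloc
  vac := mk idOp idOp_mem_localClosure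
  D := deriv hloc
  isLocal s t := by
    obtain ⟨N, hN⟩ := isLocal_of_mem_localClosure hloc s.val_mem t.val_mem
    refine ⟨N, ?_⟩
    funext m n
    refine LinearMap.ext fun c => ext (ext_ncoeff fun k u => ?_)
    -- Evaluating at a field `c` and taking its `k`-th mode is linear, so it commutes with the
    -- difference operator and reduces locality to `modeDiff_pow_nprod_comm`.
    let ev : Module.End ℂ (LocalClosure X) →ₗ[ℂ] Module.End ℂ W :=
      { toFun := fun f => ncoeff (val X (f c)) k
        map_add' := fun f g => by simp
        map_smul' := fun r f => by simp }
    have h := modeDiff_pow_nprod_comm (val X c) hN m n k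
    have e : (fun m n => ncoeff (nprod m (val X s) (nprod n (val X t) (val X c))) k
        - ncoeff (nprod n (val X t) (nprod m (val X s) (val X c))) k)
        = fun m n => ev (expComm (op hloc s) (op hloc t) 0 m n) := by
      funext m n
      simp only [expComm_zero, ncoeff_op, map_sub]
      rfl
    rw [e, modeDiff_pow_map] at h
    have h' := LinearMap.congr_fun h u
    simpa [ev] using h'
  D_vac := ext (by rw [val_deriv, val_mk, derivOp_idOp, map_zero])
  covariant s n c := by
    refine ext ?_
    rw [ncoeff_derivOp, ncoeff_op, ncoeff_op]
    simp only [val_deriv, val_mode, derivOp_nprod, LinearMap.smul_apply, map_add, map_smul]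
  X_vac s n hn := by
    rw [ncoeff_op]
    exact ext (by rw [val_mode, val_mk, nprod_idOp_of_nonneg _ hn, map_zero])
  generates N h1 h2 := by
    -- The whole closure is the generating family, so one step suffices: `c = c(-1) id`.
    rw [eq_top_iff]
    rintro c -
    rw [← ncoeff_op_idOp hloc c]
    exact h2 c (-1) _ h1

/-- The vertex algebra of fields generated by a mutually local family. -/
noncomputable def vertexAlgebra : VertexAlgebra (LocalClosure X) :=
  (generators hloc).toVertexAlgebra

theorem vertexAlgebra_vac :
    (vertexAlgebra hloc).vac = mk idOp idOp_mem_localClosure := rfl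

theorem vertexAlgebra_Y (c : LocalClosure X) (n : ℤ) :
    ncoeff ((vertexAlgebra hloc).Y c) n = mode hloc c n := by
  have h := (generators hloc).Y_X c
  have e : ncoeff ((generators hloc).X c) (-1) (generators hloc).vac = c := ncoeff_op_idOp hloc c
  rw [e] at h
  rw [← ncoeff_op hloc]
  exact congrArg (fun a => ncoeff a n) h

end LocalClosure

end LocalClosure

/-! ### Representations of `U(ℒ)` -/

section Representations

variable {A : Type u} {B : Type v} [CommRing A] [Algebra ℂ A]
  [AddCommGroup B] [Module ℂ B] [VertexAlgebroid A B]

theorem md_add (x y : A × B) (n : ℤ) : md A B (x + y) n = md A B x n + md A B y n := by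
  simp [md, Finsupp.single_add]

theorem md_smul (c : ℂ) (x : A × B) (n : ℤ) : md A B (c • x) n = c • md A B x n := by
  simp only [md, ← Finsupp.smul_single, map_smul]

theorem md_zero (n : ℤ) : md A B 0 n = 0 := by simp [md]

theorem md_der (a : A) (n : ℤ) : md A B (0, der a) n = (-n : ℂ) • md A B (a, 0) (n - 1) := by
  have h : LieL.mk A B (dHat A B (Finsupp.single n a)) = 0 := LieL.mk_eq_zero.2 ⟨_, rfl⟩
  rw [dHat_single, map_add, map_smul, add_eq_zero_iff_eq_neg, ← neg_smul] at h
  rw [md, h, map_smul, md]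

theorem md_comm (x y : A × B) (m n : ℤ) :
    md A B x m * md A B y n - md A B y n * md A B x m
      = md A B (prod0 A B x y) (m + n) + (m : ℂ) • md A B (prod1 A B x y) (m + n - 1) := by
  let : LieRing (UL A B) := LieRing.ofAssociativeRing
  have h := (UniversalEnvelopingAlgebra.ι ℂ (L := LieL A B)).map_lie
    (LieL.mk A B (Finsupp.single m x)) (LieL.mk A B (Finsupp.single n y))
  rw [LieL.lie_mk, loopBr_single, map_add, map_smul, map_add, map_smul] at h
  rw [md, md, md, md, h]
  rfl

/-! ### Homomorphisms out of `U(ℒ)` -/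

section Lift

attribute [local instance 100] LieRing.ofAssociativeRing

variable {R : Type*} [Ring R] [Algebra ℂ R] (X : ℤ → (A × B) →ₗ[ℂ] R)
  (hder : ∀ a n, X n (0, der a) = (-n : ℂ) • X (n - 1) (a, 0))
  (hcomm : ∀ x y m n, X m x * X n y - X n y * X m x
    = X (m + n) (prod0 A B x y) + (m : ℂ) • X (m + n - 1) (prod1 A B x y))

/-- The homomorphism from `U(ℒ)` determined by the images of the elements `x(n)`. -/
noncomputable def liftUL : UL A B →ₐ[ℂ] R :=
  UniversalEnvelopingAlgebra.lift ℂ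
    { (LinearMap.range (dHat A B)).liftQ (Finsupp.lsum ℂ X) (by
        rintro _ ⟨y, rfl⟩
        rw [LinearMap.mem_ker]
        induction y using Finsupp.induction_linear with
        | zero => simp
        | add y y' hy hy' => rw [map_add, map_add, hy, hy', add_zero]
        | single n a =>
          rw [dHat_single, map_add, map_smul, Finsupp.lsum_single, Finsupp.lsum_single, hder,
            neg_smul, neg_add_cancel]) with
      map_lie' := by
        intro x y
        obtain ⟨x, rfl⟩ := LieL.mk_surjective A B x
        obtain ⟨y, rfl⟩ := LieL.mk_surjective A B y
        change Finsupp.lsum ℂ X (loopBr A B x y)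
          = Finsupp.lsum ℂ X x * Finsupp.lsum ℂ X y - Finsupp.lsum ℂ X y * Finsupp.lsum ℂ X x
        induction x using Finsupp.induction_linear with
        | zero => simp
        | add x x' hx hx' =>
          simp only [map_add, LinearMap.add_apply, hx, hx', add_mul, mul_add]; abel
        | single m x =>
        induction y using Finsupp.induction_linear with
        | zero => simp
        | add y y' hy hy' => simp only [map_add, hy, hy', add_mul, mul_add]; abel
        | single n y =>
        rw [loopBr_single, map_add, map_smul]
        simp only [Finsupp.lsum_single]
        exact (hcomm x y m n).symm }

theorem liftUL_md (x : A × B) (n : ℤ) : liftUL X hder hcomm (md A B x n) = X n x := by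
  rw [liftUL, md, UniversalEnvelopingAlgebra.lift_ι_apply]
  change Finsupp.lsum ℂ X (Finsupp.single n x) = _
  rw [Finsupp.lsum_single]

theorem UL_hom_ext {f g : UL A B →ₐ[ℂ] R} (h : ∀ x n, f (md A B x n) = g (md A B x n)) :
    f = g := by
  apply UniversalEnvelopingAlgebra.hom_ext
  ext x
  obtain ⟨x, rfl⟩ := LieL.mk_surjective A B x
  induction x using Finsupp.induction_linear with
  | zero => simp
  | add x y hx hy => simp only [map_add, hx, hy]
  | single n x => exact h x n

end Lift

/-- The universal property gives a homomorphism from `U(ℒ)` to the subalgebra generated by the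
`x(n)`; composed with the inclusion it fixes every `x(n)`, so it is the identity. -/
theorem adjoin_md : Algebra.adjoin ℂ {p : UL A B | ∃ x n, p = md A B x n} = ⊤ := by
  set S := Algebra.adjoin ℂ {p : UL A B | ∃ x n, p = md A B x n}
  have hS : ∀ x n, md A B x n ∈ S := fun x n => Algebra.subset_adjoin ⟨x, n, rfl⟩
  let X : ℤ → (A × B) →ₗ[ℂ] S := fun n =>
    { toFun := fun x => ⟨md A B x n, hS x n⟩
      map_add' := fun x y => Subtype.ext (md_add x y n)
      map_smul' := fun c x => Subtype.ext (md_smul c x n) }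
  let f : UL A B →ₐ[ℂ] S := liftUL X (fun a n => Subtype.ext (md_der a n))
    (fun x y m n => Subtype.ext (md_comm x y m n))
  have h : S.val.comp f = AlgHom.id ℂ _ := UL_hom_ext fun x n => by
    rw [AlgHom.comp_apply, liftUL_md]
    rfl
  rw [eq_top_iff]
  rintro p -
  rw [← AlgHom.id_apply (R := ℂ) p, ← h]
  exact Subtype.property _

/-! ### Restricted modules and their fields -/

section Module

variable {W : Type w} [AddCommGroup W] [Module ℂ W] [Module (UL A B) W]
  [IsScalarTower ℂ (UL A B) W]

/-- A subspace that is stable under the elements `x(n)` is stable under `U(ℒ)`. -/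
theorem smul_mem_of_md {N : Submodule ℂ W} (h : ∀ x n, ∀ v ∈ N, md A B x n • v ∈ N)
    (p : UL A B) {v : W} (hv : v ∈ N) : p • v ∈ N := by
  have hp : p ∈ Algebra.adjoin ℂ {p : UL A B | ∃ x n, p = md A B x n} := by
    rw [adjoin_md]; trivial
  induction hp using Algebra.adjoin_induction generalizing v with
  | mem p hp =>
    obtain ⟨x, n, rfl⟩ := hp
    exact h x n v hv
  | algebraMap r => rw [algebraMap_smul]; exact N.smul_mem r hv
  | add p q _ _ hp hq => rw [add_smul]; exact add_mem (hp hv) (hq hv)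
  | mul p q _ _ hp hq => rw [mul_smul]; exact hp (hq hv)

theorem md_smul_comm (x y : A × B) (m n : ℤ) (v : W) :
    md A B x m • md A B y n • v = md A B y n • md A B x m • v
      + (md A B (prod0 A B x y) (m + n) • v
        + (m : ℂ) • md A B (prod1 A B x y) (m + n - 1) • v) := by
  rw [← smul_assoc (m : ℂ), ← add_smul, ← md_comm, sub_smul, mul_smul, mul_smul]
  abel

variable (A B W) in
/-- Each vector is annihilated by `x(n)` for large `n`. -/
def IsRestricted : Prop := ∀ (v : W) (x : A × B), ∃ N : ℤ, ∀ n, N ≤ n → md A B x n • v = 0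

variable (A B W) in
/-- The subspace of vectors that are annihilated by `x(n)` for large `n`. -/
def restrictedVectors : Submodule ℂ W where
  carrier := {v | ∀ x : A × B, ∃ N : ℤ, ∀ n, N ≤ n → md A B x n • v = 0}
  zero_mem' := fun x => ⟨0, fun n _ => smul_zero _⟩
  add_mem' := by
    intro v v' hv hv' x
    obtain ⟨N, hN⟩ := hv x
    obtain ⟨N', hN'⟩ := hv' x
    exact ⟨max N N', fun n hn => by
      rw [smul_add, hN n (by omega), hN' n (by omega), add_zero]⟩
  smul_mem' := by
    intro c v hv x
    obtain ⟨N, hN⟩ := hv x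
    exact ⟨N, fun n hn => by rw [smul_algebra_smul_comm, hN n hn, smul_zero]⟩

/-- Moving `x(n)` past `y(m)` produces modes of `x₀y` and `x₁y` whose index also tends to infinity
with `n`. So restrictedness need only be checked on generators of a module. -/
theorem smul_mem_restrictedVectors (p : UL A B) {v : W} (hv : v ∈ restrictedVectors A B W) :
    p • v ∈ restrictedVectors A B W := by
  refine smul_mem_of_md ?_ p hv
  intro y m v hv x
  obtain ⟨N₁, h₁⟩ := hv x
  obtain ⟨N₂, h₂⟩ := hv (prod0 A B x y)
  obtain ⟨N₃, h₃⟩ := hv (prod1 A B x y)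
  refine ⟨max N₁ (max (N₂ - m) (N₃ - m + 1)), fun n hn => ?_⟩
  rw [md_smul_comm, h₁ n (by omega), h₂ _ (by omega), h₃ _ (by omega)]
  simp

/-- The field `∑ₙ x(n) z⁻ⁿ⁻¹` on a restricted module. -/
noncomputable def modeField (h : IsRestricted A B W) (x : A × B) : VertexOperator ℂ W :=
  ofModes (fun n => Algebra.lsmul ℂ ℂ W (md A B x n)) fun v => h v x

variable (h : IsRestricted A B W)

theorem ncoeff_modeField (x : A × B) (n : ℤ) (v : W) :
    ncoeff (modeField h x) n v = md A B x n • v :=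
  LinearMap.congr_fun (ncoeff_ofModes (fun n => Algebra.lsmul ℂ ℂ W (md A B x n)) _ n) v

theorem modeField_add (x y : A × B) : modeField h (x + y) = modeField h x + modeField h y :=
  ext_ncoeff fun n v => by simp [ncoeff_modeField, md_add, add_smul]

theorem modeField_smul (c : ℂ) (x : A × B) : modeField h (c • x) = c • modeField h x :=
  ext_ncoeff fun n v => by simp [ncoeff_modeField, md_smul]

theorem modeField_der (a : A) : modeField h (0, der a) = derivOp (modeField h (a, 0)) :=
  ext_ncoeff fun n v => by
    rw [ncoeff_derivOp, LinearMap.smul_apply, ncoeff_modeField, ncoeff_modeField, md_der, smul_assoc]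

theorem expComm_modeField (x y : A × B) (m n : ℤ) (v : W) :
    expComm (modeField h x) (modeField h y) 0 m n v
      = md A B (prod0 A B x y) (m + n) • v
        + (m : ℂ) • md A B (prod1 A B x y) (m + n - 1) • v := by
  rw [expComm_zero, LinearMap.sub_apply, Module.End.mul_apply, Module.End.mul_apply]
  simp only [ncoeff_modeField]
  rw [md_smul_comm, add_sub_cancel_left]

/-- One factor `z₁ - z₂` cancels the `x₀y` term of the commutator and leaves that of `x₁y`; a second
factor kills everything. Hence locality of order two, and the nonnegative products of the fields are
those of `A ⊕ B`. -/
theorem expComm_one_modeField (x y : A × B) (m n : ℤ) (v : W) :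
    expComm (modeField h x) (modeField h y) 1 m n v = md A B (prod1 A B x y) (m + n) • v := by
  have e := expComm_succ (modeField h x) (modeField h y) 0 m n
  rw [zero_add] at e
  rw [e, LinearMap.sub_apply, expComm_modeField, expComm_modeField,
    show m + 1 + n = m + (n + 1) by ring, show m + (n + 1) - 1 = m + n by ring, Int.cast_add,
    Int.cast_one, add_smul, one_smul]
  abel

theorem expComm_modeField_of_two_le (x y : A × B) (k : ℕ) (m n : ℤ) :
    expComm (modeField h x) (modeField h y) (k + 2) m n = 0 := by
  induction k generalizing m n with
  | zero =>
    ext v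
    have e := expComm_succ (modeField h x) (modeField h y) 1 m n
    rw [Nat.cast_zero, zero_add]
    rw [show (2 : ℤ) = 1 + 1 by norm_num, e, LinearMap.sub_apply, expComm_one_modeField,
      expComm_one_modeField, show m + 1 + n = m + (n + 1) by ring, sub_self]
    rfl
  | succ k ih =>
    rw [Nat.cast_succ, add_right_comm, expComm_succ, ih, ih, sub_zero]

theorem isLocal_modeField (x y : A × B) : IsLocal (modeField h x) (modeField h y) := by
  refine ⟨2, ?_⟩
  funext m n
  rw [← expComm_natCast]
  exact expComm_modeField_of_two_le h x y 0 m n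

theorem nprod_zero_modeField (x y : A × B) :
    nprod 0 (modeField h x) (modeField h y) = modeField h (prod0 A B x y) :=
  ext_ncoeff fun n v => by
    rw [ncoeff_nprod, expComm_modeField, ncoeff_modeField]; simp

theorem nprod_one_modeField (x y : A × B) :
    nprod 1 (modeField h x) (modeField h y) = modeField h (prod1 A B x y) :=
  ext_ncoeff fun n v => by
    rw [ncoeff_nprod, expComm_one_modeField, ncoeff_modeField, zero_add]

theorem nprod_modeField_of_two_le (x y : A × B) (k : ℕ) :
    nprod (k + 2) (modeField h x) (modeField h y) = 0 :=
  ext_ncoeff fun n v => by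
    rw [ncoeff_nprod, expComm_modeField_of_two_le]; simp

end Module

/-! ### The vertex algebra `V_B` -/

theorem VL.D_smul (p : UL A B) (v : VL A B) :
    VL.D A B (p • v) = DU A B p • v + p • VL.D A B v := by
  obtain ⟨q, rfl⟩ := (idealNonneg A B).mkQ_surjective v
  change (idealNonneg A B).mkQ (DU A B (p * q)) = _
  rw [DU_mul, map_add]
  rfl

theorem VL.D_mem_idealB {v : VL A B} (hv : v ∈ idealB A B) : VL.D A B v ∈ idealB A B := by
  refine Submodule.span_induction ?_ ?_ ?_ ?_ hv
  · rintro _ ⟨e, he, k, rfl⟩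
    refine Submodule.subset_span ⟨e, he, k + 1, ?_⟩
    rw [pow_succ']; rfl
  · simp
  · intro v v' _ _ h h'
    rw [map_add]; exact add_mem h h'
  · intro p v hv h
    rw [VL.D_smul]
    exact add_mem (Submodule.smul_mem _ _ hv) (Submodule.smul_mem _ _ h)

variable (A B) in
/-- The operator `D` on `V_B`. -/
noncomputable def VB.D : Module.End ℂ (VB A B) :=
  ((idealB A B).restrictScalars ℂ).mapQ ((idealB A B).restrictScalars ℂ) (VL.D A B)
    fun _ hv => VL.D_mem_idealB hv

theorem VB.D_md (x : A × B) (n : ℤ) (v : VB A B) :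
    VB.D A B (md A B x n • v) = md A B x n • VB.D A B v - (n : ℂ) • md A B x (n - 1) • v := by
  obtain ⟨v, rfl⟩ := (idealB A B).mkQ_surjective v
  change (idealB A B).mkQ (VL.D A B (md A B x n • v)) = _
  rw [VL.D_md, map_sub]
  rfl

theorem VB.md_one_of_nonneg (x : A × B) {n : ℤ} (hn : 0 ≤ n) :
    md A B x n • VB.one A B = 0 := by
  have h : md A B x n • VL.one A B = 0 := by
    change (idealNonneg A B).mkQ (md A B x n * 1) = 0
    rw [mul_one, Submodule.mkQ_apply, Submodule.Quotient.mk_eq_zero]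
    exact Submodule.subset_span ⟨x, n, hn, rfl⟩
  change (idealB A B).mkQ (md A B x n • VL.one A B) = 0
  rw [h, map_zero]

theorem VB.exists_smul_one (v : VB A B) : ∃ p : UL A B, v = p • VB.one A B := by
  obtain ⟨v, rfl⟩ := (idealB A B).mkQ_surjective v
  obtain ⟨p, rfl⟩ := (idealNonneg A B).mkQ_surjective v
  refine ⟨p, ?_⟩
  change _ = (idealB A B).mkQ ((idealNonneg A B).mkQ (p * 1))
  rw [mul_one]

theorem VB.eq_top_of_md {N : Submodule ℂ (VB A B)} (h1 : VB.one A B ∈ N)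
    (h2 : ∀ x n, ∀ v ∈ N, md A B x n • v ∈ N) : N = ⊤ := by
  rw [eq_top_iff]
  rintro v -
  obtain ⟨p, rfl⟩ := VB.exists_smul_one v
  exact smul_mem_of_md h2 p h1

-- The vector `𝟏` is killed by all `x(n)` with `n ≥ 0`, and it generates `V_B` over `U(ℒ)`.
variable (A B) in
theorem VB.isRestricted : IsRestricted A B (VB A B) := by
  intro v
  obtain ⟨p, rfl⟩ := VB.exists_smul_one v
  exact smul_mem_restrictedVectors p fun x => ⟨0, fun n hn => VB.md_one_of_nonneg x hn⟩

variable (A B) in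
/-- The generating fields of `V_B`. -/
noncomputable def VB.generators : GeneratingFields (VB A B) (A × B) where
  X := modeField (VB.isRestricted A B)
  vac := VB.one A B
  D := VB.D A B
  isLocal := isLocal_modeField _
  D_vac := by
    change (idealB A B).mkQ (VL.D A B (VL.one A B)) = 0
    rw [VL.D_one, map_zero]
  covariant x n v := by
    rw [ncoeff_derivOp, LinearMap.smul_apply, ncoeff_modeField, ncoeff_modeField, ncoeff_modeField,
      VB.D_md, neg_smul, sub_eq_add_neg]
  X_vac x n hn := by rw [ncoeff_modeField, VB.md_one_of_nonneg x hn]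
  generates N h1 h2 := VB.eq_top_of_md h1 fun x n v hv => by
    rw [← ncoeff_modeField (VB.isRestricted A B)]; exact h2 x n v hv

variable (A B) in
/-- The vertex algebra `V_B`. -/
noncomputable def VB.vertexAlgebra : VertexAlgebra (VB A B) := (VB.generators A B).toVertexAlgebra

variable (A B) in
/-- The element `x = x(-1)𝟏` of `V_B`. -/
noncomputable def VB.incl : (A × B) →ₗ[ℂ] VB A B where
  toFun x := md A B x (-1) • VB.one A B
  map_add' x y := by rw [md_add, add_smul]
  map_smul' c x := by rw [md_smul, smul_assoc, RingHom.id_apply]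

theorem VB.incl_apply (x : A × B) : VB.incl A B x = md A B x (-1) • VB.one A B := rfl

theorem VB.isVBStructure : IsVBStructure (VB.vertexAlgebra A B) := by
  refine ⟨rfl, fun x n v => ?_⟩
  have h := (VB.generators A B).Y_X x
  have e : ncoeff ((VB.generators A B).X x) (-1) (VB.generators A B).vac
      = md A B x (-1) • VB.one A B := ncoeff_modeField (VB.isRestricted A B) _ _ _
  rw [e] at h
  exact (congrArg (fun a => ncoeff a n v) h).trans
    (ncoeff_modeField (VB.isRestricted A B) x n v)

end Representations

section ModuleStructures

variable {A : Type u} {B : Type v} [CommRing A] [Algebra ℂ A]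
  [AddCommGroup B] [Module ℂ B] [VertexAlgebroid A B]

/-- A representation of `U(ℒ)`, as a module. -/
def RepSpace {W : Type w} [AddCommGroup W] [Module ℂ W]
    (_σ : UL A B →ₐ[ℂ] Module.End ℂ W) : Type w := W

namespace RepSpace

variable {W : Type w} [AddCommGroup W] [Module ℂ W] (σ : UL A B →ₐ[ℂ] Module.End ℂ W)

instance : AddCommGroup (RepSpace σ) := inferInstanceAs (AddCommGroup W)
instance : Module ℂ (RepSpace σ) := inferInstanceAs (Module ℂ W)
noncomputable instance : Module (UL A B) (RepSpace σ) := Module.compHom W σ.toRingHom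
instance : IsScalarTower ℂ (UL A B) (RepSpace σ) where
  smul_assoc c p v := by
    change σ (c • p) v = c • σ p v
    rw [map_smul]; rfl

/-- The identification of a representation with its underlying vector space. -/
def equiv : W ≃ₗ[ℂ] RepSpace σ := LinearEquiv.refl ℂ W

theorem smul_equiv (p : UL A B) (v : W) : p • equiv σ v = equiv σ (σ p v) := rfl

end RepSpace

/-! ### Vertex modules as modules of `U(ℒ)` -/

/-- The adjoint module of a vertex algebra. -/
def VertexAlgebra.adjoint {V : Type v} [AddCommGroup V] [Module ℂ V] (𝒱 : VertexAlgebra V) :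
    VertexModule 𝒱 V where
  Y := 𝒱.Y
  Y_vac := 𝒱.Y_vac
  jacobi := 𝒱.jacobi

theorem VertexModule.Y_vac_eq {V : Type v} [AddCommGroup V] [Module ℂ V] {𝒱 : VertexAlgebra V}
    {W : Type w} [AddCommGroup W] [Module ℂ W] (M : VertexModule 𝒱 W) : M.Y 𝒱.vac = idOp :=
  ext_ncoeff fun n x => by rw [M.Y_vac, ncoeff_idOp]

section RepOfVertexModule

variable {V : Type*} [AddCommGroup V] [Module ℂ V] {𝒱 : VertexAlgebra V}

variable (A B) in
/-- A linear map from `A ⊕ B` to a vertex algebra that is compatible with the products and `∂`. -/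
structure IsAlgebroidMap (𝒱 : VertexAlgebra V) (f : (A × B) →ₗ[ℂ] V) : Prop where
  map_prod0 : ∀ x y, ncoeff (𝒱.Y (f x)) 0 (f y) = f (prod0 A B x y)
  map_prod1 : ∀ x y, ncoeff (𝒱.Y (f x)) 1 (f y) = f (prod1 A B x y)
  map_prod : ∀ x y (k : ℕ), ncoeff (𝒱.Y (f x)) (k + 2) (f y) = 0
  map_der : ∀ a, f (0, der a) = ncoeff (𝒱.Y (f (a, 0))) (-2) 𝒱.vac

variable {f : (A × B) →ₗ[ℂ] V} (hf : IsAlgebroidMap A B 𝒱 f) {W : Type w} [AddCommGroup W]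
  [Module ℂ W] (M : VertexModule 𝒱 W)

/-- The representation of `U(ℒ)` on a vertex module in which `x(n)` acts as a mode. -/
noncomputable def IsAlgebroidMap.rep : UL A B →ₐ[ℂ] Module.End ℂ W :=
  liftUL (fun n => (LinearMap.proj n : (ℤ → Module.End ℂ W) →ₗ[ℂ] Module.End ℂ W)
      ∘ₗ ncoeff ∘ₗ M.Y ∘ₗ f)
    (fun a n => by
      change ncoeff (M.Y (f (0, der a))) n = (-n : ℂ) • ncoeff (M.Y (f (a, 0))) (n - 1)
      rw [hf.map_der, M.jacobi.map_ncoeff, M.Y_vac_eq, nprod_neg_two_idOp, ncoeff_derivOp])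
    (fun x y m n => by
      change ncoeff (M.Y (f x)) m * ncoeff (M.Y (f y)) n - ncoeff (M.Y (f y)) n * ncoeff (M.Y (f x)) m
        = ncoeff (M.Y (f (prod0 A B x y))) (m + n)
          + (m : ℂ) • ncoeff (M.Y (f (prod1 A B x y))) (m + n - 1)
      ext v
      have h := M.jacobi (f x) (f y) v 0 m n
      -- At `l = 0` the Jacobi identity is the commutator formula. The products of index at least
      -- two vanish on `A ⊕ B`, so only the terms `i = 0` and `i = 1` remain.
      rw [expComm_apply, expComm_zero, finsum_nat_eq_sum_range (K := 2), Finset.sum_range_succ,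
        Finset.sum_range_one] at h
      · rw [h]
        simp [hf.map_prod0, hf.map_prod1, Int.cast_smul_eq_zsmul ℂ]
      · intro i hi
        obtain ⟨k, rfl⟩ := Nat.exists_eq_add_of_le hi
        rw [show (0 : ℤ) + ((2 + k : ℕ) : ℤ) = k + 2 by push_cast; ring, hf.map_prod]
        simp)

theorem IsAlgebroidMap.rep_md (x : A × B) (n : ℤ) :
    hf.rep M (md A B x n) = ncoeff (M.Y (f x)) n := liftUL_md _ _ _ x n

end RepOfVertexModule

/-- For `n ≥ 0` the mode `x(n)` kills `𝟏`, so `x(n) y(-1)𝟏` is the commutator applied to `𝟏`. The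
relation for `∂` is `(∂a)(-1) = a(-2)` in `ℒ`. -/
theorem VB.isAlgebroidMap {𝒱 : VertexAlgebra (VB A B)} (h𝒱 : IsVBStructure 𝒱) :
    IsAlgebroidMap A B 𝒱 (VB.incl A B) where
  map_prod0 x y := by
    rw [VB.incl_apply, h𝒱.2, VB.incl_apply, VB.incl_apply, md_smul_comm,
      VB.md_one_of_nonneg x le_rfl]
    simp
  map_prod1 x y := by
    rw [VB.incl_apply, h𝒱.2, VB.incl_apply, VB.incl_apply, md_smul_comm,
      VB.md_one_of_nonneg x zero_le_one, VB.md_one_of_nonneg _ (by norm_num)]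
    simp
  map_prod x y k := by
    rw [VB.incl_apply, h𝒱.2, VB.incl_apply, md_smul_comm,
      VB.md_one_of_nonneg x (by omega), VB.md_one_of_nonneg _ (by omega),
      VB.md_one_of_nonneg _ (by omega)]
    simp
  map_der a := by
    rw [VB.incl_apply, VB.incl_apply, h𝒱.2, h𝒱.1, md_der]
    norm_num

/-! ### Intertwining operators are determined by generators -/

theorem VertexOperator.map_expComm {W : Type*} [AddCommGroup W] [Module ℂ W] {W' : Type*}
    [AddCommGroup W'] [Module ℂ W'] (f : W →ₗ[ℂ] W') {a b : VertexOperator ℂ W}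
    {a' b' : VertexOperator ℂ W'} (ha : ∀ n v, f (ncoeff a n v) = ncoeff a' n (f v))
    (hb : ∀ n v, f (ncoeff b n v) = ncoeff b' n (f v)) (l m n : ℤ) (v : W) :
    f (expComm a b l m n v) = expComm a' b' l m n (f v) := by
  obtain ⟨K, hK⟩ := exists_nat_ncoeff_eq_zero b n v
  obtain ⟨L, hL⟩ := exists_nat_ncoeff_eq_zero a m v
  rw [expComm, expComm, LinearMap.sub_apply, LinearMap.sub_apply, LinearMap.smul_apply,
    LinearMap.smul_apply, expProd_eq_sum _ _ _ _ _ hK, expProd_eq_sum _ _ _ _ _ hL,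
    expProd_eq_sum a' b' l m n (K := K) fun i hi => by rw [← hb, hK i hi, map_zero] ,
    expProd_eq_sum b' a' l n m (K := L) fun i hi => by rw [← ha, hL i hi, map_zero] ]
  simp only [map_sub, map_zsmul, map_sum, ha, hb]

/-- The data common to `V_B`-modules and to their pullbacks: the vertex operators on `W` are
determined by those of `A ⊕ B`. -/
structure IsVBAction {W : Type*} [AddCommGroup W] [Module ℂ W]
    (Y : VB A B →ₗ[ℂ] VertexOperator ℂ W) : Prop where
  map_one : Y (VB.one A B) = idOp
  map_md : ∀ x n v, Y (md A B x n • v) = nprod n (Y (VB.incl A B x)) (Y v)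

theorem VertexModule.isVBAction {𝒱 : VertexAlgebra (VB A B)} (h𝒱 : IsVBStructure 𝒱) {W : Type*}
    [AddCommGroup W] [Module ℂ W] (M : VertexModule 𝒱 W) : IsVBAction M.Y where
  map_one := by rw [← h𝒱.1, M.Y_vac_eq]
  map_md x n v := by rw [← M.jacobi.map_ncoeff, VB.incl_apply, h𝒱.2]

/-- The states whose fields are intertwined by `f` contain `𝟏` and are stable under the `x(n)`,
because products of fields are built from modes and `f` respects those sums. Hence they are all of
`V_B`. Uniqueness of structures is the case of the identity map. -/
theorem IsVBAction.intertwine {W : Type*} [AddCommGroup W] [Module ℂ W] {W' : Type*}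
    [AddCommGroup W'] [Module ℂ W'] {Y : VB A B →ₗ[ℂ] VertexOperator ℂ W}
    {Y' : VB A B →ₗ[ℂ] VertexOperator ℂ W'} (hY : IsVBAction Y) (hY' : IsVBAction Y')
    (f : W →ₗ[ℂ] W') (hf : ∀ x n w, f (ncoeff (Y (VB.incl A B x)) n w)
      = ncoeff (Y' (VB.incl A B x)) n (f w)) (v : VB A B) (n : ℤ) (w : W) :
    f (ncoeff (Y v) n w) = ncoeff (Y' v) n (f w) := by
  let N : Submodule ℂ (VB A B) :=
    { carrier := {v | ∀ n w, f (ncoeff (Y v) n w) = ncoeff (Y' v) n (f w)}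
      zero_mem' := fun n w => by simp
      add_mem' := fun h h' n w => by simp [h n w, h' n w]
      smul_mem' := fun c v h n w => by simp [h n w] }
  have hN : N = ⊤ := by
    refine VB.eq_top_of_md ?_ ?_
    · intro n w
      rw [hY.map_one, hY'.map_one, ncoeff_idOp, ncoeff_idOp]
      split_ifs <;> simp
    · intro x k v hv n w
      rw [hY.map_md, hY'.map_md, ncoeff_nprod, ncoeff_nprod]
      exact map_expComm f (hf x) hv k 0 n w
  have hv : v ∈ N := by rw [hN]; trivial
  exact hv n w

theorem IsVBAction.unique {W : Type*} [AddCommGroup W] [Module ℂ W]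
    {Y Y' : VB A B →ₗ[ℂ] VertexOperator ℂ W} (hY : IsVBAction Y) (hY' : IsVBAction Y')
    (h : ∀ x n w, ncoeff (Y (VB.incl A B x)) n w = ncoeff (Y' (VB.incl A B x)) n w) : Y = Y' :=
  LinearMap.ext fun v => ext_ncoeff fun n w => hY.intertwine hY' LinearMap.id h v n w

theorem IsVBStructure.unique {𝒱 𝒱' : VertexAlgebra (VB A B)} (h : IsVBStructure 𝒱)
    (h' : IsVBStructure 𝒱') : 𝒱 = 𝒱' := by
  have hY : 𝒱.Y = 𝒱'.Y := (𝒱.adjoint.isVBAction h).unique (𝒱'.adjoint.isVBAction h')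
    fun x n w => (h.2 x n w).trans (h'.2 x n w).symm
  have hv : 𝒱.vac = 𝒱'.vac := h.1.trans h'.1.symm
  cases 𝒱
  cases 𝒱'
  cases hY
  cases hv
  rfl

theorem VertexModule.unique {𝒱 : VertexAlgebra (VB A B)} (h𝒱 : IsVBStructure 𝒱) {W : Type*}
    [AddCommGroup W] [Module ℂ W] {M M' : VertexModule 𝒱 W}
    (h : ∀ x n w, ncoeff (M.Y (VB.incl A B x)) n w = ncoeff (M'.Y (VB.incl A B x)) n w) :
    M = M' := by
  have hY : M.Y = M'.Y := (M.isVBAction h𝒱).unique (M'.isVBAction h𝒱) h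
  cases M
  cases M'
  cases hY
  rfl

/-! ### The `V_B`-module structure on a restricted module -/

section Existence

variable {W : Type w} [AddCommGroup W] [Module ℂ W] [Module (UL A B) W]
  [IsScalarTower ℂ (UL A B) W] (h : IsRestricted A B W)

/-- The map `x ↦ ∑ₙ x(n) z⁻ⁿ⁻¹` to the vertex algebra of fields on `W`. -/
noncomputable def fieldIncl : (A × B) →ₗ[ℂ] LocalClosure (modeField h) where
  toFun x := LocalClosure.mk (modeField h x) (mem_localClosure_self x)
  map_add' x y := LocalClosure.ext (modeField_add h x y)
  map_smul' c x := LocalClosure.ext (modeField_smul h c x)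

theorem val_fieldIncl (x : A × B) : LocalClosure.val _ (fieldIncl h x) = modeField h x := rfl

theorem fieldIncl_isAlgebroidMap : IsAlgebroidMap A B
    (LocalClosure.vertexAlgebra (isLocal_modeField h)) (fieldIncl h) where
  map_prod0 x y := by
    rw [LocalClosure.vertexAlgebra_Y]
    exact LocalClosure.ext (nprod_zero_modeField h x y)
  map_prod1 x y := by
    rw [LocalClosure.vertexAlgebra_Y]
    exact LocalClosure.ext (nprod_one_modeField h x y)
  map_prod x y k := by
    rw [LocalClosure.vertexAlgebra_Y]
    exact LocalClosure.ext ((nprod_modeField_of_two_le h x y k).trans (map_zero _).symm)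
  map_der a := by
    rw [LocalClosure.vertexAlgebra_Y]
    exact LocalClosure.ext ((modeField_der h a).trans (nprod_neg_two_idOp _).symm)

/-- The representation of `U(ℒ)` on the space of fields. -/
noncomputable abbrev fieldRep : UL A B →ₐ[ℂ] Module.End ℂ (LocalClosure (modeField h)) :=
  (fieldIncl_isAlgebroidMap h).rep (VertexAlgebra.adjoint _)

theorem fieldRep_md (x : A × B) (n : ℤ) :
    fieldRep h (md A B x n) = LocalClosure.mode (isLocal_modeField h) (fieldIncl h x) n := by
  rw [fieldRep, IsAlgebroidMap.rep_md]
  exact LocalClosure.vertexAlgebra_Y _ _ _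

/-- The identity field, as a vector of the representation of `U(ℒ)` on fields. -/
noncomputable def fieldVac : RepSpace (fieldRep h) :=
  RepSpace.equiv _ (LocalClosure.mk idOp idOp_mem_localClosure)

theorem md_smul_fieldVac (x : A × B) {n : ℤ} (hn : 0 ≤ n) : md A B x n • fieldVac h = 0 := by
  rw [fieldVac, RepSpace.smul_equiv, fieldRep_md]
  have : LocalClosure.mode (isLocal_modeField h) (fieldIncl h x) n
      (LocalClosure.mk idOp idOp_mem_localClosure) = 0 :=
    LocalClosure.ext (by
      rw [LocalClosure.val_mode, LocalClosure.val_mk, nprod_idOp_of_nonneg _ hn, map_zero])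
  rw [this, map_zero]

/-- The homomorphism from `V_ℒ` to the fields on `W`. -/
noncomputable def fieldMapVL : VL A B →ₗ[UL A B] RepSpace (fieldRep h) :=
  (idealNonneg A B).liftQ (LinearMap.toSpanSingleton (UL A B) _ (fieldVac h)) (by
    rw [idealNonneg, Submodule.span_le]
    rintro _ ⟨x, n, hn, rfl⟩
    exact md_smul_fieldVac h x hn)

theorem fieldMapVL_one : fieldMapVL h (VL.one A B) = fieldVac h := by
  change (1 : UL A B) • fieldVac h = _
  rw [one_smul]

/-- The derivation `d/dz` on the representation of `U(ℒ)` on fields. -/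
noncomputable def fieldDeriv : Module.End ℂ (RepSpace (fieldRep h)) :=
  LocalClosure.deriv (isLocal_modeField h)

theorem fieldDeriv_md (x : A × B) (n : ℤ) (c : RepSpace (fieldRep h)) :
    fieldDeriv h (md A B x n • c)
      = md A B x n • fieldDeriv h c - (n : ℂ) • md A B x (n - 1) • c := by
  obtain ⟨c, rfl⟩ := (RepSpace.equiv (fieldRep h)).surjective c
  rw [RepSpace.smul_equiv, RepSpace.smul_equiv, fieldRep_md, fieldRep_md]
  change LocalClosure.deriv (isLocal_modeField h)
      (LocalClosure.mode (isLocal_modeField h) (fieldIncl h x) n c)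
    = fieldRep h (md A B x n) (LocalClosure.deriv (isLocal_modeField h) c)
      - (n : ℂ) • (LocalClosure.mode (isLocal_modeField h) (fieldIncl h x) (n - 1) c)
  rw [fieldRep_md]
  refine LocalClosure.ext ?_
  rw [LocalClosure.val_deriv, LocalClosure.val_mode, derivOp_nprod, map_sub, map_smul,
    LocalClosure.val_mode, LocalClosure.val_mode, LocalClosure.val_deriv]
  refine ext_ncoeff fun k w => ?_
  simp [sub_eq_add_neg]

/-- The ideal `I_B` is generated by `ℂ[D]E` rather than `E`, so the map must turn `D` into `d/dz`
before it can descend to `V_B`. -/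
theorem fieldMapVL_D (v : VL A B) :
    fieldMapVL h (VL.D A B v) = fieldDeriv h (fieldMapVL h v) := by
  let N : Submodule ℂ (VL A B) :=
    { carrier := {v | fieldMapVL h (VL.D A B v) = fieldDeriv h (fieldMapVL h v)}
      zero_mem' := by simp
      add_mem' := fun {v v'} hv hv' => by
        simp only [Set.mem_ofPred_eq, map_add] at hv hv' ⊢
        rw [hv, hv']
      smul_mem' := fun c v hv => by
        simp only [Set.mem_ofPred_eq, map_smul] at hv ⊢
        rw [LinearMap.map_smul_of_tower, LinearMap.map_smul_of_tower, map_smul, hv] }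
  have h1 : VL.one A B ∈ N := by
    change fieldMapVL h (VL.D A B (VL.one A B)) = fieldDeriv h (fieldMapVL h (VL.one A B))
    rw [VL.D_one, map_zero, fieldMapVL_one]
    exact (LocalClosure.ext (by
      rw [LocalClosure.val_deriv, map_zero]; exact derivOp_idOp) :
      LocalClosure.deriv (isLocal_modeField h) (LocalClosure.mk idOp idOp_mem_localClosure)
        = 0).symm
  have h2 : ∀ x n, ∀ v ∈ N, md A B x n • v ∈ N := by
    intro x n v hv
    change fieldMapVL h (VL.D A B (md A B x n • v)) = fieldDeriv h (fieldMapVL h (md A B x n • v))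
    have hv' : fieldMapVL h (VL.D A B v) = fieldDeriv h (fieldMapVL h v) := hv
    rw [VL.D_md, map_sub, LinearMap.map_smul, LinearMap.map_smul_of_tower, LinearMap.map_smul,
      LinearMap.map_smul, fieldDeriv_md, hv']
  obtain ⟨p, rfl⟩ := (idealNonneg A B).mkQ_surjective v
  have := smul_mem_of_md h2 p h1
  change (idealNonneg A B).mkQ (p * 1) ∈ N at this
  rwa [mul_one] at this

theorem fieldMapVL_D_pow (k : ℕ) (v : VL A B) :
    fieldMapVL h ((VL.D A B ^ k) v) = (fieldDeriv h ^ k) (fieldMapVL h v) := by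
  induction k with
  | zero => rfl
  | succ k ih => rw [pow_succ', pow_succ', Module.End.mul_apply, fieldMapVL_D, ih]; rfl

theorem md_neg_one_smul_fieldVac (x : A × B) :
    md A B x (-1) • fieldVac h = RepSpace.equiv _ (fieldIncl h x) := by
  rw [fieldVac, RepSpace.smul_equiv, fieldRep_md]
  exact congrArg _ (LocalClosure.ext (nprod_neg_one_idOp (modeField h x)))

variable (h1 : modeField h (1, 0) = idOp)
  (h2 : ∀ a a' : A, nprod (-1) (modeField h (a, 0)) (modeField h (a', 0))
    = modeField h (a * a', 0))
  (h3 : ∀ (a : A) (x : B), nprod (-1) (modeField h (a, 0)) (modeField h (0, x))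
    = modeField h (0, act a x))

-- The three hypotheses are the three families of generators of `E`, written as identities between
-- fields on `W`.
include h1 h2 h3 in
theorem fieldMapVL_setE {e : VL A B} (he : e ∈ setE A B) : fieldMapVL h e = 0 := by
  rcases he with (rfl | ⟨a, a', rfl⟩) | ⟨a, x, rfl⟩
  · rw [map_sub, map_smul, fieldMapVL_one, md_neg_one_smul_fieldVac, sub_eq_zero]
    exact congrArg _ (LocalClosure.ext h1)
  · rw [map_sub, map_smul, map_smul, map_smul, fieldMapVL_one, md_neg_one_smul_fieldVac,
      md_neg_one_smul_fieldVac, RepSpace.smul_equiv, fieldRep_md, sub_eq_zero]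
    exact congrArg _ (LocalClosure.ext (h2 a a'))
  · rw [map_sub, map_smul, map_smul, map_smul, fieldMapVL_one, md_neg_one_smul_fieldVac,
      md_neg_one_smul_fieldVac, RepSpace.smul_equiv, fieldRep_md, sub_eq_zero]
    exact congrArg _ (LocalClosure.ext (h3 a x))

/-- The homomorphism from `V_B` to the fields on `W`. -/
noncomputable def fieldMap : VB A B →ₗ[UL A B] RepSpace (fieldRep h) :=
  (idealB A B).liftQ (fieldMapVL h) (by
    rw [idealB, Submodule.span_le]
    rintro _ ⟨e, he, k, rfl⟩
    change fieldMapVL h _ = 0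
    rw [fieldMapVL_D_pow, fieldMapVL_setE h h1 h2 h3 he, map_zero])

/-- The homomorphism from `V_B` to the fields on `W`, as a linear map. -/
noncomputable def fieldMapLin : VB A B →ₗ[ℂ] LocalClosure (modeField h) :=
  (RepSpace.equiv (fieldRep h)).symm.toLinearMap ∘ₗ (fieldMap h h1 h2 h3).restrictScalars ℂ

theorem fieldMapLin_one : fieldMapLin h h1 h2 h3 (VB.one A B)
    = LocalClosure.mk idOp idOp_mem_localClosure := fieldMapVL_one h

theorem fieldMapLin_md (x : A × B) (n : ℤ) (v : VB A B) :
    fieldMapLin h h1 h2 h3 (md A B x n • v)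
      = LocalClosure.mode (isLocal_modeField h) (fieldIncl h x) n
        (fieldMapLin h h1 h2 h3 v) := by
  rw [← fieldRep_md]
  exact map_smul (fieldMap h h1 h2 h3) (md A B x n) v

theorem fieldMapLin_incl (x : A × B) :
    fieldMapLin h h1 h2 h3 (VB.incl A B x) = fieldIncl h x := by
  rw [VB.incl_apply, fieldMapLin_md, fieldMapLin_one]
  exact LocalClosure.ext (nprod_neg_one_idOp (modeField h x))

/-- The map from `V_B` to fields is a homomorphism of vertex algebras. It is an intertwiner into the
fields viewed as a module over themselves, so it need only be tested on modes of `A ⊕ B`, where it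
is `U(ℒ)`-linearity. -/
theorem fieldMapLin_ncoeff {𝒱 : VertexAlgebra (VB A B)} (h𝒱 : IsVBStructure 𝒱) (v : VB A B)
    (n : ℤ) (w : VB A B) : fieldMapLin h h1 h2 h3 (ncoeff (𝒱.Y v) n w)
      = LocalClosure.mode (isLocal_modeField h) (fieldMapLin h h1 h2 h3 v) n
        (fieldMapLin h h1 h2 h3 w) := by
  rw [← LocalClosure.vertexAlgebra_Y]
  refine (𝒱.adjoint.isVBAction h𝒱).intertwine
    (Y' := (LocalClosure.vertexAlgebra (isLocal_modeField h)).Y ∘ₗ fieldMapLin h h1 h2 h3)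
    ⟨?_, ?_⟩ (fieldMapLin h h1 h2 h3) ?_ v n w
  · rw [LinearMap.comp_apply, fieldMapLin_one, ← LocalClosure.vertexAlgebra_vac]
    exact (LocalClosure.vertexAlgebra (isLocal_modeField h)).adjoint.Y_vac_eq
  · intro x n v
    rw [LinearMap.comp_apply, LinearMap.comp_apply, LinearMap.comp_apply, fieldMapLin_md,
      fieldMapLin_incl, ← LocalClosure.vertexAlgebra_Y]
    exact (LocalClosure.vertexAlgebra (isLocal_modeField h)).jacobi.map_ncoeff _ _ _
  · intro x n w
    rw [LinearMap.comp_apply, fieldMapLin_incl, LocalClosure.vertexAlgebra_Y, ← fieldMapLin_md]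
    exact congrArg _ (h𝒱.2 x n w)

/-- The `V_B`-module structure on a restricted `U(ℒ)`-module whose fields satisfy the defining
relations of `V_B`. -/
noncomputable def vertexModuleOfRestricted {𝒱 : VertexAlgebra (VB A B)} (h𝒱 : IsVBStructure 𝒱) :
    VertexModule 𝒱 W where
  Y := LocalClosure.val _ ∘ₗ fieldMapLin h h1 h2 h3
  Y_vac n w := by
    rw [LinearMap.comp_apply, h𝒱.1, fieldMapLin_one, LocalClosure.val_mk, ncoeff_idOp]
  jacobi := jacobiIdentity_of_isLocal
    (fun x y => isLocal_of_mem_localClosure (isLocal_modeField h) (LocalClosure.val_mem _)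
      (LocalClosure.val_mem _))
    (fun x y l => by
      rw [LinearMap.comp_apply, fieldMapLin_ncoeff h h1 h2 h3 h𝒱]
      rfl)

theorem vertexModuleOfRestricted_incl {𝒱 : VertexAlgebra (VB A B)} (h𝒱 : IsVBStructure 𝒱)
    (x : A × B) (n : ℤ) (w : W) :
    ncoeff ((vertexModuleOfRestricted h h1 h2 h3 h𝒱).Y (VB.incl A B x)) n w = md A B x n • w := by
  change ncoeff (LocalClosure.val _ (fieldMapLin h h1 h2 h3 (VB.incl A B x))) n w = _
  rw [fieldMapLin_incl, val_fieldIncl, ncoeff_modeField]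

end Existence

end ModuleStructures

/-! ### Split local vertex algebroids -/

/-- The data that control the modules of a vertex algebroid `B` over a local algebra `A` with
`B = ℂb ⊕ ∂(A)`: the residue map `χ` of `A` and the coordinate `ℓ` of `b`. -/
structure LocalSplitting (A : Type u) (B : Type v) [CommRing A] [Algebra ℂ A]
    [AddCommGroup B] [Module ℂ B] [VertexAlgebroid A B] where
  /-- the residue map of `A` -/
  χ : A →ₐ[ℂ] ℂ
  /-- the coordinate of `b` -/
  ℓ : B →ₗ[ℂ] ℂ
  /-- the generator of `B` modulo `∂(A)` -/
  b : B
  /-- the norm of `b` -/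
  k : ℂ
  ℓ_b : ℓ b = 1
  isNilpotent_ker : IsNilpotent (RingHom.ker χ)
  χ_anchor : ∀ x a, χ (anchor (B := B) x a) = 0
  χ_pair : ∀ x y, χ (pair (B := B) x y) = k * (ℓ x * ℓ y)
  ℓ_der : ∀ a : A, ℓ (der a) = 0
  ℓ_br : ∀ x y, ℓ (br A x y) = 0
  ℓ_act : ∀ (a : A) x, ℓ (act a x) = χ a * ℓ x
  exists_eq : ∀ x, ∃ a : A, x = ℓ x • b + der a

section Existence

variable {A : Type u} {B : Type v} [CommRing A] [Algebra ℂ A]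
  [AddCommGroup B] [Module ℂ B] [VertexAlgebroid A B]

/-- The anchor vanishes on `A∂(A)`, and with it the associativity defect of the action. -/
theorem act_mul_of_mem_AdA (a a' : A) {x : B} (hx : x ∈ AdA A B) :
    act (a * a') x = act a (act a' x) := by
  have h := act_act a a' x
  rw [anchor_eq_zero hx] at h
  simp only [Derivation.coe_zero, Pi.zero_apply, map_zero, LinearMap.zero_apply, add_zero,
    sub_eq_zero] at h
  exact h.symm

/-- From `∂e = 2 e·∂e`, acting with `e` gives `e·∂e = 2 e·∂e`, since the action is associative on
`A∂(A)`. So `e·∂e = 0` and then `∂e = 0`. -/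
theorem der_eq_zero_of_isIdempotentElem {e : A} (he : IsIdempotentElem e) :
    der (B := B) e = 0 := by
  have h1 : der (B := B) e = act e (der e) + act e (der e) := by rw [← der_mul, he]
  have h2 : act e (der (B := B) e) = 0 := by
    have h := congrArg (act e) h1
    rw [map_add, ← act_mul_of_mem_AdA e e (der_mem e), he] at h
    simpa using h
  rw [h1, h2, add_zero]

/-- Fitting's argument: the powers of `a` stabilize as `aⁿ = aⁿ⁺¹y`, which makes `aⁿyⁿ` an
idempotent with `aⁿ · aⁿyⁿ = aⁿ`. If it is `0` then `a` is nilpotent; if it is `1` then `a` is a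
unit. -/
theorem isNilpotent_or_isUnit {A : Type*} [CommRing A] [IsArtinianRing A]
    (h : ∀ e : A, IsIdempotentElem e → e = 0 ∨ e = 1) (a : A) : IsNilpotent a ∨ IsUnit a := by
  obtain ⟨n, y, hy⟩ := IsArtinian.exists_pow_succ_smul_dvd a (1 : A)
  simp only [smul_eq_mul, mul_one, Nat.succ_eq_add_one] at hy
  have h1 : ∀ k, a ^ (n + k) * y ^ k = a ^ n := by
    intro k
    induction k with
    | zero => simp
    | succ k ih =>
      calc a ^ (n + (k + 1)) * y ^ (k + 1) = a ^ k * y ^ k * (a ^ (n + 1) * y) := by ring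
        _ = a ^ (n + k) * y ^ k := by rw [hy]; ring
        _ = a ^ n := ih
  have h2 : a ^ n * (a ^ n * y ^ n) = a ^ n := by
    rw [← mul_assoc, ← pow_add, h1]
  have h3 : IsIdempotentElem (a ^ n * y ^ n) := by
    calc a ^ n * y ^ n * (a ^ n * y ^ n) = a ^ n * (a ^ n * y ^ n) * y ^ n := by ring
      _ = _ := by rw [h2]
  rcases h _ h3 with h0 | h0
  · left
    exact ⟨n, by rw [← h2, h0, mul_zero]⟩
  · right
    rw [h0, mul_one] at h2
    rcases n.eq_zero_or_pos with rfl | hn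
    · refine IsUnit.of_mul_eq_one y ?_
      simpa using hy
    · exact (isUnit_pow_iff hn.ne').1 (IsUnit.of_mul_eq_one _ h0)

/-- If `aⁿ⁺¹ = 0` then `0 = D(aⁿ⁺¹) = (n + 1) aⁿ D(a)`, so a unit `D(a)` forces `aⁿ = 0`; descending
to `n = 0` gives `1 = 0`. -/
theorem Derivation.not_isUnit_of_isNilpotent (D : Derivation ℂ A A) {a : A}
    (ha : IsNilpotent a) (hD : IsUnit (D a)) : (1 : A) = 0 := by
  have h : ∀ n : ℕ, a ^ (n + 1) = 0 → a ^ n = 0 := by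
    intro n hn
    have h1 := D.leibniz_pow a (n + 1)
    rw [hn, map_zero, Nat.add_sub_cancel, smul_eq_mul, nsmul_eq_mul, ← mul_assoc, eq_comm,
      hD.mul_left_eq_zero, ← nsmul_eq_mul, ← Nat.cast_smul_eq_nsmul ℂ] at h1
    exact (smul_eq_zero.1 h1).resolve_left (Nat.cast_ne_zero.2 n.succ_ne_zero)
  obtain ⟨n, hn⟩ := ha
  induction n with
  | zero => simpa using hn
  | succ n ih => exact ih (h n hn)

theorem two_smul_br_self (x : B) : (2 : ℂ) • br A x x = der (pair (A := A) x x) := by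
  rw [two_smul, br_add_br]

theorem br_self_mem_range_der (x : B) : br A x x ∈ LinearMap.range (der : A →ₗ[ℂ] B) := by
  refine ⟨(2 : ℂ)⁻¹ • pair x x, ?_⟩
  rw [map_smul, ← two_smul_br_self, smul_smul, inv_mul_cancel₀ two_ne_zero, one_smul]

/-- The square of `b` is `½ ∂⟨b, b⟩`, and bracketing with `b` keeps the range of `∂` because `[b,
∂a] = ∂(b₀a)`. -/
theorem power_succ_mem_range_der (b : B) (k : ℕ) :
    power A b (k + 1) ∈ LinearMap.range (der : A →ₗ[ℂ] B) := by
  induction k with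
  | zero => exact br_self_mem_range_der b
  | succ k ih =>
    obtain ⟨a, ha⟩ := ih
    exact ⟨anchor b a, by rw [power, ← ha, br_der]⟩

theorem span_sup_range_der {b : B} (hb : IsGenerator A b) :
    Submodule.span ℂ {b} ⊔ LinearMap.range (der : A →ₗ[ℂ] B) = ⊤ := by
  rw [eq_top_iff, ← show Submodule.span ℂ (Set.range (power A b)) = ⊤ from hb, Submodule.span_le]
  rintro _ ⟨k, rfl⟩
  rcases k with _ | k
  · exact Submodule.mem_sup_left (Submodule.mem_span_singleton_self b)
  · exact Submodule.mem_sup_right (power_succ_mem_range_der b k)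

theorem finiteDimensional_of_ker_der [FiniteDimensional ℂ B]
    (hker : LinearMap.ker (der : A →ₗ[ℂ] B) = Submodule.span ℂ {1}) : FiniteDimensional ℂ A := by
  have h1 : FiniteDimensional ℂ (LinearMap.ker (der : A →ₗ[ℂ] B)) := by
    rw [hker]; infer_instance
  have h2 : FiniteDimensional ℂ (A ⧸ LinearMap.ker (der : A →ₗ[ℂ] B)) :=
    (der : A →ₗ[ℂ] B).quotKerEquivRange.symm.finiteDimensional
  exact Module.Finite.of_submodule_quotient (LinearMap.ker (der : A →ₗ[ℂ] B))

theorem idempotent_eq_zero_or_one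
    (hker : LinearMap.ker (der : A →ₗ[ℂ] B) = Submodule.span ℂ {1}) {e : A}
    (he : IsIdempotentElem e) : e = 0 ∨ e = 1 := by
  have h : e ∈ LinearMap.ker (der : A →ₗ[ℂ] B) := der_eq_zero_of_isIdempotentElem he
  rw [hker, Submodule.mem_span_singleton] at h
  obtain ⟨c, rfl⟩ := h
  have h : (c * c - c) • (1 : A) = 0 := by
    rw [sub_smul, sub_eq_zero]
    simpa [IsIdempotentElem, smul_smul] using he
  rcases smul_eq_zero.1 h with h | h
  · have h' : c * (c - 1) = 0 := by rw [← h]; ring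
    rcases mul_eq_zero.1 h' with rfl | h'
    · simp
    · rw [sub_eq_zero.1 h']; simp
  · simp [h]

/-- Idempotents of the Artinian algebra `A` are trivial, so `A` is local with residue field `ℂ`;
derivations land in its maximal ideal; and `b` spans `B` modulo `∂(A)`. Choosing a functional that
is `1` on `b` and `0` on `A∂(A)`, the compatibilities follow by expanding in `B = ℂb + ∂(A)`. -/
theorem exists_localSplitting [FiniteDimensional ℂ B]
    (hAdA : AdA A B ≠ ⊤)
    (hker : LinearMap.ker (der : A →ₗ[ℂ] B) = Submodule.span ℂ {1})
    {b : B} (hb : IsGenerator A b) :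
    ∃ S : LocalSplitting A B, S.b = b ∧ ∀ I : Ideal A, I.IsMaximal ↔ I = RingHom.ker S.χ := by
  have := finiteDimensional_of_ker_der hker
  have : IsArtinianRing A := IsArtinianRing.of_finite ℂ A
  have : Nontrivial A := by
    by_contra hA
    rw [not_nontrivial_iff_subsingleton] at hA
    refine hAdA (eq_top_iff.2 fun x _ => ?_)
    rw [← one_act (A := A) x, Subsingleton.elim (1 : A) 0, map_zero]
    exact zero_mem _
  have hnu : ∀ a : A, IsNilpotent a ∨ IsUnit a :=
    isNilpotent_or_isUnit fun e => idempotent_eq_zero_or_one hker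
  have : IsLocalRing A := IsLocalRing.of_isUnit_or_isUnit_one_sub_self fun a =>
    (hnu a).symm.imp_right IsNilpotent.isUnit_one_sub
  -- The residue field is finite over `ℂ`, hence algebraic, and embeds in the algebraically closed
  -- field `ℂ`.
  let χ : A →ₐ[ℂ] ℂ := (IsAlgClosed.lift : (A ⧸ IsLocalRing.maximalIdeal A) →ₐ[ℂ] ℂ).comp
    (Ideal.Quotient.mkₐ ℂ (IsLocalRing.maximalIdeal A))
  have hmax : ∀ I : Ideal A, I.IsMaximal ↔ I = RingHom.ker χ := by
    have h : (RingHom.ker χ).IsMaximal := RingHom.ker_isMaximal_of_surjective χ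
      fun c => ⟨algebraMap ℂ A c, by simp⟩
    exact fun I => ⟨fun hI => (IsLocalRing.eq_maximalIdeal hI).trans
      (IsLocalRing.eq_maximalIdeal h).symm, fun hI => hI ▸ h⟩
  have hχ : ∀ a, ¬ IsUnit a → χ a = 0 := by
    intro a ha
    have h : a ∈ IsLocalRing.maximalIdeal A := ha
    rwa [← IsLocalRing.eq_maximalIdeal ((hmax _).2 rfl)] at h
  have hnil : ∀ a, χ a = 0 → IsNilpotent a := fun a ha => (hnu a).resolve_right fun hu =>
    (hu.map χ).ne_zero ha
  have hderiv : ∀ (D : Derivation ℂ A A) a, χ (D a) = 0 := by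
    intro D a
    -- A derivation ignores scalars, so `a` may be replaced by its nilpotent part.
    have h1 : χ (a - algebraMap ℂ A (χ a)) = 0 := by simp
    have h2 : D a = D (a - algebraMap ℂ A (χ a)) := by simp
    rw [h2]
    exact hχ _ fun hu => one_ne_zero (D.not_isUnit_of_isNilpotent (hnil _ h1) hu)
  have hsup := span_sup_range_der hb
  have hdec : ∀ x : B, ∃ (t : ℂ) (a : A), x = t • b + der a := by
    intro x
    have hx : x ∈ Submodule.span ℂ {b} ⊔ LinearMap.range (der : A →ₗ[ℂ] B) := by
      rw [hsup]; trivial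
    obtain ⟨y, hy, z, ⟨a, rfl⟩, rfl⟩ := Submodule.mem_sup.1 hx
    obtain ⟨t, rfl⟩ := Submodule.mem_span_singleton.1 hy
    exact ⟨t, a, rfl⟩
  have hbA : b ∉ AdA A B := by
    intro h
    refine hAdA (eq_top_iff.2 ?_)
    rw [← hsup]
    refine sup_le ((Submodule.span_singleton_le_iff_mem _ _).2 h) ?_
    rintro _ ⟨a, rfl⟩
    exact der_mem a
  -- A functional vanishing on `A∂(A)` and not at `b`; it is then normalized by `ℓ b = 1`.
  obtain ⟨f, hfb, hf⟩ := Submodule.exists_le_ker_of_notMem hbA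
  obtain ⟨ℓ, hℓb, hℓ⟩ : ∃ ℓ : B →ₗ[ℂ] ℂ, ℓ b = 1 ∧ ∀ x ∈ AdA A B, ℓ x = 0 :=
    ⟨(f b)⁻¹ • f, inv_mul_cancel₀ hfb, fun x hx => by
      rw [LinearMap.smul_apply, show f x = 0 from hf hx, smul_zero]⟩
  have hx : ∀ x : B, ∃ a : A, x = ℓ x • b + der a := by
    intro x
    obtain ⟨t, a, rfl⟩ := hdec x
    exact ⟨a, by rw [map_add, map_smul, hℓb, hℓ _ (der_mem a)]; simp⟩
  refine ⟨{ χ := χ, ℓ := ℓ, b := b, k := χ (pair b b), ℓ_b := hℓb, isNilpotent_ker := ?_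
            χ_anchor := fun x a => hderiv _ a, χ_pair := ?_, ℓ_der := fun a => hℓ _ (der_mem a)
            ℓ_br := ?_, ℓ_act := ?_, exists_eq := hx }, rfl, hmax⟩
  · have h : RingHom.ker χ ≤ nilradical A := fun a ha => hnil a ha
    obtain ⟨n, hn⟩ := IsArtinianRing.isNilpotent_nilradical (R := A)
    exact ⟨n, le_bot_iff.1 ((Ideal.pow_right_mono h n).trans hn.le)⟩
  · intro x y
    obtain ⟨a, ha⟩ := hx x
    obtain ⟨a', ha'⟩ := hx y
    -- Pairing with `∂a` gives anchor terms, which `χ` kills; only the multiple of `⟨b, b⟩`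
    -- survives.
    have h : pair x y = (ℓ x * ℓ y) • pair b b + ℓ x • anchor b a' + anchor y a := by
      have h1 : pair (A := A) (der a) y = anchor y a := by rw [pair_comm, pair_der]
      have h2 : pair (A := A) b y = ℓ y • pair b b + anchor b a' := by
        conv_lhs => rw [ha', map_add, map_smul, pair_der]
      conv_lhs => rw [ha, map_add, LinearMap.add_apply, map_smul, LinearMap.smul_apply, h1, h2]
      module
    rw [h, map_add, map_add, map_smul, map_smul, hderiv, hderiv]
    simp [mul_comm]
  · intro x y
    obtain ⟨a, ha⟩ := hx x
    obtain ⟨a', ha'⟩ := hx y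
    refine hℓ _ ?_
    rw [ha, map_add, map_smul, LinearMap.add_apply]
    refine add_mem ?_ (br_mem_left (der_mem a) _)
    rw [LinearMap.smul_apply]
    refine Submodule.smul_mem _ _ ?_
    rw [ha', map_add, map_smul]
    refine add_mem (Submodule.smul_mem _ _ ?_) (br_mem_right _ (der_mem a'))
    obtain ⟨d, hd⟩ := br_self_mem_range_der (A := A) b
    rw [← hd]
    exact der_mem d
  · have hAdA : ∀ x, ℓ x = 0 → x ∈ AdA A B := fun x h => by
      obtain ⟨a, ha⟩ := hx x
      rw [ha, h, zero_smul, zero_add]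
      exact der_mem a
    -- Modulo `A∂(A)`, where the action is associative, `a` acts on the class of `b` as the scalar
    -- `ℓ (act a b)`. If `a` is nilpotent so is this scalar.
    have hnilact : ∀ a, χ a = 0 → ℓ (act a b) = 0 := by
      intro a ha
      obtain ⟨n, hn⟩ := hnil a ha
      have h1 : a • LieQuot.mk A B b = ℓ (act a b) • LieQuot.mk A B b := by
        rw [LieQuot.smul_mk, ← map_smul, ← sub_eq_zero, ← map_sub, LieQuot.mk_eq_zero]
        exact hAdA _ (by simp [hℓb])
      have h2 : ∀ n : ℕ, a ^ n • LieQuot.mk A B b = ℓ (act a b) ^ n • LieQuot.mk A B b := by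
        intro n
        induction n with
        | zero => simp
        | succ n ih => rw [pow_succ', mul_smul, ih, smul_comm, h1, smul_smul, pow_succ]
      have h3 := h2 n
      rw [hn, zero_smul] at h3
      have h4 := (smul_eq_zero.1 h3.symm).resolve_right fun h => hbA (LieQuot.mk_eq_zero.1 h)
      exact eq_zero_of_pow_eq_zero h4
    intro a x
    obtain ⟨d, hd⟩ := hx x
    have h1 : χ (a - algebraMap ℂ A (χ a)) = 0 := by simp
    have h2 := hnilact _ h1
    rw [Algebra.algebraMap_eq_smul_one, map_sub, map_smul, LinearMap.sub_apply,
      LinearMap.smul_apply, one_act, map_sub, map_smul, hℓb, smul_eq_mul, mul_one, sub_eq_zero] at h2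
    conv_lhs => rw [hd, map_add, map_smul, map_add, map_smul, h2, hℓ _ (act_der_mem a d)]
    simp [mul_comm]

end Existence

/-! ### Finite-dimensional modules of the Lie algebroid -/

namespace LocalSplitting

variable {A : Type u} {B : Type v} [CommRing A] [Algebra ℂ A]
  [AddCommGroup B] [Module ℂ B] [VertexAlgebroid A B] (S : LocalSplitting A B)

theorem ℓ_eq_zero {x : B} (hx : x ∈ AdA A B) : S.ℓ x = 0 := by
  refine (Submodule.span_le (p := LinearMap.ker S.ℓ)).2 ?_ hx
  rintro _ ⟨⟨c, d⟩, rfl⟩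
  simp [S.ℓ_act, S.ℓ_der]

/-- The coordinate of `b` on `B / A∂(A)`. -/
noncomputable def ℓQ : LieQuot A B →ₗ[ℂ] ℂ := (AdA A B).liftQ S.ℓ fun _ hx => S.ℓ_eq_zero hx

@[simp] theorem ℓQ_mk (x : B) : S.ℓQ (LieQuot.mk A B x) = S.ℓ x := rfl

/-- The one-dimensional module `ℂv` with `av = χ(a)v` and `bv = cv`. -/
noncomputable def charModule (c : ℂ) : LieAlgebroidModule A (LieQuot A B) ℂ where
  aAct := (Algebra.lmul ℂ ℂ).comp S.χ
  gAct := S.ℓQ.smulRight (c • 1)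
  gAct_lie x x' y := by
    obtain ⟨x, rfl⟩ := LieQuot.mk_surjective A B x
    obtain ⟨x', rfl⟩ := LieQuot.mk_surjective A B x'
    simp only [LieQuot.lie_mk, LinearMap.smulRight_apply, ℓQ_mk, S.ℓ_br, LinearMap.smul_apply,
      Module.End.one_apply, smul_eq_mul]
    ring
  gAct_aAct x a y := by
    obtain ⟨x, rfl⟩ := LieQuot.mk_surjective A B x
    simp only [LieQuot.mk_lie, LinearMap.smulRight_apply, ℓQ_mk, LinearMap.smul_apply,
      Module.End.one_apply, smul_eq_mul, AlgHom.comp_apply, Algebra.coe_lmul_eq_mul,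
      LinearMap.mul_apply', S.χ_anchor]
    ring
  aAct_gAct x a y := by
    obtain ⟨x, rfl⟩ := LieQuot.mk_surjective A B x
    simp only [LieQuot.smul_mk, LinearMap.smulRight_apply, ℓQ_mk, LinearMap.smul_apply,
      Module.End.one_apply, smul_eq_mul, AlgHom.comp_apply, Algebra.coe_lmul_eq_mul,
      LinearMap.mul_apply', S.ℓ_act]
    ring

@[simp] theorem charModule_aAct (c : ℂ) (a : A) (y : ℂ) :
    (S.charModule c).aAct a y = S.χ a * y := rfl

@[simp] theorem charModule_gAct (c : ℂ) (x : B) (y : ℂ) :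
    (S.charModule c).gAct (LieQuot.mk A B x) y = S.ℓ x * (c * y) := by
  simp [charModule]

theorem charModule_isIrreducible (c : ℂ) : (S.charModule c).IsIrreducible :=
  ⟨inferInstance, fun N _ _ => eq_bot_or_eq_top N⟩

variable {U : Type*} [AddCommGroup U] [Module ℂ U]

/-- With `n` least such that `𝔪ⁿU = 0`, one has `n ≥ 1` because `U ≠ 0`, and any nonzero `a y` with
`a ∈ 𝔪ⁿ⁻¹` is killed by `𝔪`. -/
theorem exists_mem_ker_smul (σ : A →ₐ[ℂ] Module.End ℂ U) [Nontrivial U] :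
    ∃ y : U, y ≠ 0 ∧ ∀ a, S.χ a = 0 → σ a y = 0 := by
  classical
  have hex : ∃ n : ℕ, ∀ a ∈ RingHom.ker S.χ ^ n, ∀ y, σ a y = 0 := by
    obtain ⟨n, hn⟩ := S.isNilpotent_ker
    exact ⟨n, fun a ha y => by
      rw [hn] at ha
      simp [show a = 0 from ha]⟩
  obtain ⟨z, hz⟩ := exists_ne (0 : U)
  rcases h : Nat.find hex with _ | n
  · have h1 := Nat.find_spec hex 1 (by rw [h, pow_zero, Ideal.one_eq_top]; trivial) z
    rw [map_one] at h1
    exact absurd h1 hz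
  · have h1 := Nat.find_min hex (m := n) (by omega)
    push Not at h1
    obtain ⟨a, ha, y, hy⟩ := h1
    refine ⟨_, hy, fun a' ha' => ?_⟩
    rw [← Module.End.mul_apply, ← map_mul]
    refine Nat.find_spec hex _ ?_ y
    rw [h, pow_succ']
    exact Ideal.mul_mem_mul ha' ha

theorem aAct_of_ker {σ : A →ₐ[ℂ] Module.End ℂ U} {y : U} (h : ∀ a, S.χ a = 0 → σ a y = 0)
    (a : A) : σ a y = S.χ a • y := by
  have h1 := h (a - algebraMap ℂ A (S.χ a)) (by simp)
  rw [map_sub, AlgHom.commutes, LinearMap.sub_apply, sub_eq_zero] at h1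
  rw [h1, Module.algebraMap_end_apply]

/-- A nonzero finite-dimensional module contains a copy of some `charModule c`. -/
theorem exists_eigenvector [FiniteDimensional ℂ U] [Nontrivial U]
    (ρ : LieAlgebroidModule A (LieQuot A B) U) :
    ∃ v : U, v ≠ 0 ∧ (∀ a, ρ.aAct a v = S.χ a • v) ∧
      ∃ c : ℂ, ∀ x : B, ρ.gAct (LieQuot.mk A B x) v = (S.ℓ x * c) • v := by
  -- The vectors killed by `𝔪`. They are stable under `b` since `b(ay) - a(by) = (b₀a)y` and `b₀a`
  -- lies again in `𝔪`.
  let N : Submodule ℂ U :=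
    { carrier := {y | ∀ a, S.χ a = 0 → ρ.aAct a y = 0}
      zero_mem' := fun a _ => map_zero _
      add_mem' := fun hy hy' a ha => by rw [map_add, hy a ha, hy' a ha, add_zero]
      smul_mem' := fun c y hy a ha => by rw [map_smul, hy a ha, smul_zero] }
  have hN : ∀ y ∈ N, ρ.gAct (LieQuot.mk A B S.b) y ∈ N := by
    intro y hy a ha
    have h := ρ.gAct_aAct (LieQuot.mk A B S.b) a y
    rw [hy a ha, map_zero, zero_sub, LieQuot.mk_lie, hy _ (S.χ_anchor S.b a), neg_eq_zero] at h
    exact h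
  obtain ⟨y, hy, hyN⟩ := S.exists_mem_ker_smul ρ.aAct
  have : Nontrivial N := ⟨⟨⟨y, hyN⟩, 0, fun h => hy (congrArg Subtype.val h)⟩⟩
  obtain ⟨c, hc⟩ := Module.End.exists_eigenvalue ((ρ.gAct (LieQuot.mk A B S.b)).restrict hN)
  obtain ⟨⟨v, hvN⟩, hv⟩ := hc.exists_hasEigenvector
  refine ⟨v, fun h => hv.2 (Subtype.ext h), S.aAct_of_ker hvN, c, fun x => ?_⟩
  obtain ⟨a, ha⟩ := S.exists_eq x
  -- The quotient `B / A∂(A)` is spanned by the class of `b`, so an eigenvector of `b` is one for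
  -- all of it.
  have h1 : LieQuot.mk A B x = S.ℓ x • LieQuot.mk A B S.b := by
    conv_lhs => rw [ha, map_add, LieQuot.mk_eq_zero.2 (der_mem a), add_zero, map_smul]
  rw [h1, map_smul, LinearMap.smul_apply, mul_smul]
  exact congrArg _ (congrArg Subtype.val hv.apply_eq_smul)

theorem exists_span_eq_top [FiniteDimensional ℂ U]
    {ρ : LieAlgebroidModule A (LieQuot A B) U} (hρ : ρ.IsIrreducible) :
    ∃ v : U, v ≠ 0 ∧ Submodule.span ℂ {v} = ⊤ ∧ (∀ a, ρ.aAct a v = S.χ a • v) ∧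
      ∃ c : ℂ, ∀ x : B, ρ.gAct (LieQuot.mk A B x) v = (S.ℓ x * c) • v := by
  have := hρ.1
  obtain ⟨v, hv, h1, c, h2⟩ := S.exists_eigenvector ρ
  refine ⟨v, hv, (hρ.2 _ ?_ ?_).resolve_left ?_, h1, c, h2⟩
  · intro a y hy
    obtain ⟨t, rfl⟩ := Submodule.mem_span_singleton.1 hy
    rw [map_smul, h1]
    exact Submodule.smul_mem _ _ (Submodule.smul_mem _ _ (Submodule.mem_span_singleton_self v))
  · intro x y hy
    obtain ⟨x, rfl⟩ := LieQuot.mk_surjective A B x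
    obtain ⟨t, rfl⟩ := Submodule.mem_span_singleton.1 hy
    rw [map_smul, h2]
    exact Submodule.smul_mem _ _ (Submodule.smul_mem _ _ (Submodule.mem_span_singleton_self v))
  · rwa [Submodule.span_singleton_eq_bot]

theorem exists_iso_charModule [FiniteDimensional ℂ U]
    {ρ : LieAlgebroidModule A (LieQuot A B) U} (hρ : ρ.IsIrreducible) :
    ∃ c : ℂ, ρ.Iso (S.charModule c) := by
  obtain ⟨v, hv, htop, h1, c, h2⟩ := S.exists_span_eq_top hρ
  let e : ℂ ≃ₗ[ℂ] U :=
    (LinearEquiv.toSpanNonzeroSingleton ℂ U v hv).trans (LinearEquiv.ofTop _ htop)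
  have he : ∀ t, e t = t • v := fun t => rfl
  refine ⟨c, e.symm, fun a y => ?_, fun x y => ?_⟩
  · obtain ⟨t, rfl⟩ := e.surjective y
    rw [e.symm_apply_apply, e.symm_apply_eq, he, he, map_smul, h1, charModule_aAct, smul_smul,
      mul_comm]
  · obtain ⟨x, rfl⟩ := LieQuot.mk_surjective A B x
    obtain ⟨t, rfl⟩ := e.surjective y
    rw [e.symm_apply_apply, e.symm_apply_eq, he, he, map_smul, h2, charModule_gAct, smul_smul]
    congr 1
    ring

theorem eq_of_charModule_iso {c c' : ℂ} (h : (S.charModule c).Iso (S.charModule c')) :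
    c = c' := by
  obtain ⟨f, -, hf⟩ := h
  have h1 := hf (LieQuot.mk A B S.b) 1
  rw [charModule_gAct, charModule_gAct, S.ℓ_b, one_mul, one_mul, mul_one] at h1
  have h2 : f c = c * f 1 := by rw [← smul_eq_mul c, ← map_smul, smul_eq_mul, mul_one]
  rw [h2] at h1
  exact mul_right_cancel₀ (fun h => one_ne_zero (f.map_eq_zero_iff.1 h)) h1

end LocalSplitting

/-! ### Homogeneous elements of `ℒ` -/

section Homogeneous

variable {A : Type u} {B : Type v} [CommRing A] [Algebra ℂ A]
  [AddCommGroup B] [Module ℂ B] [VertexAlgebroid A B]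

@[simp] theorem md_mk_zero (n : ℤ) : md A B (0, 0) n = 0 := md_zero n

theorem md_comm_fst_fst (a a' : A) (m n : ℤ) :
    md A B (a, 0) m * md A B (a', 0) n - md A B (a', 0) n * md A B (a, 0) m = 0 := by
  rw [md_comm]
  simp

theorem md_comm_fst_snd (a : A) (y : B) (m n : ℤ) :
    md A B (a, 0) m * md A B (0, y) n - md A B (0, y) n * md A B (a, 0) m
      = (-1 : ℂ) • md A B (anchor y a, 0) (m + n) := by
  rw [← md_smul (-1) (anchor y a, 0), md_comm]
  simp

theorem md_comm_snd_fst (x : B) (a : A) (m n : ℤ) :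
    md A B (0, x) m * md A B (a, 0) n - md A B (a, 0) n * md A B (0, x) m
      = md A B (anchor x a, 0) (m + n) := by
  rw [md_comm]
  simp

theorem md_comm_snd_snd (x y : B) (m n : ℤ) :
    md A B (0, x) m * md A B (0, y) n - md A B (0, y) n * md A B (0, x) m
      = md A B (0, br A x y) (m + n) + (m : ℂ) • md A B (pair x y, 0) (m + n - 1) := by
  rw [md_comm]
  simp

theorem md_eq_add (x : A × B) (n : ℤ) : md A B x n = md A B (x.1, 0) n + md A B (0, x.2) n := by
  rw [← md_add]
  simp

variable (A B) in
/-- The homogeneous element `a(-d-1) + u(-d)` of degree `d`. -/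
noncomputable def hm (d : ℤ) (x : A × B) : UL A B :=
  md A B (x.1, 0) (-d - 1) + md A B (0, x.2) (-d)

theorem md_fst_eq_hm (a : A) (n : ℤ) : md A B (a, 0) n = hm A B (-n - 1) (a, 0) := by
  rw [hm, show -(-n - 1) - 1 = n by ring, show md A B (0, ((a, 0) : A × B).2) _ = 0 from md_zero _,
    add_zero]

theorem md_snd_eq_hm (x : B) (n : ℤ) : md A B (0, x) n = hm A B (-n) (0, x) := by
  rw [hm, neg_neg, show md A B (((0, x) : A × B).1, 0) _ = 0 from md_zero _, zero_add]

/-- Packing `a(-d-1)` and `u(-d)` into one symbol makes the bracket of homogeneous elements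
homogeneous; the factor `-d` of the pairing is the mode index of `u(-d)`. -/
theorem hm_comm (d e : ℤ) (x y : A × B) :
    hm A B d x * hm A B e y - hm A B e y * hm A B d x
      = hm A B (d + e) (anchor x.2 y.1 - anchor y.2 x.1 - (d : ℂ) • pair x.2 y.2,
        br A x.2 y.2) := by
  have h1 := md_comm_fst_fst (B := B) x.1 y.1 (-d - 1) (-e - 1)
  have h2 := md_comm_fst_snd x.1 y.2 (-d - 1) (-e)
  have h3 := md_comm_snd_fst x.2 y.1 (-d) (-e - 1)
  have h4 := md_comm_snd_snd (A := A) x.2 y.2 (-d) (-e)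
  have h5 : md A B (anchor x.2 y.1 - anchor y.2 x.1 - (d : ℂ) • pair x.2 y.2, 0) (-(d + e) - 1)
      = md A B (anchor x.2 y.1, 0) (-(d + e) - 1)
        + ((-1 : ℂ) • md A B (anchor y.2 x.1, 0) (-(d + e) - 1)
        + (-d : ℂ) • md A B (pair x.2 y.2, 0) (-(d + e) - 1)) := by
    rw [← md_smul, ← md_smul, ← md_add, ← md_add]
    congr 1
    ext <;> simp
    ring
  rw [hm, hm, hm]
  dsimp only
  rw [h5]
  rw [show -d - 1 + -e = -(d + e) - 1 by ring] at h2
  rw [show -d + (-e - 1) = -(d + e) - 1 by ring] at h3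
  rw [show -d + -e = -(d + e) by ring] at h4
  push_cast at h4
  simp only [mul_add, add_mul]
  linear_combination (norm := module) h1 + h2 + h3 + h4

variable (A B) in
/-- The automorphism of `U(ℒ)` that is multiplication by `2ᵈ` on the component of degree `d`. -/
noncomputable def degAut : UL A B →ₐ[ℂ] UL A B :=
  liftUL (fun n =>
      { toFun := fun x => (2 : ℂ) ^ (-n - 1) • md A B (x.1, 0) n + (2 : ℂ) ^ (-n) • md A B (0, x.2) n
        map_add' := fun x y => by
          have h1 := md_add (A := A) (B := B) (x.1, 0) (y.1, 0) n
          have h2 := md_add (A := A) (B := B) (0, x.2) (0, y.2) n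
          simp only [Prod.mk_add_mk, add_zero] at h1 h2
          rw [Prod.fst_add, Prod.snd_add, h1, h2]
          module
        map_smul' := fun c x => by
          have h1 := md_smul (A := A) (B := B) c (x.1, 0) n
          have h2 := md_smul (A := A) (B := B) c (0, x.2) n
          simp only [Prod.smul_mk, smul_zero] at h1 h2
          rw [Prod.smul_fst, Prod.smul_snd, h1, h2]
          simp only [RingHom.id_apply]
          module })
    (fun a n => by
      change (2 : ℂ) ^ (-n - 1) • md A B 0 n + (2 : ℂ) ^ (-n) • md A B (0, der a) n
        = (-n : ℂ) • ((2 : ℂ) ^ (-(n - 1) - 1) • md A B (a, 0) (n - 1)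
          + (2 : ℂ) ^ (-(n - 1)) • md A B 0 (n - 1))
      rw [md_zero, md_zero, md_der, show -(n - 1) - 1 = -n by ring]
      module)
    (fun x y m n => by
      have h1 := md_comm_fst_fst (B := B) x.1 y.1 m n
      have h2 := md_comm_fst_snd x.1 y.2 m n
      have h3 := md_comm_snd_fst x.2 y.1 m n
      have h4 := md_comm_snd_snd (A := A) x.2 y.2 m n
      have h5 : md A B (anchor x.2 y.1 - anchor y.2 x.1, 0) (m + n)
          = md A B (anchor x.2 y.1, 0) (m + n)
            + (-1 : ℂ) • md A B (anchor y.2 x.1, 0) (m + n) := by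
        rw [← md_smul, ← md_add]
        congr 1
        ext <;> simp
        ring
      -- The next four identities say that the bracket preserves degrees: the power of `2` on each
      -- component of the bracket is the product of the powers on its factors.
      have e1 : (2 : ℂ) ^ (-(m + n) - 1) = 2 ^ (-m - 1) * 2 ^ (-n) := by
        rw [← zpow_add₀ two_ne_zero]; congr 1; ring
      have e2 : (2 : ℂ) ^ (-m) * 2 ^ (-n - 1) = 2 ^ (-m - 1) * 2 ^ (-n) := by
        rw [← zpow_add₀ two_ne_zero, ← zpow_add₀ two_ne_zero]; congr 1; ring
      have e3 : (2 : ℂ) ^ (-(m + n)) = 2 ^ (-m) * 2 ^ (-n) := by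
        rw [← zpow_add₀ two_ne_zero]; congr 1; ring
      have e4 : (2 : ℂ) ^ (-(m + n - 1) - 1) = 2 ^ (-m) * 2 ^ (-n) := by
        rw [← zpow_add₀ two_ne_zero]; congr 1; ring
      simp only [LinearMap.coe_mk, AddHom.coe_mk, prod0_apply, prod1_apply]
      rw [show md A B (0, ((pair x.2 y.2, 0) : A × B).2) _ = 0 from md_zero _, h5, e1, e3, e4]
      simp only [mul_add, add_mul, smul_mul_smul_comm]
      rw [mul_comm ((2 : ℂ) ^ (-n - 1)) ((2 : ℂ) ^ (-m)), e2, mul_comm ((2 : ℂ) ^ (-n)) ((2 : ℂ) ^ (-m)),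
        mul_comm ((2 : ℂ) ^ (-n)) ((2 : ℂ) ^ (-m - 1)),
        mul_comm ((2 : ℂ) ^ (-n - 1)) ((2 : ℂ) ^ (-m - 1))]
      generalize (2 : ℂ) ^ (-m - 1) * (2 : ℂ) ^ (-n - 1) = r
      generalize (2 : ℂ) ^ (-m - 1) * (2 : ℂ) ^ (-n) = s
      generalize (2 : ℂ) ^ (-m) * (2 : ℂ) ^ (-n) = t
      linear_combination (norm := module) r • h1 + s • h2 + s • h3 + t • h4)

theorem degAut_md (x : A × B) (n : ℤ) : degAut A B (md A B x n)
    = (2 : ℂ) ^ (-n - 1) • md A B (x.1, 0) n + (2 : ℂ) ^ (-n) • md A B (0, x.2) n :=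
  liftUL_md _ _ _ x n

theorem degAut_isMonomial {d : ℤ} {p : UL A B} (h : IsMonomial d p) :
    degAut A B p = (2 : ℂ) ^ d • p := by
  induction h with
  | one => simp
  | mulA a n d p _ ih =>
    rw [map_mul, ih, degAut_md, show md A B (0, ((a, 0) : A × B).2) n = 0 from md_zero _,
      smul_zero, add_zero, smul_mul_smul_comm, ← zpow_add₀ two_ne_zero]
    congr 2
    ring
  | mulB x n d p _ ih =>
    rw [map_mul, ih, degAut_md, show md A B (((0, x) : A × B).1, 0) n = 0 from md_zero _,
      smul_zero, zero_add, smul_mul_smul_comm, ← zpow_add₀ two_ne_zero]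
    congr 2
    ring

theorem IsMonomial.mul {d e : ℤ} {p q : UL A B} (hp : IsMonomial d p) (hq : IsMonomial e q) :
    IsMonomial (d + e) (p * q) := by
  induction hp with
  | one => simpa using hq
  | mulA a n d p _ ih =>
    rw [mul_assoc, show d - n - 1 + e = d + e - n - 1 by ring]
    exact .mulA a n _ _ ih
  | mulB x n d p _ ih =>
    rw [mul_assoc, show d - n + e = d + e - n by ring]
    exact .mulB x n _ _ ih

/-- The monomials span `U(ℒ)`. -/
theorem mem_span_isMonomial (p : UL A B) :
    p ∈ Submodule.span ℂ {p : UL A B | ∃ d, IsMonomial d p} := by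
  have h : ∀ x n, ∀ q ∈ Submodule.span ℂ {p : UL A B | ∃ d, IsMonomial d p},
      md A B x n • q ∈ Submodule.span ℂ {p : UL A B | ∃ d, IsMonomial d p} := by
    intro x n q hq
    induction hq using Submodule.span_induction with
    | mem q hq =>
      obtain ⟨d, hd⟩ := hq
      rw [md_eq_add, add_smul]
      exact add_mem (Submodule.subset_span ⟨_, .mulA _ n d q hd⟩)
        (Submodule.subset_span ⟨_, .mulB _ n d q hd⟩)
    | zero => rw [smul_zero]; exact zero_mem _
    | add q q' _ _ hq hq' => rw [smul_add]; exact add_mem hq hq'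
    | smul c q _ hq => rw [smul_algebra_smul_comm]; exact Submodule.smul_mem _ _ hq
  have := smul_mem_of_md h p (Submodule.subset_span ⟨0, .one⟩)
  rwa [smul_eq_mul, mul_one] at this

end Homogeneous

/-! ### The induced module `M(U)` and its grading -/

namespace IndM

variable {A : Type u} {B : Type v} [CommRing A] [Algebra ℂ A]
  [AddCommGroup B] [Module ℂ B] [VertexAlgebroid A B]
  {U : Type w} [AddCommGroup U] [Module ℂ U] (ρ : LieAlgebroidModule A (LieQuot A B) U)

/-- The map `y ↦ 1 ⊗ y` from `U` to `M(U)`. -/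
noncomputable def ι : U →ₗ[ℂ] IndM ρ :=
  (indRel ρ).mkQ.restrictScalars ℂ ∘ₗ TensorProduct.mk ℂ (UL A B) U 1

theorem mkQ_tmul (p : UL A B) (y : U) : (indRel ρ).mkQ (p ⊗ₜ[ℂ] y) = p • ι ρ y := by
  change _ = p • (indRel ρ).mkQ (1 ⊗ₜ[ℂ] y)
  rw [← map_smul, TensorProduct.smul_tmul', smul_eq_mul, mul_one]

theorem bot_eq : IndM.bot ρ = LinearMap.range (ι ρ) := by
  rw [IndM.bot, ← Submodule.span_eq (LinearMap.range (ι ρ))]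
  congr 1
  ext v
  exact ⟨fun ⟨y, hy⟩ => ⟨y, hy.symm⟩, fun ⟨y, hy⟩ => ⟨y, hy.symm⟩⟩

theorem hm_zero_smul_ι (x : A × B) (y : U) :
    hm A B 0 x • ι ρ y = ι ρ (ρ.aAct x.1 y + ρ.gAct (LieQuot.mk A B x.2) y) := by
  have h1 : (indRel ρ).mkQ (md A B (x.1, 0) (-1) ⊗ₜ[ℂ] y - 1 ⊗ₜ[ℂ] ρ.aAct x.1 y) = 0 :=
    (Submodule.Quotient.mk_eq_zero _).2
      (Submodule.subset_span (.inl (.inl (.inl ⟨x.1, y, rfl⟩))))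
  have h2 : (indRel ρ).mkQ
      (md A B (0, x.2) 0 ⊗ₜ[ℂ] y - 1 ⊗ₜ[ℂ] ρ.gAct (LieQuot.mk A B x.2) y) = 0 :=
    (Submodule.Quotient.mk_eq_zero _).2
      (Submodule.subset_span (.inl (.inl (.inr ⟨x.2, y, rfl⟩))))
  rw [map_sub, mkQ_tmul, mkQ_tmul, one_smul, sub_eq_zero] at h1 h2
  rw [hm, add_smul, map_add, ← h1, ← h2]
  simp

theorem hm_smul_ι_of_neg {d : ℤ} (hd : d < 0) (x : A × B) (y : U) :
    hm A B d x • ι ρ y = 0 := by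
  have h1 : (indRel ρ).mkQ (md A B (x.1, 0) (-d - 1) ⊗ₜ[ℂ] y) = 0 :=
    (Submodule.Quotient.mk_eq_zero _).2
      (Submodule.subset_span (.inl (.inr ⟨x.1, -d - 1, y, by omega, rfl⟩)))
  have h2 : (indRel ρ).mkQ (md A B (0, x.2) (-d) ⊗ₜ[ℂ] y) = 0 :=
    (Submodule.Quotient.mk_eq_zero _).2
      (Submodule.subset_span (.inr ⟨x.2, -d, y, by omega, rfl⟩))
  rw [mkQ_tmul] at h1 h2
  rw [hm, add_smul, h1, h2, add_zero]

section Lift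

variable {ρ} {W : Type*} [AddCommGroup W] [Module ℂ W] [Module (UL A B) W]
  [IsScalarTower ℂ (UL A B) W] (f : U →ₗ[ℂ] W)
  (h0 : ∀ x y, hm A B 0 x • f y = f (ρ.aAct x.1 y + ρ.gAct (LieQuot.mk A B x.2) y))
  (hneg : ∀ d < 0, ∀ x y, hm A B d x • f y = 0)

/-- The homomorphism from `M(U)` determined by its values on `U`. -/
noncomputable def lift : IndM ρ →ₗ[UL A B] W :=
  (indRel ρ).liftQ (TensorProduct.AlgebraTensorModule.lift
    (LinearMap.toSpanSingleton (UL A B) (U →ₗ[ℂ] W) f)) (by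
    rw [indRel, Submodule.span_le]
    rintro _ (((⟨a, y, rfl⟩ | ⟨x, y, rfl⟩) | ⟨a, n, y, hn, rfl⟩) | ⟨x, n, y, hn, rfl⟩)
    · have h := h0 (a, 0) y
      rw [← neg_add_cancel (1 : ℤ), add_comm] at h
      simp_all [hm]
    · have h := h0 (0, x) y
      simp_all [hm]
    · have h := hneg (-n - 1) (by omega) (a, 0) y
      rw [← md_fst_eq_hm] at h
      simpa using h
    · have h := hneg (-n) (by omega) (0, x) y
      rw [← md_snd_eq_hm] at h
      simpa using h)

theorem lift_ι (y : U) : lift f h0 hneg (ι ρ y) = f y := by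
  change (TensorProduct.AlgebraTensorModule.lift
    (LinearMap.toSpanSingleton (UL A B) (U →ₗ[ℂ] W) f)) (1 ⊗ₜ[ℂ] y) = f y
  simp

end Lift

/-- The component of degree `d` of `M(U)`, for an integer `d`. -/
noncomputable def grZ (d : ℤ) : Submodule ℂ (IndM ρ) :=
  Submodule.span ℂ {v | ∃ (p : UL A B) (y : U), IsMonomial d p ∧ v = p • ι ρ y}

theorem gr_eq_grZ (n : ℕ) : IndM.gr ρ n = grZ ρ n := by
  simp only [IndM.gr, grZ, mkQ_tmul]

variable {ρ}

theorem smul_mem_grZ {d e : ℤ} {p : UL A B} (hp : IsMonomial e p) {v : IndM ρ}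
    (hv : v ∈ grZ ρ d) : p • v ∈ grZ ρ (e + d) := by
  induction hv using Submodule.span_induction with
  | mem v hv =>
    obtain ⟨q, y, hq, rfl⟩ := hv
    rw [← mul_smul]
    exact Submodule.subset_span ⟨_, y, hp.mul hq, rfl⟩
  | zero => rw [smul_zero]; exact zero_mem _
  | add v v' _ _ hv hv' => rw [smul_add]; exact add_mem hv hv'
  | smul c v _ hv => rw [smul_algebra_smul_comm]; exact Submodule.smul_mem _ _ hv

theorem ι_mem_grZ (y : U) : ι ρ y ∈ grZ ρ 0 :=
  Submodule.subset_span ⟨1, y, .one, (one_smul _ _).symm⟩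

/-- Products of homogeneous elements of positive degree. -/
inductive IsCreation : ℤ → UL A B → Prop
  | one : IsCreation 0 1
  | mul (e : ℤ) (he : 0 < e) (x : A × B) (d : ℤ) (p : UL A B) (h : IsCreation d p) :
      IsCreation (d + e) (hm A B e x * p)

theorem IsCreation.nonneg {d : ℤ} {p : UL A B} (h : IsCreation d p) : 0 ≤ d := by
  induction h with
  | one => rfl
  | mul e he x d p _ ih => omega

theorem IsCreation.eq_one {d : ℤ} {p : UL A B} (h : IsCreation d p) (hd : d = 0) : p = 1 := by
  cases h with
  | one => rfl
  | mul e he x d p h => have := h.nonneg; omega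

variable (ρ) in
/-- The subspace spanned by the vectors `p • y` with `p` a creation operator of degree `d`. -/
noncomputable def creationSpan (d : ℤ) : Submodule ℂ (IndM ρ) :=
  Submodule.span ℂ {v | ∃ (p : UL A B) (y : U), IsCreation d p ∧ v = p • ι ρ y}

theorem hm_smul_mem_creationSpan_of_pos {d e : ℤ} (he : 0 < e) (x : A × B) {v : IndM ρ}
    (hv : v ∈ creationSpan ρ d) : hm A B e x • v ∈ creationSpan ρ (d + e) := by
  induction hv using Submodule.span_induction with
  | mem v hv =>
    obtain ⟨q, y, hq, rfl⟩ := hv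
    rw [← mul_smul]
    exact Submodule.subset_span ⟨_, y, .mul e he x d q hq, rfl⟩
  | zero => rw [smul_zero]; exact zero_mem _
  | add v v' _ _ hv hv' => rw [smul_add]; exact add_mem hv hv'
  | smul c v _ hv => rw [smul_algebra_smul_comm]; exact Submodule.smul_mem _ _ hv

/-- A substitute for the easy half of the Poincaré–Birkhoff–Witt theorem. Any homogeneous element is
moved to the right past the creation operators; the commutators are homogeneous and meet a shorter
product, and on `U` the rules of the induced module apply. Hence `M(U)` has no negative degrees and
its degree-zero part is `U`. -/
theorem hm_smul_isCreation {d : ℤ} {p : UL A B} (hp : IsCreation d p) (e : ℤ) (x : A × B)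
    (y : U) : hm A B e x • p • ι ρ y ∈ creationSpan ρ (d + e) := by
  induction hp generalizing e x with
  | one =>
    rw [one_smul, zero_add]
    rcases lt_trichotomy e 0 with he | rfl | he
    · rw [hm_smul_ι_of_neg ρ he]
      exact zero_mem _
    · rw [hm_zero_smul_ι]
      exact Submodule.subset_span ⟨1, _, .one, (one_smul _ _).symm⟩
    · refine Submodule.subset_span ⟨hm A B e x * 1, y, ?_, by rw [mul_one]⟩
      have := IsCreation.mul e he x 0 1 .one
      rwa [zero_add] at this
  | mul e' he' x' d p _ ih =>
    have h : hm A B e x • (hm A B e' x' * p) • ι ρ y = hm A B e' x' • hm A B e x • p • ι ρ y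
        + (hm A B e x * hm A B e' x' - hm A B e' x' * hm A B e x) • p • ι ρ y := by
      simp only [sub_smul, mul_smul]
      abel
    rw [h, hm_comm]
    refine add_mem ?_ ?_
    · have := hm_smul_mem_creationSpan_of_pos he' x' (ih e x)
      rwa [show d + e + e' = d + e' + e by ring] at this
    · have := ih (e + e') (anchor x.2 x'.1 - anchor x'.2 x.1 - (e : ℂ) • pair x.2 x'.2,
        br A x.2 x'.2)
      rwa [show d + (e + e') = d + e' + e by ring] at this

theorem hm_smul_mem_creationSpan {d : ℤ} (e : ℤ) (x : A × B) {v : IndM ρ}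
    (hv : v ∈ creationSpan ρ d) : hm A B e x • v ∈ creationSpan ρ (d + e) := by
  induction hv using Submodule.span_induction with
  | mem v hv =>
    obtain ⟨q, y, hq, rfl⟩ := hv
    exact hm_smul_isCreation hq e x y
  | zero => rw [smul_zero]; exact zero_mem _
  | add v v' _ _ hv hv' => rw [smul_add]; exact add_mem hv hv'
  | smul c v _ hv => rw [smul_algebra_smul_comm]; exact Submodule.smul_mem _ _ hv

theorem grZ_le_creationSpan (d : ℤ) : grZ ρ d ≤ creationSpan ρ d := by
  rw [grZ, Submodule.span_le]
  rintro _ ⟨p, y, hp, rfl⟩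
  induction hp with
  | one => exact Submodule.subset_span ⟨1, y, .one, rfl⟩
  | mulA a n d p _ ih =>
    have := hm_smul_mem_creationSpan (-n - 1) (a, 0) ih
    rwa [← md_fst_eq_hm, ← mul_smul, show d + (-n - 1) = d - n - 1 by ring] at this
  | mulB x n d p _ ih =>
    have := hm_smul_mem_creationSpan (-n) (0, x) ih
    rwa [← md_snd_eq_hm, ← mul_smul, show d + -n = d - n by ring] at this

theorem grZ_eq_bot {d : ℤ} (hd : d < 0) : grZ ρ d = ⊥ := by
  rw [eq_bot_iff]
  refine (grZ_le_creationSpan d).trans (Submodule.span_le.2 ?_)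
  rintro _ ⟨p, y, hp, rfl⟩
  have := hp.nonneg
  omega

theorem gr_zero_eq : IndM.gr ρ 0 = IndM.bot ρ := by
  rw [gr_eq_grZ, bot_eq]
  refine le_antisymm ((grZ_le_creationSpan _).trans (Submodule.span_le.2 ?_)) ?_
  · rintro _ ⟨p, y, hp, rfl⟩
    rw [hp.eq_one (by simp), one_smul]
    exact ⟨y, rfl⟩
  · rintro _ ⟨y, rfl⟩
    exact ι_mem_grZ y

theorem mem_iSup_gr_of_grZ {d : ℤ} {v : IndM ρ} (hv : v ∈ grZ ρ d) : v ∈ ⨆ n, IndM.gr ρ n := by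
  rcases lt_or_ge d 0 with hd | hd
  · rw [grZ_eq_bot hd] at hv
    rw [(Submodule.mem_bot ℂ).1 hv]
    exact zero_mem _
  · obtain ⟨n, rfl⟩ := Int.eq_ofNat_of_zero_le hd
    rw [← gr_eq_grZ] at hv
    exact Submodule.mem_iSup_of_mem n hv

theorem eq_top_of_ι_mem {N : Submodule (UL A B) (IndM ρ)} (h : ∀ y, ι ρ y ∈ N) : N = ⊤ := by
  rw [eq_top_iff]
  rintro v -
  obtain ⟨t, rfl⟩ := (indRel ρ).mkQ_surjective v
  induction t using TensorProduct.induction_on with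
  | zero => rw [map_zero]; exact zero_mem _
  | tmul p y => rw [mkQ_tmul]; exact N.smul_mem p (h y)
  | add t t' ht ht' => rw [map_add]; exact add_mem ht ht'

theorem smul_mem_of_isMonomial {W : Type*} [AddCommGroup W] [Module ℂ W] [Module (UL A B) W]
    [IsScalarTower ℂ (UL A B) W] {v : W} {N : Submodule ℂ W}
    (h : ∀ d (p : UL A B), IsMonomial d p → p • v ∈ N) (p : UL A B) : p • v ∈ N := by
  have hp := mem_span_isMonomial p
  induction hp using Submodule.span_induction with
  | mem p hp => exact h _ p hp.choose_spec
  | zero => rw [zero_smul]; exact zero_mem _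
  | add p q _ _ hp hq => rw [add_smul]; exact add_mem hp hq
  | smul c p _ hp => rw [smul_assoc]; exact N.smul_mem c hp

theorem iSup_gr : ⨆ n, IndM.gr ρ n = ⊤ := by
  rw [eq_top_iff]
  rintro v -
  obtain ⟨t, rfl⟩ := (indRel ρ).mkQ_surjective v
  induction t using TensorProduct.induction_on with
  | zero => rw [map_zero]; exact zero_mem _
  | tmul p y =>
    rw [mkQ_tmul]
    refine smul_mem_of_isMonomial (fun d p hp => ?_) p
    exact mem_iSup_gr_of_grZ (smul_mem_grZ hp (ι_mem_grZ y))
  | add t t' ht ht' => rw [map_add]; exact add_mem ht ht'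

variable (ρ) in
/-- `M(U)` with the action of `U(ℒ)` twisted by `degAut`. -/
noncomputable abbrev twistRep : UL A B →ₐ[ℂ] Module.End ℂ (IndM ρ) :=
  (Algebra.lsmul ℂ ℂ (IndM ρ)).comp (degAut A B)

theorem degAut_hm (d : ℤ) (x : A × B) : degAut A B (hm A B d x) = (2 : ℂ) ^ d • hm A B d x := by
  rw [hm, map_add, degAut_md, degAut_md]
  simp

variable (ρ) in
/-- The map from `M(U)` to its twist that is the identity on `U`. -/
noncomputable def twistMap : IndM ρ →ₗ[UL A B] RepSpace (twistRep ρ) :=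
  lift ((RepSpace.equiv (twistRep ρ)).toLinearMap ∘ₗ ι ρ)
    (fun x y => by
      change RepSpace.equiv (twistRep ρ) (degAut A B (hm A B 0 x) • ι ρ y) = _
      rw [degAut_hm, zpow_zero, one_smul, hm_zero_smul_ι]
      rfl)
    (fun d hd x y => by
      change RepSpace.equiv (twistRep ρ) (degAut A B (hm A B d x) • ι ρ y) = _
      rw [degAut_hm, smul_assoc, hm_smul_ι_of_neg ρ hd, smul_zero, map_zero])

variable (ρ) in
/-- The operator on `M(U)` that is multiplication by `2ᵈ` on the component of degree `d`. -/
noncomputable def degOp : Module.End ℂ (IndM ρ) :=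
  (RepSpace.equiv (twistRep ρ)).symm.toLinearMap ∘ₗ (twistMap ρ).restrictScalars ℂ

theorem degOp_smul (p : UL A B) (v : IndM ρ) :
    degOp ρ (p • v) = degAut A B p • degOp ρ v :=
  map_smul (twistMap ρ) p v

theorem degOp_ι (y : U) : degOp ρ (ι ρ y) = ι ρ y := by
  change twistMap ρ (ι ρ y) = RepSpace.equiv (twistRep ρ) (ι ρ y)
  rw [twistMap, lift_ι]
  rfl

theorem grZ_le_eigenspace (d : ℤ) : grZ ρ d ≤ (degOp ρ).eigenspace (2 ^ d) := by
  rw [grZ, Submodule.span_le]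
  rintro _ ⟨p, y, hp, rfl⟩
  rw [SetLike.mem_coe, Module.End.mem_eigenspace_iff, degOp_smul, degOp_ι, degAut_isMonomial hp,
    smul_assoc]

theorem gr_le_eigenspace (n : ℕ) : IndM.gr ρ n ≤ (degOp ρ).eigenspace (2 ^ n) := by
  rw [gr_eq_grZ]
  simpa using grZ_le_eigenspace (ρ := ρ) n

theorem two_pow_injective : Function.Injective fun n : ℕ => (2 : ℂ) ^ n := by
  intro m n h
  have h' : ((2 ^ m : ℕ) : ℂ) = ((2 ^ n : ℕ) : ℂ) := by push_cast; exact h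
  exact Nat.pow_right_injective le_rfl (Nat.cast_injective h')

/-- Independence of graded components is obtained from eigenspaces: multiplication by `2ⁿ` in degree
`n` has different eigenvalues in different degrees. -/
theorem iSupIndep_of_le_eigenspace {W : Type*} [AddCommGroup W] [Module ℂ W]
    {θ : Module.End ℂ W} {gr : ℕ → Submodule ℂ W} (h : ∀ n, gr n ≤ θ.eigenspace (2 ^ n)) :
    iSupIndep gr :=
  (θ.eigenspaces_iSupIndep.comp two_pow_injective).mono h

theorem iSupIndep_gr : iSupIndep (IndM.gr ρ) := iSupIndep_of_le_eigenspace gr_le_eigenspace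

end IndM

/-! ### The maximal submodule `J(U)` and the quotient `L(U)` -/

section MaxJ

variable {A : Type u} {B : Type v} [CommRing A] [Algebra ℂ A]
  [AddCommGroup B] [Module ℂ B] [VertexAlgebroid A B]
  {U : Type w} [AddCommGroup U] [Module ℂ U] {ρ : LieAlgebroidModule A (LieQuot A B) U}

namespace IndM

variable (ρ) in
/-- The sum of the components of positive degree of `M(U)`. -/
noncomputable def pos : Submodule ℂ (IndM ρ) := ⨆ n, IndM.gr ρ (n + 1)

theorem gr_succ_le_pos (n : ℕ) : IndM.gr ρ (n + 1) ≤ pos ρ :=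
  le_iSup (fun n => IndM.gr ρ (n + 1)) n

theorem disjoint_bot_pos : Disjoint (IndM.bot ρ) (pos ρ) := by
  rw [← gr_zero_eq]
  exact (iSupIndep_gr 0).mono_right
    (iSup_le fun n => le_iSup₂_of_le (n + 1) n.succ_ne_zero le_rfl)

/-- Degree zero is exactly `U`, so a graded subspace that misses `U` has no component in degree
zero. Such subspaces are closed under sums, which is what makes `J(U)` itself miss `U`. -/
theorem le_pos {N : Submodule ℂ (IndM ρ)} (h : N ≤ ⨆ n, N ⊓ IndM.gr ρ n)
    (hb : N ⊓ IndM.bot ρ = ⊥) : N ≤ pos ρ := by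
  refine h.trans (iSup_le fun n => ?_)
  rcases n with _ | n
  · rw [gr_zero_eq, hb]
    exact bot_le
  · exact inf_le_right.trans (gr_succ_le_pos n)

theorem le_maxJ {N : Submodule (UL A B) (IndM ρ)}
    (h : N.restrictScalars ℂ ≤ ⨆ n, N.restrictScalars ℂ ⊓ IndM.gr ρ n)
    (hpos : N.restrictScalars ℂ ≤ pos ρ) : N ≤ maxJ ρ :=
  le_sSup ⟨h, ((disjoint_bot_pos.mono_right hpos).symm).eq_bot⟩

theorem maxJ_induction {P : Submodule ℂ (IndM ρ)}
    (h : ∀ N : Submodule (UL A B) (IndM ρ), N ≤ maxJ ρ →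
      N.restrictScalars ℂ ≤ ⨆ n, N.restrictScalars ℂ ⊓ IndM.gr ρ n →
      N.restrictScalars ℂ ⊓ IndM.bot ρ = ⊥ → N.restrictScalars ℂ ≤ P) :
    (maxJ ρ).restrictScalars ℂ ≤ P := by
  intro v hv
  have hv' : v ∈ maxJ ρ := hv
  clear hv
  rw [maxJ, sSup_eq_iSup'] at hv'
  induction hv' using Submodule.iSup_induction' with
  | mem N v hN => exact h N.1 (le_sSup N.2) N.2.1 N.2.2 hN
  | zero => exact zero_mem _
  | add v v' _ _ h1 h2 => exact add_mem h1 h2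

theorem maxJ_le_iSup : (maxJ ρ).restrictScalars ℂ
    ≤ ⨆ n, (maxJ ρ).restrictScalars ℂ ⊓ IndM.gr ρ n :=
  maxJ_induction fun _ hN h1 _ => h1.trans (iSup_mono fun _ => inf_le_inf_right _ hN)

/-- Each submodule in the supremum consists of vectors of positive degree, hence so does their sum.
Thus the supremum defining `J(U)` still meets `U` only in zero. -/
theorem maxJ_le_pos : (maxJ ρ).restrictScalars ℂ ≤ pos ρ :=
  maxJ_induction fun _ _ h1 h2 => le_pos h1 h2

theorem eq_zero_of_mem_maxJ {v : IndM ρ} (hv : v ∈ IndM.bot ρ) (hJ : v ∈ maxJ ρ) : v = 0 :=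
  (Submodule.disjoint_def.1 disjoint_bot_pos) v hv (maxJ_le_pos hJ)

/-- A homogeneous vector that is annihilated by all operators to degree zero lies in `J(U)`. -/
theorem mem_maxJ_of_smul {n : ℕ} {v : IndM ρ} (hv : v ∈ IndM.gr ρ n)
    (h : ∀ p : UL A B, IsMonomial (-n) p → p • v = 0) : v ∈ maxJ ρ := by
  rw [gr_eq_grZ] at hv
  -- The vector `p • v` has degree `d + n`: it vanishes in negative degree, vanishes by hypothesis
  -- in degree zero, and otherwise has positive degree. So the submodule generated by `v` misses
  -- `U`.
  have key : ∀ d (p : UL A B), IsMonomial d p → p • v = 0 ∨ ∃ k : ℕ, p • v ∈ IndM.gr ρ (k + 1) := by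
    intro d p hp
    have h1 := smul_mem_grZ hp hv
    rcases lt_trichotomy (d + n) 0 with hd | hd | hd
    · rw [grZ_eq_bot hd] at h1
      exact .inl h1
    · obtain rfl : d = -n := by omega
      exact .inl (h p hp)
    · obtain ⟨k, hk⟩ := Int.eq_ofNat_of_zero_le (a := d + n - 1) (by omega)
      refine .inr ⟨k, ?_⟩
      rw [gr_eq_grZ]
      rwa [show d + n = ((k + 1 : ℕ) : ℤ) by push_cast; omega] at h1
  refine le_maxJ (N := Submodule.span (UL A B) {v}) ?_ ?_
    (Submodule.mem_span_singleton_self v)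
  · intro w hw
    obtain ⟨p, rfl⟩ := Submodule.mem_span_singleton.1 hw
    refine smul_mem_of_isMonomial (fun d p hp => ?_) p
    rcases key d p hp with h0 | ⟨k, hk⟩
    · rw [h0]
      exact zero_mem _
    · exact Submodule.mem_iSup_of_mem (k + 1)
        ⟨Submodule.smul_mem _ p (Submodule.mem_span_singleton_self v), hk⟩
  · intro w hw
    obtain ⟨p, rfl⟩ := Submodule.mem_span_singleton.1 hw
    refine smul_mem_of_isMonomial (fun d p hp => ?_) p
    rcases key d p hp with h0 | ⟨k, hk⟩
    · rw [h0]
      exact zero_mem _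
    · exact gr_succ_le_pos k hk

theorem degOp_mem_maxJ {v : IndM ρ} (hv : v ∈ maxJ ρ) : degOp ρ v ∈ maxJ ρ := by
  have h : (⨆ n, (maxJ ρ).restrictScalars ℂ ⊓ IndM.gr ρ n)
      ≤ ((maxJ ρ).restrictScalars ℂ).comap (degOp ρ) := by
    refine iSup_le fun n w hw => ?_
    rw [Submodule.mem_comap, Module.End.mem_eigenspace_iff.1 (gr_le_eigenspace n hw.2)]
    exact Submodule.smul_mem _ _ hw.1
  exact h (maxJ_le_iSup hv)

theorem exists_sum_gr {W : Type*} [AddCommGroup W] [Module ℂ W] {gr : ℕ → Submodule ℂ W}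
    (h : ⨆ n, gr n = ⊤) (v : W) :
    ∃ (D : ℕ) (f : ℕ → W), (∀ n, f n ∈ gr n) ∧ v = ∑ n ∈ Finset.range D, f n := by
  have hv : v ∈ ⨆ n, gr n := by rw [h]; trivial
  obtain ⟨f, hf, rfl⟩ := (Submodule.mem_iSup_iff_exists_finsupp gr v).1 hv
  refine ⟨f.support.sup id + 1, f, hf, Finset.sum_subset (fun n hn => ?_) fun n _ hn => ?_⟩
  · exact Finset.mem_range.2 (Nat.lt_succ_of_le (Finset.le_sup (f := id) hn))
  · exact Finsupp.notMem_support_iff.1 hn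

/-- A subspace of `M(U)` that is stable under `U(ℒ)` and properly contains `J(U)` meets `U`. -/
theorem exists_mem_bot {N : Submodule (UL A B) (IndM ρ)} (hJ : maxJ ρ ≤ N) {v : IndM ρ}
    (hv : v ∈ N) (hvJ : v ∉ maxJ ρ) : ∃ w ∈ IndM.bot ρ, w ≠ 0 ∧ w ∈ N := by
  obtain ⟨D, f, hf, rfl⟩ := exists_sum_gr iSup_gr v
  induction D with
  | zero => exact absurd (zero_mem _) hvJ
  | succ D ih =>
    rw [Finset.sum_range_succ] at hv hvJ
    by_cases hD : f D ∈ maxJ ρ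
    · exact ih ((N.add_mem_iff_left (hJ hD)).1 hv) fun h => hvJ (add_mem h hD)
    · have h1 : ∃ p : UL A B, IsMonomial (-D) p ∧ p • f D ≠ 0 := by
        by_contra! h
        exact hD (mem_maxJ_of_smul (hf D) h)
      obtain ⟨p, hp, h0⟩ := h1
      have h2 : p • f D ∈ IndM.bot ρ := by
        have := smul_mem_grZ hp ((gr_eq_grZ ρ D) ▸ hf D)
        rw [neg_add_cancel] at this
        rw [← gr_zero_eq, gr_eq_grZ]
        exact this
      have h3 : p • ∑ n ∈ Finset.range D, f n = 0 := by
        rw [Finset.smul_sum]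
        refine Finset.sum_eq_zero fun n hn => ?_
        have := smul_mem_grZ hp ((gr_eq_grZ ρ n) ▸ hf n)
        rw [grZ_eq_bot (by have := Finset.mem_range.1 hn; omega)] at this
        exact this
      refine ⟨_, h2, h0, ?_⟩
      have := N.smul_mem p hv
      rwa [smul_add, h3, zero_add] at this

end IndM

/-! ### The grading of `L(U)` -/

namespace SimpleL

variable (ρ)

/-- The operator on `L(U)` that is multiplication by `2ⁿ` on the component of degree `n`. -/
noncomputable def degOp : Module.End ℂ (SimpleL ρ) :=
  ((maxJ ρ).restrictScalars ℂ).mapQ ((maxJ ρ).restrictScalars ℂ) (IndM.degOp ρ)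
    (fun _ hv => IndM.degOp_mem_maxJ hv)

variable {ρ}

theorem gr_le_eigenspace (n : ℕ) : SimpleL.gr ρ n ≤ (degOp ρ).eigenspace (2 ^ n) := by
  rintro _ ⟨v, hv, rfl⟩
  rw [Module.End.mem_eigenspace_iff]
  change (maxJ ρ).mkQ (IndM.degOp ρ v) = _
  rw [Module.End.mem_eigenspace_iff.1 (IndM.gr_le_eigenspace n hv)]
  rfl

theorem iSup_gr : ⨆ n, SimpleL.gr ρ n = ⊤ := by
  simp only [SimpleL.gr]
  rw [← Submodule.map_iSup, IndM.iSup_gr, Submodule.map_top, LinearMap.range_eq_top]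
  exact (maxJ ρ).mkQ_surjective

theorem isInternal_gr : DirectSum.IsInternal (SimpleL.gr ρ) :=
  (DirectSum.isInternal_submodule_iff_iSupIndep_and_iSup_eq_top _).2
    ⟨IndM.iSupIndep_of_le_eigenspace gr_le_eigenspace, iSup_gr⟩

theorem isRestricted : IsRestricted A B (SimpleL ρ) := by
  intro v
  obtain ⟨v, rfl⟩ := (maxJ ρ).mkQ_surjective v
  obtain ⟨t, rfl⟩ := (indRel ρ).mkQ_surjective v
  have : (maxJ ρ).mkQ ((indRel ρ).mkQ t) ∈ restrictedVectors A B (SimpleL ρ) := by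
    induction t using TensorProduct.induction_on with
    | zero => rw [map_zero, map_zero]; exact zero_mem _
    | add t t' ht ht' => rw [map_add, map_add]; exact add_mem ht ht'
    | tmul p y =>
      rw [IndM.mkQ_tmul, map_smul]
      refine smul_mem_restrictedVectors p fun x => ⟨1, fun n hn => ?_⟩
      rw [← map_smul, md_eq_add, md_fst_eq_hm, md_snd_eq_hm, add_smul,
        IndM.hm_smul_ι_of_neg ρ (by omega), IndM.hm_smul_ι_of_neg ρ (by omega), add_zero, map_zero]
  exact this

end SimpleL

end MaxJ

/-! ### Heisenberg modes on a polynomial ring -/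

section Heisenberg

/-- The operators `β(-i-1) = xᵢ`, `β(0) = c` and `β(i+1) = (i+1)k ∂/∂xᵢ` on polynomials. -/
noncomputable def heisenberg (k c : ℂ) : ℤ → Module.End ℂ (MvPolynomial ℕ ℂ)
  | Int.negSucc i => LinearMap.mulLeft ℂ (MvPolynomial.X i)
  | Int.ofNat 0 => c • 1
  | Int.ofNat (i + 1) => (((i : ℂ) + 1) * k) • (MvPolynomial.pderiv i).toLinearMap

theorem MvPolynomial.pderiv_pderiv_comm (i j : ℕ) (p : MvPolynomial ℕ ℂ) :
    MvPolynomial.pderiv i (MvPolynomial.pderiv j p)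
      = MvPolynomial.pderiv j (MvPolynomial.pderiv i p) := by
  have h : ⁅MvPolynomial.pderiv (R := ℂ) i, MvPolynomial.pderiv (R := ℂ) j⁆ = 0 :=
    MvPolynomial.derivation_ext fun l => by
      rw [Derivation.commutator_apply, MvPolynomial.pderiv_X, MvPolynomial.pderiv_X]
      simp [Pi.single_apply, apply_ite]
  have := DFunLike.congr_fun h p
  rwa [Derivation.commutator_apply, Derivation.zero_apply, sub_eq_zero] at this

theorem heisenberg_comm (k c : ℂ) (m n : ℤ) :
    heisenberg k c m * heisenberg k c n - heisenberg k c n * heisenberg k c m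
      = if m + n = 0 then ((m : ℂ) * k) • 1 else 0 := by
  have key : ∀ (i j : ℕ) (p : MvPolynomial ℕ ℂ), MvPolynomial.pderiv i (MvPolynomial.X j * p)
      = (if i = j then p else 0) + MvPolynomial.X j * MvPolynomial.pderiv i p := by
    intro i j p
    rw [MvPolynomial.pderiv_mul, MvPolynomial.pderiv_X, Pi.single_apply]
    simp only [eq_comm, ite_mul, one_mul, zero_mul]
  refine LinearMap.ext fun p => ?_
  rcases m with (_ | i) | i <;> rcases n with (_ | j) | j
  · simp [heisenberg]
  · rw [if_neg (by simp; omega)]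
    simp [heisenberg, smul_comm c]
  · rw [if_neg (by simp)]
    simp [heisenberg]
  · rw [if_neg (by simp; omega)]
    simp [heisenberg, smul_comm c]
  · rw [if_neg (by simp; omega)]
    simp [heisenberg, MvPolynomial.pderiv_pderiv_comm i j, smul_smul, mul_comm]
  · simp only [heisenberg, LinearMap.sub_apply, Module.End.mul_apply, LinearMap.smul_apply,
      LinearMap.mulLeft_apply, Derivation.coeFn_coe, key]
    rcases eq_or_ne i j with rfl | h
    · rw [if_pos rfl, if_pos (by simp; omega)]
      simp
    · rw [if_neg h, if_neg (by simp; omega)]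
      simp
  · rw [if_neg (by simp)]
    simp [heisenberg]
  · simp only [heisenberg, LinearMap.sub_apply, Module.End.mul_apply, LinearMap.smul_apply,
      LinearMap.mulLeft_apply, Derivation.coeFn_coe, key]
    rcases eq_or_ne j i with rfl | h
    · rw [if_pos rfl, if_pos (by simp; omega)]
      simp
      module
    · rw [if_neg h, if_neg (by simp; omega)]
      simp
  · rw [if_neg (by omega)]
    simp only [heisenberg, LinearMap.sub_apply, Module.End.mul_apply, LinearMap.mulLeft_apply,
      LinearMap.zero_apply]
    ring

end Heisenberg

namespace VertexOperator

theorem idOp_nprod_neg_one {W : Type*} [AddCommGroup W] [Module ℂ W] (a : VertexOperator ℂ W) :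
    nprod (-1) idOp a = a := by
  refine ext_ncoeff fun n u => ?_
  have hneg : ((-1 : ℤ).negOnePow : ℤ) = -1 := by
    rw [Int.negOnePow_neg, Int.negOnePow_one]; rfl
  rw [ncoeff_nprod, expComm, LinearMap.sub_apply, LinearMap.smul_apply, expProd_apply,
    expProd_apply, hneg]
  simp only [neg_one_pow_mul_choose_neg_one, one_smul, ncoeff_idOp, zero_add, neg_smul,
    sub_neg_eq_add]
  rw [finsum_eq_single _ 0, finsum_eq_single _ 0]
  · simp
  · intro i _; rw [if_neg (by omega), map_zero]
  · intro i hi; rw [if_neg (by omega)]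

end VertexOperator

/-! ### The modules `L(ℂv)` -/

theorem der_one {A : Type u} {B : Type v} [CommRing A] [Algebra ℂ A] [AddCommGroup B]
    [Module ℂ B] [VertexAlgebroid A B] : der (B := B) (1 : A) = 0 :=
  der_eq_zero_of_isIdempotentElem .one

/-- Since `∂1 = 0`, the relation `(∂1)(n+1) = -(n+1) 1(n)` in `ℒ` kills `1(n)` unless `n = -1`. -/
theorem md_one_of_ne {A : Type u} {B : Type v} [CommRing A] [Algebra ℂ A] [AddCommGroup B]
    [Module ℂ B] [VertexAlgebroid A B] {n : ℤ} (hn : n ≠ -1) : md A B (1, 0) n = 0 := by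
  have h := md_der (A := A) (B := B) 1 (n + 1)
  rw [der_one, md_mk_zero, add_sub_cancel_right] at h
  refine (smul_eq_zero.1 h.symm).resolve_left (neg_ne_zero.2 ?_)
  exact_mod_cast fun h => hn (by omega)

/-! ### The Fock space and the action of the maximal ideal -/

namespace LocalSplitting

variable {A : Type u} {B : Type v} [CommRing A] [Algebra ℂ A]
  [AddCommGroup B] [Module ℂ B] [VertexAlgebroid A B] (S : LocalSplitting A B) (c : ℂ)

/-- The representation of `U(ℒ)` on the Fock space: `a(n)` acts as `δ_{n,-1}χ(a)` and `u(n)` as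
`ℓ(u)β(n)`. -/
noncomputable def fockRep : UL A B →ₐ[ℂ] Module.End ℂ (MvPolynomial ℕ ℂ) :=
  liftUL (fun n => ((if n = -1 then S.χ.toLinearMap else 0) ∘ₗ LinearMap.fst ℂ A B).smulRight 1
      + (S.ℓ ∘ₗ LinearMap.snd ℂ A B).smulRight (heisenberg S.k c n))
    (fun a n => by
      rcases eq_or_ne n 0 with rfl | hn
      · simp [S.ℓ_der]
      · simp [S.ℓ_der, show n - 1 ≠ -1 by omega])
    (fun x y m n => by
      have h := heisenberg_comm S.k c m n
      simp only [LinearMap.add_apply, LinearMap.smulRight_apply, LinearMap.comp_apply,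
        LinearMap.fst_apply, LinearMap.snd_apply, prod0_apply, prod1_apply, S.ℓ_br, map_zero,
        zero_smul, add_zero]
      generalize (if m = -1 then S.χ.toLinearMap else 0) x.1 = r
      generalize (if n = -1 then S.χ.toLinearMap else 0) y.1 = s
      have h1 : (if m + n = -1 then S.χ.toLinearMap else 0) (anchor x.2 y.1 - anchor y.2 x.1)
          = 0 := by
        split_ifs <;> simp [S.χ_anchor]
      -- The mode of `⟨x, y⟩` at index `m + n - 1` acts as a nonzero operator only if that index is
      -- `-1`, so `m + n = 0`; by `χ_pair` it is then the Heisenberg central term.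
      have h2 : (m : ℂ) • (if m + n - 1 = -1 then S.χ.toLinearMap else 0) (pair x.2 y.2)
          • (1 : Module.End ℂ (MvPolynomial ℕ ℂ))
          = (S.ℓ x.2 * S.ℓ y.2) • (if m + n = 0 then ((m : ℂ) * S.k) • 1 else 0) := by
        rcases eq_or_ne (m + n) 0 with h0 | h0
        · rw [if_pos h0, if_pos (by omega), AlgHom.toLinearMap_apply, S.χ_pair]
          module
        · rw [if_neg h0, if_neg (by omega)]
          simp
      rw [h1, h2, ← h]
      simp only [mul_add, add_mul, smul_mul_smul_comm, one_mul, mul_one]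
      module)

theorem fockRep_fst (a : A) (n : ℤ) :
    S.fockRep c (md A B (a, 0) n) = (if n = -1 then S.χ a else 0) • 1 := by
  rw [fockRep, liftUL_md]
  split_ifs <;> simp

theorem fockRep_snd (x : B) (n : ℤ) :
    S.fockRep c (md A B (0, x) n) = S.ℓ x • heisenberg S.k c n := by
  rw [fockRep, liftUL_md]
  simp

/-- The homomorphism from `M(ℂv)` to the Fock space. -/
noncomputable def toFock : IndM (S.charModule c) →ₗ[UL A B] RepSpace (S.fockRep c) :=
  IndM.lift ((RepSpace.equiv (S.fockRep c)).toLinearMap ∘ₗ Algebra.linearMap ℂ (MvPolynomial ℕ ℂ))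
    (fun x y => by
      rw [LinearMap.comp_apply, LinearEquiv.coe_coe, RepSpace.smul_equiv, hm, map_add,
        fockRep_fst, fockRep_snd, charModule_aAct, charModule_gAct]
      refine congrArg (RepSpace.equiv (S.fockRep c)) (?_ : _ = Algebra.linearMap ℂ
        (MvPolynomial ℕ ℂ) (S.χ x.1 * y + S.ℓ x.2 * (c * y)))
      rw [if_pos (by norm_num), neg_zero, show heisenberg S.k c 0 = c • 1 from rfl]
      simp only [LinearMap.add_apply, LinearMap.smul_apply, Module.End.one_apply,
        Algebra.linearMap_apply, map_add, map_mul]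
      simp only [Algebra.smul_def])
    (fun d hd x y => by
      rw [LinearMap.comp_apply, LinearEquiv.coe_coe, RepSpace.smul_equiv, hm, map_add,
        fockRep_fst, fockRep_snd, if_neg (by omega)]
      obtain ⟨i, hi⟩ := Int.eq_ofNat_of_zero_le (a := -d - 1) (by omega)
      rw [show -d = Int.ofNat (i + 1) by simp; omega, heisenberg]
      simp [MvPolynomial.algebraMap_eq])

theorem toFock_ι (y : ℂ) : S.toFock c (IndM.ι _ y)
    = RepSpace.equiv (S.fockRep c) (algebraMap ℂ (MvPolynomial ℕ ℂ) y) := IndM.lift_ι _ _ _ y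

/-- Constants are nonzero in the polynomial ring, so the Fock space detects `ℂv` inside `M(ℂv)`. -/
theorem ι_injective : Function.Injective (IndM.ι (S.charModule c)) := by
  intro y y' h
  have h1 := congrArg (S.toFock c) h
  rw [toFock_ι, toFock_ι] at h1
  exact (algebraMap ℂ (MvPolynomial ℕ ℂ)).injective ((RepSpace.equiv (S.fockRep c)).injective h1)

/-- On the Fock space `a(n)` acts as a multiple of `χ(a)`, so the graded submodule generated by all
`a(n)w` with `χ(a) = 0` maps to zero there. As `ℂv` maps injectively, the submodule misses `ℂv` and
lies in `J`. -/
theorem md_fst_smul_mem_maxJ {a : A} (ha : S.χ a = 0) (n : ℤ) (v : IndM (S.charModule c)) :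
    md A B (a, 0) n • v ∈ maxJ (S.charModule c) := by
  -- Monomials on both sides of `a(n)`: those on the left make the span stable under `U(ℒ)`, and
  -- those on the right make its generators homogeneous.
  let T : Set (IndM (S.charModule c)) :=
    {v | ∃ (q p : UL A B) (d e : ℤ) (a : A) (n : ℤ) (y : ℂ), IsMonomial d q ∧ IsMonomial e p ∧
      S.χ a = 0 ∧ v = q • md A B (a, 0) n • p • IndM.ι _ y}
  let N : Submodule (UL A B) (IndM (S.charModule c)) :=
    { Submodule.span ℂ T with
      smul_mem' := fun p v hv => by
        refine smul_mem_of_md (N := Submodule.span ℂ T) (fun x n v hv => ?_) p hv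
        induction hv using Submodule.span_induction with
        | mem v hv =>
          obtain ⟨q, p, d, e, a, n', y, hq, hp, ha, rfl⟩ := hv
          rw [md_eq_add, add_smul]
          exact add_mem
            (Submodule.subset_span ⟨_, p, _, e, a, n', y, .mulA x.1 n d q hq, hp, ha,
              (mul_smul _ _ _).symm⟩)
            (Submodule.subset_span ⟨_, p, _, e, a, n', y, .mulB x.2 n d q hq, hp, ha,
              (mul_smul _ _ _).symm⟩)
        | zero => rw [smul_zero]; exact zero_mem _
        | add v v' _ _ hv hv' => rw [smul_add]; exact add_mem hv hv'
        | smul c v _ hv => rw [smul_algebra_smul_comm]; exact Submodule.smul_mem _ _ hv }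
  have hN : N.restrictScalars ℂ = Submodule.span ℂ T := rfl
  have hle : N ≤ maxJ (S.charModule c) := by
    refine le_sSup ⟨?_, ?_⟩
    · rw [hN, Submodule.span_le]
      rintro v hv
      have hvN := Submodule.subset_span (R := ℂ) hv
      obtain ⟨q, p, d, e, a, n, y, hq, hp, ha, rfl⟩ := hv
      have hgr := IndM.smul_mem_grZ hq (IndM.smul_mem_grZ (.mulA a n 0 1 .one)
        (IndM.smul_mem_grZ hp (IndM.ι_mem_grZ (ρ := S.charModule c) y)))
      rw [mul_one] at hgr
      generalize d + (0 - n - 1 + (e + 0)) = r at hgr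
      rcases lt_or_ge r 0 with hr | hr
      · rw [IndM.grZ_eq_bot hr] at hgr
        rw [(Submodule.mem_bot ℂ).1 hgr]
        exact zero_mem _
      · obtain ⟨r, rfl⟩ := Int.eq_ofNat_of_zero_le hr
        refine Submodule.mem_iSup_of_mem r ⟨hvN, ?_⟩
        rw [IndM.gr_eq_grZ]
        exact hgr
    · rw [eq_bot_iff]
      rintro v ⟨hv, hb⟩
      have h0 : S.toFock c v = 0 := by
        have : Submodule.span ℂ T
            ≤ LinearMap.ker ((S.toFock c).restrictScalars ℂ) := by
          rw [Submodule.span_le]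
          rintro _ ⟨q, p, d, e, a, n, y, hq, hp, ha, rfl⟩
          change S.toFock c _ = 0
          rw [map_smul, map_smul]
          obtain ⟨w, hw⟩ := (RepSpace.equiv (S.fockRep c)).surjective
            (S.toFock c (p • IndM.ι _ y))
          rw [← hw, RepSpace.smul_equiv, fockRep_fst, ha]
          simp
        exact this hv
      rw [IndM.bot_eq] at hb
      obtain ⟨y, rfl⟩ := hb
      rw [toFock_ι, LinearEquiv.map_eq_zero_iff] at h0
      rw [(map_eq_zero_iff _ (algebraMap ℂ (MvPolynomial ℕ ℂ)).injective).1 h0, map_zero]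
      exact zero_mem _
  refine hle ?_
  change _ ∈ Submodule.span ℂ T
  obtain ⟨t, rfl⟩ := (indRel (S.charModule c)).mkQ_surjective v
  induction t using TensorProduct.induction_on with
  | zero => rw [map_zero, smul_zero]; exact zero_mem _
  | add t t' ht ht' => rw [map_add, smul_add]; exact add_mem ht ht'
  | tmul p y =>
    rw [IndM.mkQ_tmul]
    have h : p • IndM.ι _ y ∈ (Submodule.span ℂ T).comap
        (Algebra.lsmul ℂ ℂ (IndM (S.charModule c)) (md A B (a, 0) n)) := by
      refine IndM.smul_mem_of_isMonomial (fun d p hp => ?_) p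
      exact Submodule.subset_span ⟨1, p, 0, d, a, n, y, .one, hp, ha, (one_smul _ _).symm⟩
    exact h

end LocalSplitting

/-! ### Homogeneous fields -/

namespace VertexOperator

variable {W : Type*} [AddCommGroup W] [Module ℂ W] {G : ℤ → Submodule ℂ W}

/-- The modes `Fₘ` of the field are homogeneous of degree `k - m - 1`. -/
def IsHomogeneous (G : ℤ → Submodule ℂ W) (k : ℤ) (F : VertexOperator ℂ W) : Prop :=
  ∀ m d, ∀ v ∈ G d, ncoeff F m v ∈ G (d + k - m - 1)

theorem isHomogeneous_idOp : IsHomogeneous G 0 idOp := by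
  intro m d v hv
  rw [ncoeff_idOp]
  split_ifs with h
  · rwa [h, show d + 0 - -1 - 1 = d by ring]
  · exact zero_mem _

theorem IsHomogeneous.expProd {k k' : ℤ} {F F' : VertexOperator ℂ W} (hF : IsHomogeneous G k F)
    (hF' : IsHomogeneous G k' F') (l m n : ℤ) {d : ℤ} {v : W} (hv : v ∈ G d) :
    expProd F F' l m n v ∈ G (d + (k + k' - l - 1) - m - n - 1) := by
  obtain ⟨K, hK⟩ := exists_nat_ncoeff_eq_zero F' n v
  rw [expProd_eq_sum _ _ _ _ _ hK]
  refine sum_mem fun i _ => ?_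
  rw [← Int.cast_smul_eq_zsmul ℂ]
  refine Submodule.smul_mem _ _ ?_
  have h := hF (m + l - i) _ _ (hF' (n + i) d v hv)
  rwa [show d + k' - (n + i) - 1 + k - (m + l - i) - 1 = d + (k + k' - l - 1) - m - n - 1 by
    ring] at h

theorem IsHomogeneous.nprod {k k' : ℤ} {F F' : VertexOperator ℂ W} (hF : IsHomogeneous G k F)
    (hF' : IsHomogeneous G k' F') (l : ℤ) :
    IsHomogeneous G (k + k' - l - 1) (nprod l F F') := by
  intro n d v hv
  rw [ncoeff_nprod, expComm, LinearMap.sub_apply, LinearMap.smul_apply]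
  refine sub_mem ?_ ?_
  · have h := hF.expProd hF' l 0 n hv
    rwa [sub_zero] at h
  · rw [← Int.cast_smul_eq_zsmul ℂ]
    refine Submodule.smul_mem _ _ ?_
    have h := hF'.expProd hF l n 0 hv
    rwa [sub_zero, add_comm k' k] at h

end VertexOperator

/-! ### Degrees of the modes of `V_B` -/

section GradedAction

variable {A : Type u} {B : Type v} [CommRing A] [Algebra ℂ A]
  [AddCommGroup B] [Module ℂ B] [VertexAlgebroid A B]

theorem IsVBAction.isHomogeneous_of_isMonomial {W : Type*} [AddCommGroup W] [Module ℂ W]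
    {G : ℤ → Submodule ℂ W} {Y : VB A B →ₗ[ℂ] VertexOperator ℂ W} (hY : IsVBAction Y)
    (hA : ∀ a, IsHomogeneous G 0 (Y (VB.incl A B (a, 0))))
    (hB : ∀ x, IsHomogeneous G 1 (Y (VB.incl A B (0, x)))) {d : ℤ} {p : UL A B}
    (hp : IsMonomial d p) : IsHomogeneous G d (Y (p • VB.one A B)) := by
  induction hp with
  | one => rw [one_smul, hY.map_one]; exact isHomogeneous_idOp
  | mulA a n d p _ ih =>
    have h := (hA a).nprod ih n
    rwa [← hY.map_md, ← mul_smul, zero_add] at h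
  | mulB x n d p _ ih =>
    have h := (hB x).nprod ih n
    rwa [← hY.map_md, ← mul_smul, show 1 + d - n - 1 = d - n by ring] at h

theorem IsVBAction.isHomogeneous {W : Type*} [AddCommGroup W] [Module ℂ W]
    {G : ℤ → Submodule ℂ W} {Y : VB A B →ₗ[ℂ] VertexOperator ℂ W} (hY : IsVBAction Y)
    (hA : ∀ a, IsHomogeneous G 0 (Y (VB.incl A B (a, 0))))
    (hB : ∀ x, IsHomogeneous G 1 (Y (VB.incl A B (0, x)))) {n : ℕ} {v : VB A B}
    (hv : v ∈ VB.gr A B n) : IsHomogeneous G n (Y v) := by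
  intro m d w hw
  induction hv using Submodule.span_induction with
  | mem v hv =>
    obtain ⟨p, hp, rfl⟩ := hv
    exact hY.isHomogeneous_of_isMonomial hA hB hp m d w hw
  | zero => simp
  | add v v' _ _ hv hv' =>
    rw [map_add, map_add]
    exact add_mem hv hv'
  | smul c v _ hv =>
    rw [map_smul, map_smul]
    exact Submodule.smul_mem _ _ hv

/-- A subspace that is stable under the modes of `A ⊕ B` is stable under all modes. -/
theorem IsVBAction.mode_mem {W : Type*} [AddCommGroup W] [Module ℂ W] {N : Submodule ℂ W}
    {Y : VB A B →ₗ[ℂ] VertexOperator ℂ W} (hY : IsVBAction Y)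
    (h : ∀ x n, ∀ w ∈ N, ncoeff (Y (VB.incl A B x)) n w ∈ N) (v : VB A B) (n : ℤ) {w : W}
    (hw : w ∈ N) : ncoeff (Y v) n w ∈ N := by
  obtain ⟨p, rfl⟩ := VB.exists_smul_one v
  let P : Submodule ℂ (VB A B) := N.comap (LinearMap.applyₗ w ∘ₗ
    (LinearMap.proj n : (ℤ → Module.End ℂ W) →ₗ[ℂ] Module.End ℂ W) ∘ₗ ncoeff ∘ₗ Y)
  refine IndM.smul_mem_of_isMonomial (N := P) (fun d p hp => ?_) p
  -- With the constant family `N` as grading, homogeneity of a field means that its modes preserve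
  -- `N`.
  exact hY.isHomogeneous_of_isMonomial (G := fun _ => N) (fun a n _ w hw => h _ n w hw)
    (fun x n _ w hw => h _ n w hw) hp n 0 w hw

/-- The element `1(-1)` commutes with every `x(n)` because derivations kill `1`, and on `U` it is
the identity. -/
theorem IndM.md_one_smul {U : Type*} [AddCommGroup U] [Module ℂ U]
    {ρ : LieAlgebroidModule A (LieQuot A B) U} (v : IndM ρ) : md A B (1, 0) (-1) • v = v := by
  let N : Submodule ℂ (IndM ρ) :=
    LinearMap.eqLocus (Algebra.lsmul ℂ ℂ (IndM ρ) (md A B (1, 0) (-1))) LinearMap.id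
  have hmd : ∀ x n, ∀ v ∈ N, md A B x n • v ∈ N := by
    intro x n v hv
    have hv' : md A B (1, 0) (-1) • v = v := hv
    change md A B (1, 0) (-1) • md A B x n • v = md A B x n • v
    rw [md_smul_comm, hv']
    simp
  have hι : ∀ y, ι ρ y ∈ N := by
    intro y
    have h := hm_zero_smul_ι ρ (1, 0) y
    change md A B (1, 0) (-1) • ι ρ y = ι ρ y
    rw [md_fst_eq_hm]
    simpa using h
  have htop := eq_top_of_ι_mem (N := { N with smul_mem' := fun p v hv => smul_mem_of_md hmd p hv }) hι
  have : v ∈ (⊤ : Submodule (UL A B) (IndM ρ)) := trivial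
  rw [← htop] at this
  exact this

end GradedAction

/-! ### `L(ℂv)` as a simple `V_B`-module -/

namespace LocalSplitting

variable {A : Type u} {B : Type v} [CommRing A] [Algebra ℂ A]
  [AddCommGroup B] [Module ℂ B] [VertexAlgebroid A B] (S : LocalSplitting A B) (c : ℂ)

/-- Write `a = χ(a) 1 + a'` with `a' ∈ 𝔪`: the modes of `a'` are zero on `L(ℂv)`, and `1(n)` is the
identity for `n = -1` and zero otherwise. -/
theorem md_fst_smul (a : A) (n : ℤ) (w : SimpleL (S.charModule c)) :
    md A B (a, 0) n • w = if n = -1 then S.χ a • w else 0 := by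
  obtain ⟨v, rfl⟩ := (maxJ (S.charModule c)).mkQ_surjective w
  have h0 : md A B (a - algebraMap ℂ A (S.χ a), 0) n • (maxJ (S.charModule c)).mkQ v = 0 := by
    rw [← map_smul]
    exact (Submodule.Quotient.mk_eq_zero _).2 (S.md_fst_smul_mem_maxJ c (by simp) n v)
  have h1 : ((a, 0) : A × B) = (a - algebraMap ℂ A (S.χ a), 0) + S.χ a • (1, 0) := by
    ext <;> simp [Algebra.algebraMap_eq_smul_one]
  rw [h1, md_add, md_smul, add_smul, h0, zero_add, smul_assoc]
  split_ifs with hn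
  · rw [hn, ← map_smul, IndM.md_one_smul]
  · rw [md_one_of_ne hn, zero_smul, smul_zero]

/-- Here `u = ℓ(u) b + ∂a` and `(∂a)(n) = -n a(n-1)`. The mode `a(n-1)` can be nonzero only at `n =
0`, where the factor `-n` vanishes. -/
theorem md_snd_smul (x : B) (n : ℤ) (w : SimpleL (S.charModule c)) :
    md A B (0, x) n • w = S.ℓ x • md A B (0, S.b) n • w := by
  obtain ⟨a, ha⟩ := S.exists_eq x
  have h1 : ((0, x) : A × B) = S.ℓ x • (0, S.b) + (0, der a) := by
    ext
    · simp
    · simpa using ha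
  conv_lhs => rw [h1]
  rw [md_add, md_smul, add_smul, smul_assoc, md_der, smul_assoc, md_fst_smul]
  split_ifs with hn
  · have : n = 0 := by omega
    simp [this]
  · simp

/-- The bracket of `b(0)` with any `x(n)` involves only elements of `𝔪` and elements with `ℓ = 0`,
which act as zero on `L(ℂv)`. So `b(0)` commutes with everything and is the scalar by which it acts
on `ℂv`. This recovers `c` from the module, even without its grading. -/
theorem md_b_zero_smul (w : SimpleL (S.charModule c)) : md A B (0, S.b) 0 • w = c • w := by
  let N : Submodule ℂ (SimpleL (S.charModule c)) :=
    LinearMap.eqLocus (Algebra.lsmul ℂ ℂ _ (md A B (0, S.b) 0)) (c • LinearMap.id)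
  have hmd : ∀ x n, ∀ v ∈ N, md A B x n • v ∈ N := by
    intro x n v hv
    have hv' : md A B (0, S.b) 0 • v = c • v := hv
    change md A B (0, S.b) 0 • md A B x n • v = c • md A B x n • v
    rw [md_smul_comm, hv', Int.cast_zero, zero_smul, add_zero, smul_algebra_smul_comm,
      md_eq_add (prod0 A B (0, S.b) x), add_smul, md_fst_smul, md_snd_smul]
    simp [S.χ_anchor, S.ℓ_br]
  have hι : ∀ y, (maxJ (S.charModule c)).mkQ (IndM.ι _ y) ∈ N := by
    intro y
    have h := IndM.hm_zero_smul_ι (S.charModule c) (0, S.b) y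
    change md A B (0, S.b) 0 • (maxJ (S.charModule c)).mkQ (IndM.ι _ y)
      = c • (maxJ (S.charModule c)).mkQ (IndM.ι _ y)
    rw [← map_smul, md_snd_eq_hm, neg_zero, h, charModule_aAct, charModule_gAct, S.ℓ_b, map_zero,
      zero_mul, zero_add, one_mul, ← smul_eq_mul, map_smul]
    rfl
  have htop := IndM.eq_top_of_ι_mem (N := Submodule.comap (maxJ (S.charModule c)).mkQ
    { N with smul_mem' := fun p v hv => smul_mem_of_md hmd p hv }) hι
  obtain ⟨v, rfl⟩ := (maxJ (S.charModule c)).mkQ_surjective w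
  have : v ∈ (⊤ : Submodule (UL A B) (IndM (S.charModule c))) := trivial
  rw [← htop] at this
  exact this

theorem modeField_fst (a : A) :
    modeField (SimpleL.isRestricted (ρ := S.charModule c)) (a, 0) = S.χ a • idOp :=
  ext_ncoeff fun n w => by
    rw [ncoeff_modeField, md_fst_smul, map_smul, Pi.smul_apply, LinearMap.smul_apply, ncoeff_idOp]
    split_ifs <;> simp

/-- The `V_B`-module `L(ℂv)`. -/
noncomputable def vertexModule {𝒱 : VertexAlgebra (VB A B)} (h𝒱 : IsVBStructure 𝒱) :
    VertexModule 𝒱 (SimpleL (S.charModule c)) :=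
  vertexModuleOfRestricted SimpleL.isRestricted
    (by rw [modeField_fst, map_one, one_smul])
    (fun a a' => by
      rw [modeField_fst, modeField_fst, modeField_fst, nprod_smul_left, nprod_smul_right,
        nprod_neg_one_idOp, map_mul, smul_smul])
    (fun a x => by
      rw [modeField_fst, nprod_smul_left, idOp_nprod_neg_one]
      refine ext_ncoeff fun n w => ?_
      rw [map_smul, Pi.smul_apply, LinearMap.smul_apply, ncoeff_modeField, ncoeff_modeField,
        md_snd_smul, md_snd_smul _ _ (act a x), S.ℓ_act, mul_smul])
    h𝒱

variable {𝒱 : VertexAlgebra (VB A B)} (h𝒱 : IsVBStructure 𝒱)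

theorem vertexModule_incl (x : A × B) (n : ℤ) (w : SimpleL (S.charModule c)) :
    ncoeff ((S.vertexModule c h𝒱).Y (VB.incl A B x)) n w = md A B x n • w :=
  vertexModuleOfRestricted_incl _ _ _ _ h𝒱 x n w

theorem isLStructure_vertexModule : IsLStructure (S.charModule c) (S.vertexModule c h𝒱) :=
  S.vertexModule_incl c h𝒱

theorem _root_.IsLStructure.unique {U : Type*} [AddCommGroup U] [Module ℂ U]
    {ρ : LieAlgebroidModule A (LieQuot A B) U} (h𝒱 : IsVBStructure 𝒱)
    {M M' : VertexModule 𝒱 (SimpleL ρ)} (h : IsLStructure ρ M) (h' : IsLStructure ρ M') :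
    M = M' :=
  VertexModule.unique h𝒱 fun x n w => (h x n w).trans (h' x n w).symm

theorem mkQ_ι_eq_zero {y : ℂ} (h : (maxJ (S.charModule c)).mkQ (IndM.ι _ y) = 0) : y = 0 := by
  have h1 := IndM.eq_zero_of_mem_maxJ (by rw [IndM.bot_eq]; exact ⟨y, rfl⟩)
    ((Submodule.Quotient.mk_eq_zero _).1 h)
  exact S.ι_injective c (h1.trans (map_zero _).symm)

instance nontrivial_simpleL : Nontrivial (SimpleL (S.charModule c)) :=
  ⟨⟨_, 0, fun h => one_ne_zero (S.mkQ_ι_eq_zero c (y := 1) h)⟩⟩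

theorem gr_zero_eq : SimpleL.gr (S.charModule c) 0
    = LinearMap.range ((maxJ (S.charModule c)).mkQ.restrictScalars ℂ ∘ₗ IndM.ι _) := by
  rw [SimpleL.gr, IndM.gr_zero_eq, IndM.bot_eq, LinearMap.range_comp]

theorem gr_zero_ne_bot : SimpleL.gr (S.charModule c) 0 ≠ ⊥ := by
  intro h
  have h1 : (maxJ (S.charModule c)).mkQ (IndM.ι _ 1) ∈ SimpleL.gr (S.charModule c) 0 := by
    rw [gr_zero_eq]
    exact ⟨1, rfl⟩
  rw [h] at h1
  exact one_ne_zero (S.mkQ_ι_eq_zero c h1)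

theorem finiteDimensional_gr_zero : FiniteDimensional ℂ (SimpleL.gr (S.charModule c) 0) := by
  rw [gr_zero_eq]
  infer_instance

/-- The preimage in `M(ℂv)` of a nonzero submodule contains `J` properly, so it meets `ℂv`. As `ℂv`
is a line, it contains `ℂv`, which generates. No grading of the submodule is needed. -/
theorem isSimple_vertexModule : (S.vertexModule c h𝒱).IsSimple := by
  refine ⟨inferInstance, fun N hN => or_iff_not_imp_left.2 fun hne => ?_⟩
  have hmd : ∀ x n, ∀ v ∈ N, md A B x n • v ∈ N := by
    intro x n v hv
    rw [← S.vertexModule_incl c h𝒱]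
    exact hN _ n v hv
  let N' : Submodule (UL A B) (IndM (S.charModule c)) := Submodule.comap (maxJ (S.charModule c)).mkQ
    { N with smul_mem' := fun p v hv => smul_mem_of_md hmd p hv }
  obtain ⟨w, hw, hw0⟩ := Submodule.exists_mem_ne_zero_of_ne_bot hne
  obtain ⟨v, rfl⟩ := (maxJ (S.charModule c)).mkQ_surjective w
  have hJ : maxJ (S.charModule c) ≤ N' := by
    intro z hz
    change (maxJ (S.charModule c)).mkQ z ∈ N
    rw [show (maxJ (S.charModule c)).mkQ z = 0 from (Submodule.Quotient.mk_eq_zero _).2 hz]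
    exact zero_mem _
  obtain ⟨z, hz, hz0, hzN⟩ := IndM.exists_mem_bot hJ (v := v) hw
    fun h => hw0 ((Submodule.Quotient.mk_eq_zero _).2 h)
  rw [IndM.bot_eq] at hz
  obtain ⟨y, rfl⟩ := hz
  have hy : y ≠ 0 := fun h => hz0 (by rw [h, map_zero])
  have htop : N' = ⊤ := by
    refine IndM.eq_top_of_ι_mem fun t => ?_
    have := (N'.restrictScalars ℂ).smul_mem (t * y⁻¹) hzN
    rwa [← map_smul, smul_eq_mul, inv_mul_cancel_right₀ hy] at this
  rw [eq_top_iff]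
  rintro w -
  obtain ⟨v, rfl⟩ := (maxJ (S.charModule c)).mkQ_surjective w
  have : v ∈ N' := by rw [htop]; trivial
  exact this

theorem eq_of_vertexModule_iso {c c' : ℂ}
    (h : (S.vertexModule c h𝒱).Iso (S.vertexModule c' h𝒱)) : c = c' := by
  obtain ⟨f, hf⟩ := h
  obtain ⟨w, hw⟩ := exists_ne (0 : SimpleL (S.charModule c))
  have h1 := hf (VB.incl A B (0, S.b)) 0 w
  rw [vertexModule_incl, vertexModule_incl, md_b_zero_smul, md_b_zero_smul, map_smul] at h1
  exact smul_left_injective ℂ (fun h => hw (f.map_eq_zero_iff.1 h)) h1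

end LocalSplitting

/-! ### Compatibility of the grading of `L(U)` with `V_B` -/

namespace SimpleL

variable {A : Type u} {B : Type v} [CommRing A] [Algebra ℂ A]
  [AddCommGroup B] [Module ℂ B] [VertexAlgebroid A B]
  {U : Type w} [AddCommGroup U] [Module ℂ U] {ρ : LieAlgebroidModule A (LieQuot A B) U}

variable (ρ) in
/-- The component of degree `d` of `L(U)`, for an integer `d`. -/
noncomputable def grZ (d : ℤ) : Submodule ℂ (SimpleL ρ) :=
  (IndM.grZ ρ d).map ((maxJ ρ).mkQ.restrictScalars ℂ)

theorem smul_mem_grZ {d e : ℤ} {p : UL A B} (hp : IsMonomial e p) {v : SimpleL ρ}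
    (hv : v ∈ grZ ρ d) : p • v ∈ grZ ρ (e + d) := by
  obtain ⟨v, hv, rfl⟩ := hv
  exact ⟨p • v, IndM.smul_mem_grZ hp hv, map_smul (maxJ ρ).mkQ p v⟩

/-- The components are indexed by `ℤ` in the argument, so that homogeneity is uniform and the
vanishing of modes into negative degrees is the vanishing of the negative components. -/
theorem isGraded {𝒱 : VertexAlgebra (VB A B)} (h𝒱 : IsVBStructure 𝒱)
    {M : VertexModule 𝒱 (SimpleL ρ)} (hM : IsLStructure ρ M) :
    M.IsGraded (VB.gr A B) (SimpleL.gr ρ) := by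
  have hgr : ∀ n : ℕ, SimpleL.gr ρ n = grZ ρ n := fun n => by
    rw [SimpleL.gr, grZ, IndM.gr_eq_grZ]
  have hA : ∀ a, IsHomogeneous (grZ ρ) 0 (M.Y (VB.incl A B (a, 0))) := by
    intro a m d v hv
    rw [VB.incl_apply, hM]
    have h := smul_mem_grZ (.mulA a m 0 1 .one) hv
    rwa [mul_one, show 0 - m - 1 + d = d + 0 - m - 1 by ring] at h
  have hB : ∀ x, IsHomogeneous (grZ ρ) 1 (M.Y (VB.incl A B (0, x))) := by
    intro x m d v hv
    rw [VB.incl_apply, hM]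
    have h := smul_mem_grZ (.mulB x m 0 1 .one) hv
    rwa [mul_one, show 0 - m + d = d + 1 - m - 1 by ring] at h
  refine ⟨isInternal_gr, fun k n p m hp x hx y hy => ?_, fun k n m hm x hx y hy => ?_⟩
  · rw [hgr] at hy ⊢
    have h := (M.isVBAction h𝒱).isHomogeneous hA hB hx m n y hy
    rwa [hp, add_comm (k : ℤ) n]
  · rw [hgr] at hy
    have h := (M.isVBAction h𝒱).isHomogeneous hA hB hx m n y hy
    rw [grZ, IndM.grZ_eq_bot (by omega), Submodule.map_bot] at h
    exact h

end SimpleL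

/-! ### Graded linear maps -/

section GradedLinear

variable {W W' : Type*} [AddCommGroup W] [Module ℂ W] [AddCommGroup W'] [Module ℂ W']

/-- By the modular law, `Q n` is the sum of `P n` and the part of `Q n` in the other components `P
k`, which is zero by independence. -/
theorem eq_of_le_of_iSup_eq_top {P Q : ℕ → Submodule ℂ W} (hPQ : ∀ n, P n ≤ Q n)
    (hQ : iSupIndep Q) (hP : ⨆ n, P n = ⊤) (n : ℕ) : P n = Q n := by
  have h1 : (⨆ k, ⨆ (_ : k ≠ n), P k) ⊓ Q n = ⊥ :=
    ((hQ n).mono_right (iSup₂_mono fun k _ => hPQ k)).symm.eq_bot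
  have h2 := sup_inf_assoc_of_le (⨆ k, ⨆ (_ : k ≠ n), P k) (hPQ n)
  rwa [← iSup_split_single, hP, top_inf_eq, h1, sup_bot_eq, eq_comm] at h2

/-- The images of the components of a kernel vector lie in independent subspaces and add up to zero,
so each component is in the kernel. -/
theorem ker_le_iSup_of_graded {P : ℕ → Submodule ℂ W} {Q : ℕ → Submodule ℂ W'}
    (f : W →ₗ[ℂ] W') (hf : ∀ n, (P n).map f ≤ Q n) (hP : ⨆ n, P n = ⊤) (hQ : iSupIndep Q) :
    LinearMap.ker f ≤ ⨆ n, LinearMap.ker f ⊓ P n := by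
  intro v hv
  obtain ⟨D, g, hg, rfl⟩ := IndM.exists_sum_gr hP v
  rw [LinearMap.mem_ker, map_sum] at hv
  have h := iSupIndep_iff_finsetSum_eq_zero_imp_eq_zero Q |>.1 hQ _ _
    (fun n _ => hf n ⟨g n, hg n, rfl⟩) hv
  exact sum_mem fun n hn => Submodule.mem_iSup_of_mem n ⟨h n hn, hg n⟩

theorem map_le_iSup_of_graded {P : ℕ → Submodule ℂ W} {Q : ℕ → Submodule ℂ W'}
    (f : W →ₗ[ℂ] W') (hf : ∀ n, (P n).map f ≤ Q n) {N : Submodule ℂ W}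
    (hN : N ≤ ⨆ n, N ⊓ P n) : N.map f ≤ ⨆ n, N.map f ⊓ Q n := by
  refine (Submodule.map_mono hN).trans ?_
  rw [Submodule.map_iSup]
  exact iSup_mono fun n => le_inf (Submodule.map_mono inf_le_left)
    ((Submodule.map_mono inf_le_right).trans (hf n))

end GradedLinear

/-- The product of index `-1` is the normally ordered product; under these vanishing conditions one
of its terms is left. On degree-zero vectors this gives `(a·u)(0) = a(-1)u(0)` and `(aa')(-1) =
a(-1)a'(-1)`. -/
theorem VertexOperator.ncoeff_nprod_neg_one {W : Type*} [AddCommGroup W] [Module ℂ W]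
    (F F' : VertexOperator ℂ W) (n : ℤ) {v : W} (hF : ∀ i, 0 ≤ i → ncoeff F i v = 0)
    (hF' : ∀ i, n < i → ncoeff F' i v = 0) :
    ncoeff (nprod (-1) F F') n v = ncoeff F (-1) (ncoeff F' n v) := by
  rw [ncoeff_nprod, expComm, LinearMap.sub_apply, LinearMap.smul_apply,
    expProd_eq_sum F F' (-1) 0 n (K := 1) (fun i hi => hF' _ (by omega)),
    expProd_eq_sum F' F (-1) n 0 (K := 0) (fun i _ => hF _ (by omega))]
  simp

/-! ### The degree-zero space of a graded `V_B`-module -/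

namespace VertexModule

variable {A : Type u} {B : Type v} [CommRing A] [Algebra ℂ A]
  [AddCommGroup B] [Module ℂ B] [VertexAlgebroid A B] {𝒱 : VertexAlgebra (VB A B)}
  {W : Type w} [AddCommGroup W] [Module ℂ W] (M : VertexModule 𝒱 W)

/-- The mode `x(n)` of an element of `A ⊕ B` on a `V_B`-module. -/
noncomputable def op (n : ℤ) : (A × B) →ₗ[ℂ] Module.End ℂ W :=
  (LinearMap.proj n : (ℤ → Module.End ℂ W) →ₗ[ℂ] Module.End ℂ W)
      ∘ₗ ncoeff ∘ₗ M.Y ∘ₗ VB.incl A B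

theorem op_apply (n : ℤ) (x : A × B) : M.op n x = ncoeff (M.Y (VB.incl A B x)) n := rfl

theorem incl_fst_mem (a : A) : VB.incl A B (a, 0) ∈ VB.gr A B 0 := by
  have h := IsMonomial.mulA (B := B) a (-1) 0 1 .one
  rw [show (0 : ℤ) - -1 - 1 = (0 : ℕ) by norm_num, mul_one] at h
  exact Submodule.subset_span ⟨_, h, rfl⟩

theorem incl_snd_mem (x : B) : VB.incl A B (0, x) ∈ VB.gr A B 1 := by
  have h := IsMonomial.mulB (A := A) x (-1) 0 1 .one
  rw [show (0 : ℤ) - -1 = (1 : ℕ) by norm_num, mul_one] at h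
  exact Submodule.subset_span ⟨_, h, rfl⟩

section Graded

variable {M} {gr : ℕ → Submodule ℂ W} (hgr : M.IsGraded (VB.gr A B) gr)
include hgr

theorem IsGraded.op_fst_mem (a : A) {n p : ℕ} {m : ℤ} (hp : (p : ℤ) = n - m - 1) {v : W}
    (hv : v ∈ gr n) : M.op m (a, 0) v ∈ gr p :=
  hgr.mode_mem 0 n p m (by push_cast; omega) _ (incl_fst_mem a) v hv

theorem IsGraded.op_fst_eq_zero (a : A) {n : ℕ} {m : ℤ} (hm : (n : ℤ) - m - 1 < 0) {v : W}
    (hv : v ∈ gr n) : M.op m (a, 0) v = 0 :=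
  hgr.mode_eq_zero 0 n m (by push_cast; omega) _ (incl_fst_mem a) v hv

theorem IsGraded.op_snd_mem (x : B) {n p : ℕ} {m : ℤ} (hp : (p : ℤ) = n - m) {v : W}
    (hv : v ∈ gr n) : M.op m (0, x) v ∈ gr p :=
  hgr.mode_mem 1 n p m (by push_cast; omega) _ (incl_snd_mem x) v hv

theorem IsGraded.op_snd_eq_zero (x : B) {n : ℕ} {m : ℤ} (hm : (n : ℤ) - m < 0) {v : W}
    (hv : v ∈ gr n) : M.op m (0, x) v = 0 :=
  hgr.mode_eq_zero 1 n m (by push_cast; omega) _ (incl_snd_mem x) v hv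

end Graded

theorem mkQ_eq_of_setE {e e' : VL A B} (h : e - e' ∈ setE A B) :
    (idealB A B).mkQ e = (idealB A B).mkQ e' := by
  rw [← sub_eq_zero, ← map_sub]
  exact (Submodule.Quotient.mk_eq_zero _).2 (Submodule.subset_span ⟨_, h, 0, rfl⟩)

theorem incl_one : VB.incl A B (1, 0) = VB.one A B :=
  mkQ_eq_of_setE (.inl (.inl rfl))

theorem incl_mul (a a' : A) :
    VB.incl A B (a * a', 0) = md A B (a, 0) (-1) • VB.incl A B (a', 0) :=
  (mkQ_eq_of_setE (.inl (.inr ⟨a, a', rfl⟩))).symm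

theorem incl_act (a : A) (x : B) :
    VB.incl A B (0, act a x) = md A B (a, 0) (-1) • VB.incl A B (0, x) :=
  (mkQ_eq_of_setE (.inr ⟨a, x, rfl⟩)).symm

variable (h𝒱 : IsVBStructure 𝒱)

/-- The representation of `U(ℒ)` on a `V_B`-module. -/
noncomputable abbrev rep : UL A B →ₐ[ℂ] Module.End ℂ W := (VB.isAlgebroidMap h𝒱).rep M

theorem rep_md (x : A × B) (n : ℤ) : M.rep h𝒱 (md A B x n) = M.op n x :=
  IsAlgebroidMap.rep_md _ M x n

-- In `ℒ` one has `(∂a)(0) = -0 · a(-1) = 0`.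
include h𝒱 in
theorem op_zero_der (a : A) : M.op 0 (0, der a) = 0 := by
  rw [← M.rep_md h𝒱, md_der]
  simp

include h𝒱 in
theorem op_comm_snd_snd (x y : B) : M.op 0 (0, x) * M.op 0 (0, y) - M.op 0 (0, y) * M.op 0 (0, x)
    = M.op 0 (0, br A x y) := by
  have h := congrArg (M.rep h𝒱) (md_comm_snd_snd (A := A) x y 0 0)
  simpa [M.rep_md h𝒱] using h

include h𝒱 in
theorem op_comm_snd_fst (x : B) (a : A) :
    M.op 0 (0, x) * M.op (-1) (a, 0) - M.op (-1) (a, 0) * M.op 0 (0, x)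
    = M.op (-1) (anchor x a, 0) := by
  have h := congrArg (M.rep h𝒱) (md_comm_snd_fst x a 0 (-1))
  simpa [M.rep_md h𝒱] using h

variable {M} {gr : ℕ → Submodule ℂ W} (hgr : M.IsGraded (VB.gr A B) gr)

include h𝒱 hgr in
theorem IsGraded.op_fst_mul (a a' : A) {v : W} (hv : v ∈ gr 0) :
    M.op (-1) (a * a', 0) v = M.op (-1) (a, 0) (M.op (-1) (a', 0) v) := by
  rw [op_apply, incl_mul, (M.isVBAction h𝒱).map_md]
  exact ncoeff_nprod_neg_one _ _ _ (fun i hi => hgr.op_fst_eq_zero a (by push_cast; omega) hv)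
    (fun i hi => hgr.op_fst_eq_zero a' (by push_cast; omega) hv)

include h𝒱 hgr in
theorem IsGraded.op_snd_act (a : A) (x : B) {v : W} (hv : v ∈ gr 0) :
    M.op 0 (0, act a x) v = M.op (-1) (a, 0) (M.op 0 (0, x) v) := by
  rw [op_apply, incl_act, (M.isVBAction h𝒱).map_md]
  exact ncoeff_nprod_neg_one _ _ _ (fun i hi => hgr.op_fst_eq_zero a (by push_cast; omega) hv)
    (fun i hi => hgr.op_snd_eq_zero x (by push_cast; omega) hv)

/-- The action of `A` on the degree-zero space. -/
noncomputable def IsGraded.aActZero : A →ₐ[ℂ] Module.End ℂ (gr 0) :=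
  AlgHom.ofLinearMap
    { toFun := fun a => (M.op (-1) (a, 0)).restrict
        fun _ hv => hgr.op_fst_mem a (by norm_num) hv
      map_add' := fun a a' => LinearMap.ext fun v => Subtype.ext (by
        have h := map_add (M.op (-1)) (a, 0) (a', 0)
        rw [Prod.mk_add_mk, add_zero] at h
        simp [h])
      map_smul' := fun c a => LinearMap.ext fun v => Subtype.ext (by
        have h := map_smul (M.op (-1)) c (a, 0)
        rw [Prod.smul_mk, smul_zero] at h
        simp [h]) }
    (LinearMap.ext fun v => Subtype.ext (by
      change M.op (-1) (1, 0) v = v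
      rw [op_apply, incl_one, (M.isVBAction h𝒱).map_one, ncoeff_idOp, if_pos rfl]))
    (fun a a' => LinearMap.ext fun v => Subtype.ext (hgr.op_fst_mul h𝒱 a a' v.2))

/-- The action of `B` on the degree-zero space. -/
noncomputable def IsGraded.bActZero : B →ₗ[ℂ] Module.End ℂ (gr 0) where
  toFun x := (M.op 0 (0, x)).restrict fun _ hv => hgr.op_snd_mem x (by norm_num) hv
  map_add' x x' := LinearMap.ext fun v => Subtype.ext (by
    have h := map_add (M.op 0) (0, x) (0, x')
    rw [Prod.mk_add_mk, add_zero] at h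
    simp [h])
  map_smul' c x := LinearMap.ext fun v => Subtype.ext (by
    have h := map_smul (M.op 0) c (0, x)
    rw [Prod.smul_mk, smul_zero] at h
    simp [h])

theorem IsGraded.coe_bActZero (x : B) (v : gr 0) :
    (hgr.bActZero x v : W) = M.op 0 (0, x) v := rfl

-- On degree zero `(a·∂a')(0) = a(-1)(∂a')(0)`, and `(∂a')(0) = 0`. This lets the action of `B`
-- descend to `B / A∂(A)`.
include h𝒱 in
theorem IsGraded.bActZero_eq_zero {x : B} (hx : x ∈ AdA A B) : hgr.bActZero x = 0 := by
  refine (Submodule.span_le (p := LinearMap.ker hgr.bActZero)).2 ?_ hx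
  rintro _ ⟨⟨a, a'⟩, rfl⟩
  refine LinearMap.ext fun v => Subtype.ext ?_
  rw [coe_bActZero, hgr.op_snd_act h𝒱 _ _ v.2, M.op_zero_der h𝒱]
  simp

/-- The degree-zero space, as a module of the Lie algebroid `B / A∂(A)`. -/
noncomputable def IsGraded.zeroModule : LieAlgebroidModule A (LieQuot A B) (gr 0) where
  aAct := hgr.aActZero h𝒱
  gAct := (AdA A B).liftQ hgr.bActZero fun _ hx => hgr.bActZero_eq_zero h𝒱 hx
  gAct_lie x x' v := by
    obtain ⟨x, rfl⟩ := LieQuot.mk_surjective A B x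
    obtain ⟨x', rfl⟩ := LieQuot.mk_surjective A B x'
    exact Subtype.ext (LinearMap.congr_fun (M.op_comm_snd_snd h𝒱 x x') v.1).symm
  gAct_aAct x a v := by
    obtain ⟨x, rfl⟩ := LieQuot.mk_surjective A B x
    exact Subtype.ext (LinearMap.congr_fun (M.op_comm_snd_fst h𝒱 x a) v.1)
  aAct_gAct x a v := by
    obtain ⟨x, rfl⟩ := LieQuot.mk_surjective A B x
    exact Subtype.ext (hgr.op_snd_act h𝒱 a x v.2).symm

end VertexModule

/-! ### Classification of the irreducible graded `V_B`-modules -/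

namespace LocalSplitting

variable {A : Type u} {B : Type v} [CommRing A] [Algebra ℂ A]
  [AddCommGroup B] [Module ℂ B] [VertexAlgebroid A B] (S : LocalSplitting A B)
  {𝒱 : VertexAlgebra (VB A B)} (h𝒱 : IsVBStructure 𝒱)
  {W : Type w} [AddCommGroup W] [Module ℂ W] {M : VertexModule 𝒱 W}
  {gr : ℕ → Submodule ℂ W} (hgr : M.IsGraded (VB.gr A B) gr)

/-- A vector of degree zero on which `a(-1)` acts as `χ(a)` and `b(0)` as `c`. -/
structure IsLowestWeight (M : VertexModule 𝒱 W) (gr : ℕ → Submodule ℂ W) (c : ℂ) (v : W) : Prop where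
  mem : v ∈ gr 0
  op_fst : ∀ a, M.op (-1) (a, 0) v = S.χ a • v
  op_snd : ∀ x, M.op 0 (0, x) v = (S.ℓ x * c) • v

section Hom

variable {S} {c : ℂ} {v : W} (hv : S.IsLowestWeight M gr c v)
include hv

theorem IsLowestWeight.hm_zero (x : A × B) : M.rep h𝒱 (hm A B 0 x) v
    = (S.χ x.1 + S.ℓ x.2 * c) • v := by
  rw [hm, map_add, M.rep_md, M.rep_md, LinearMap.add_apply, neg_zero, zero_sub, hv.op_fst,
    hv.op_snd, add_smul]

include hgr

theorem IsLowestWeight.hm_neg {d : ℤ} (hd : d < 0) (x : A × B) : M.rep h𝒱 (hm A B d x) v = 0 := by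
  rw [hm, map_add, M.rep_md, M.rep_md, LinearMap.add_apply,
    hgr.op_fst_eq_zero _ (by push_cast; omega) hv.mem,
    hgr.op_snd_eq_zero _ (by push_cast; omega) hv.mem, add_zero]

/-- The homomorphism from `M(ℂv)` to a `V_B`-module determined by `v`. -/
noncomputable def IsLowestWeight.hom : IndM (S.charModule c) →ₗ[UL A B] RepSpace (M.rep h𝒱) :=
  IndM.lift ((RepSpace.equiv (M.rep h𝒱)).toLinearMap ∘ₗ LinearMap.toSpanSingleton ℂ W v)
    (fun x y => by
      rw [LinearMap.comp_apply, LinearEquiv.coe_coe, RepSpace.smul_equiv,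
        LinearMap.toSpanSingleton_apply, map_smul, hv.hm_zero h𝒱, charModule_aAct,
        charModule_gAct]
      refine congrArg (RepSpace.equiv (M.rep h𝒱))
        (?_ : _ = (S.χ x.1 * y + S.ℓ x.2 * (c * y)) • v)
      module)
    (fun d hd x y => by
      rw [LinearMap.comp_apply, LinearEquiv.coe_coe, RepSpace.smul_equiv,
        LinearMap.toSpanSingleton_apply, map_smul, hv.hm_neg h𝒱 hgr hd, smul_zero, map_zero])

/-- The homomorphism from `M(ℂv)` to a `V_B`-module, as a linear map. -/
noncomputable def IsLowestWeight.homLin : IndM (S.charModule c) →ₗ[ℂ] W :=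
  (RepSpace.equiv (M.rep h𝒱)).symm.toLinearMap ∘ₗ (hv.hom h𝒱 hgr).restrictScalars ℂ

theorem IsLowestWeight.homLin_smul (p : UL A B) (z : IndM (S.charModule c)) :
    hv.homLin h𝒱 hgr (p • z) = M.rep h𝒱 p (hv.homLin h𝒱 hgr z) :=
  map_smul (hv.hom h𝒱 hgr) p z

theorem IsLowestWeight.homLin_ι (y : ℂ) : hv.homLin h𝒱 hgr (IndM.ι _ y) = y • v := by
  change hv.hom h𝒱 hgr (IndM.ι _ y) = RepSpace.equiv (M.rep h𝒱) (y • v)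
  rw [IsLowestWeight.hom, IndM.lift_ι]
  rfl

/-- Both clauses are needed in one induction: a partial product may fall to negative degree, where
the vector is already zero and stays zero. -/
theorem IsLowestWeight.rep_mem {d : ℤ} {p : UL A B} (hp : IsMonomial d p) :
    (∀ n : ℕ, d = n → M.rep h𝒱 p v ∈ gr n) ∧ (d < 0 → M.rep h𝒱 p v = 0) := by
  induction hp with
  | one =>
    refine ⟨fun n hn => ?_, fun h => absurd h (lt_irrefl _)⟩
    obtain rfl : n = 0 := by omega
    simpa using hv.mem
  | mulA a m d p _ ih =>
    rw [map_mul, M.rep_md, Module.End.mul_apply]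
    rcases lt_or_ge d 0 with hd | hd
    · rw [ih.2 hd, map_zero]
      exact ⟨fun _ _ => zero_mem _, fun _ => rfl⟩
    · obtain ⟨k, rfl⟩ := Int.eq_ofNat_of_zero_le hd
      exact ⟨fun n hn => hgr.op_fst_mem a hn.symm (ih.1 k rfl),
        fun h => hgr.op_fst_eq_zero a h (ih.1 k rfl)⟩
  | mulB x m d p _ ih =>
    rw [map_mul, M.rep_md, Module.End.mul_apply]
    rcases lt_or_ge d 0 with hd | hd
    · rw [ih.2 hd, map_zero]
      exact ⟨fun _ _ => zero_mem _, fun _ => rfl⟩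
    · obtain ⟨k, rfl⟩ := Int.eq_ofNat_of_zero_le hd
      exact ⟨fun n hn => hgr.op_snd_mem x hn.symm (ih.1 k rfl),
        fun h => hgr.op_snd_eq_zero x h (ih.1 k rfl)⟩

theorem IsLowestWeight.map_gr_le (n : ℕ) :
    (IndM.gr (S.charModule c) n).map (hv.homLin h𝒱 hgr) ≤ gr n := by
  rw [Submodule.map_le_iff_le_comap, IndM.gr, Submodule.span_le]
  rintro _ ⟨p, y, hp, rfl⟩
  rw [IndM.mkQ_tmul, SetLike.mem_coe, Submodule.mem_comap, hv.homLin_smul, hv.homLin_ι, map_smul]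
  exact Submodule.smul_mem _ _ ((hv.rep_mem h𝒱 hgr hp).1 n rfl)

theorem IsLowestWeight.isSubmodule_map (N : Submodule (UL A B) (IndM (S.charModule c))) :
    M.IsSubmodule ((N.restrictScalars ℂ).map (hv.homLin h𝒱 hgr)) := by
  intro x n y hy
  refine (M.isVBAction h𝒱).mode_mem (fun x n w hw => ?_) x n hy
  obtain ⟨z, hz, rfl⟩ := hw
  refine ⟨md A B x n • z, N.smul_mem _ hz, ?_⟩
  rw [hv.homLin_smul, M.rep_md]
  rfl

variable (hM : M.IsGradedSimple gr) (hv0 : v ≠ 0)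
include hM hv0

theorem IsLowestWeight.range_homLin : LinearMap.range (hv.homLin h𝒱 hgr) = ⊤ := by
  have h := hM.2 ((⊤ : Submodule ℂ _).map (hv.homLin h𝒱 hgr)) (hv.isSubmodule_map h𝒱 hgr ⊤)
    (map_le_iSup_of_graded _ (hv.map_gr_le h𝒱 hgr) (by
      simp only [top_inf_eq, IndM.iSup_gr, le_refl]))
  rw [Submodule.map_top] at h
  refine h.resolve_left fun hbot => hv0 ?_
  have h1 : hv.homLin h𝒱 hgr (IndM.ι _ 1) ∈ LinearMap.range (hv.homLin h𝒱 hgr) := ⟨_, rfl⟩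
  rwa [hbot, hv.homLin_ι, one_smul] at h1

theorem IsLowestWeight.hom_surjective : Function.Surjective (hv.hom h𝒱 hgr) := by
  have h : Function.Surjective (hv.homLin h𝒱 hgr) :=
    LinearMap.range_eq_top.1 (hv.range_homLin h𝒱 hgr hM hv0)
  exact h

/-- The kernel is graded and misses `ℂv` since `v ≠ 0`, so it lies in `J`. Conversely the image of
`J` is a graded submodule in positive degrees, so it cannot contain `v` and is zero by
irreducibility. -/
theorem IsLowestWeight.ker_hom : LinearMap.ker (hv.hom h𝒱 hgr) = maxJ (S.charModule c) := by
  have hind : iSupIndep gr := hgr.isInternal.submodule_iSupIndep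
  have hk : (LinearMap.ker (hv.hom h𝒱 hgr)).restrictScalars ℂ
      = LinearMap.ker (hv.homLin h𝒱 hgr) := rfl
  refine le_antisymm (le_sSup ⟨?_, ?_⟩) ?_
  · rw [hk]
    exact ker_le_iSup_of_graded _ (hv.map_gr_le h𝒱 hgr) IndM.iSup_gr hind
  · rw [hk, eq_bot_iff, IndM.bot_eq]
    rintro _ ⟨h, y, rfl⟩
    have h' : hv.homLin h𝒱 hgr (IndM.ι _ y) = 0 := h
    rw [hv.homLin_ι] at h'
    rw [(smul_eq_zero.1 h').resolve_right hv0, map_zero]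
    exact zero_mem _
  · have h1 := hM.2 _ (hv.isSubmodule_map h𝒱 hgr (maxJ (S.charModule c)))
      (map_le_iSup_of_graded _ (hv.map_gr_le h𝒱 hgr) IndM.maxJ_le_iSup)
    have h2 : ((maxJ (S.charModule c)).restrictScalars ℂ).map (hv.homLin h𝒱 hgr)
        ≤ ⨆ n, ⨆ (_ : n ≠ 0), gr n := by
      refine (Submodule.map_mono IndM.maxJ_le_pos).trans ?_
      rw [IndM.pos, Submodule.map_iSup]
      exact iSup_le fun n => (hv.map_gr_le h𝒱 hgr (n + 1)).trans
        (le_iSup₂_of_le (n + 1) n.succ_ne_zero le_rfl)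
    have h3 := h1.resolve_right fun htop => hv0
      (Submodule.disjoint_def.1 (hind 0) v hv.mem (h2 (by rw [htop]; trivial)))
    intro z hz
    have h4 : hv.homLin h𝒱 hgr z ∈
        ((maxJ (S.charModule c)).restrictScalars ℂ).map (hv.homLin h𝒱 hgr) := ⟨z, hz, rfl⟩
    rw [h3] at h4
    exact h4

/-- The isomorphism from `L(ℂv)` to an irreducible graded `V_B`-module. -/
noncomputable def IsLowestWeight.equiv : SimpleL (S.charModule c) ≃ₗ[ℂ] W :=
  (((Submodule.quotEquivOfEq _ _ (hv.ker_hom h𝒱 hgr hM hv0).symm).trans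
    ((hv.hom h𝒱 hgr).quotKerEquivOfSurjective
      (hv.hom_surjective h𝒱 hgr hM hv0))).restrictScalars ℂ).trans
    (RepSpace.equiv (M.rep h𝒱)).symm

/-- The isomorphism respects the modes of `A ⊕ B`, hence all modes. It maps components into
components, and equality follows because the target components are independent and the images span.
-/
theorem IsLowestWeight.gradedIso :
    M.GradedIso gr (S.vertexModule c h𝒱) (SimpleL.gr (S.charModule c)) := by
  have h1 : ∀ x n y, hv.equiv h𝒱 hgr hM hv0 (ncoeff ((S.vertexModule c h𝒱).Y x) n y)
      = ncoeff (M.Y x) n (hv.equiv h𝒱 hgr hM hv0 y) := by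
    refine ((S.vertexModule c h𝒱).isVBAction h𝒱).intertwine (M.isVBAction h𝒱)
      (hv.equiv h𝒱 hgr hM hv0).toLinearMap fun x n w => ?_
    obtain ⟨z, rfl⟩ := (maxJ (S.charModule c)).mkQ_surjective w
    rw [vertexModule_incl, ← map_smul]
    change hv.homLin h𝒱 hgr (md A B x n • z) = M.op n x (hv.homLin h𝒱 hgr z)
    rw [hv.homLin_smul, M.rep_md]
  have h2 : ∀ n, (SimpleL.gr (S.charModule c) n).map (hv.equiv h𝒱 hgr hM hv0).toLinearMap
      = gr n := by
    refine eq_of_le_of_iSup_eq_top (fun n => ?_) hgr.isInternal.submodule_iSupIndep ?_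
    · rintro _ ⟨_, ⟨z, hz, rfl⟩, rfl⟩
      exact hv.map_gr_le h𝒱 hgr n ⟨z, hz, rfl⟩
    · rw [← Submodule.map_iSup, SimpleL.iSup_gr, Submodule.map_top]
      exact LinearEquiv.range _
  refine ⟨(hv.equiv h𝒱 hgr hM hv0).symm, fun x n y => ?_, fun n => ?_⟩
  · rw [LinearEquiv.symm_apply_eq, h1, LinearEquiv.apply_symm_apply]
  · rw [← h2, ← Submodule.map_comp]
    simp

end Hom

-- Irreducibility of the degree-zero space is not needed: any nonzero finite-dimensional module of
-- the Lie algebroid has such an eigenvector.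
include h𝒱 hgr in
theorem exists_isLowestWeight [FiniteDimensional ℂ (gr 0)] (h0 : gr 0 ≠ ⊥) :
    ∃ (c : ℂ) (v : W), v ≠ 0 ∧ S.IsLowestWeight M gr c v := by
  have := Submodule.nontrivial_iff_ne_bot.2 h0
  obtain ⟨v, hv, h1, c, h2⟩ := S.exists_eigenvector (hgr.zeroModule h𝒱)
  exact ⟨c, v, fun h => hv (Subtype.ext h), v.2, fun a => congrArg Subtype.val (h1 a),
    fun x => congrArg Subtype.val (h2 x)⟩

end LocalSplitting

theorem mainTheorem2 {A : Type u} {B : Type v} [CommRing A] [Algebra ℂ A]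
    [AddCommGroup B] [Module ℂ B] [VertexAlgebroid A B]
    (hdim : Module.finrank ℂ B = 2 ∨ Module.finrank ℂ B = 3)
    (hLie : ¬ VertexAlgebroid.IsLie A B)
    (hAdA : VertexAlgebroid.AdA A B ≠ ⊤)
    (hker : LinearMap.ker (VertexAlgebroid.der : A →ₗ[ℂ] B) = Submodule.span ℂ {1})
    (b : B) (hb : VertexAlgebroid.IsGenerator A b) :
    ∃ (𝔪 : Ideal A) (C : ℂ → LieAlgebroidModule A (LieQuot A B) ℂ)
      (𝒱 : VertexAlgebra (VB A B)) (L : ∀ c : ℂ, VertexModule 𝒱 (SimpleL (C c))),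
      -- `𝔪` is the unique maximal ideal of `A`
      (∀ I : Ideal A, I.IsMaximal ↔ I = 𝔪) ∧
      -- a finite-dimensional irreducible module is `ℂv`, with `𝔪v = 0` and `bv = cv`
      (∀ (U : Type w) [AddCommGroup U] [Module ℂ U] [FiniteDimensional ℂ U]
        (ρ : LieAlgebroidModule A (LieQuot A B) U), ρ.IsIrreducible →
        ∃ v : U, v ≠ 0 ∧ Submodule.span ℂ {v} = ⊤ ∧ (∀ a ∈ 𝔪, ρ.aAct a v = 0) ∧
          ∃ c : ℂ, ρ.gAct (LieQuot.mk A B b) v = c • v) ∧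
      -- `C c` is `ℂv` with `𝔪v = 0` and `bv = cv`
      (∀ c : ℂ, (∀ a ∈ 𝔪, (C c).aAct a = 0) ∧
        ∀ v : ℂ, (C c).gAct (LieQuot.mk A B b) v = c • v) ∧
      -- the `C c` represent the finite-dimensional irreducible modules up to isomorphism
      (∀ c : ℂ, (C c).IsIrreducible) ∧
      (∀ c c' : ℂ, (C c).Iso (C c') → c = c') ∧
      (∀ (U : Type w) [AddCommGroup U] [Module ℂ U] [FiniteDimensional ℂ U]
        (ρ : LieAlgebroidModule A (LieQuot A B) U), ρ.IsIrreducible →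
        ∃ c : ℂ, ρ.Iso (C c)) ∧
      -- `𝒱` is the vertex algebra `V_B`, and `L c` is the `V_B`-module `L(C c)`
      (IsVBStructure 𝒱 ∧ ∀ 𝒱' : VertexAlgebra (VB A B), IsVBStructure 𝒱' → 𝒱' = 𝒱) ∧
      (∀ c : ℂ, IsLStructure (C c) (L c) ∧
        ∀ M : VertexModule 𝒱 (SimpleL (C c)), IsLStructure (C c) M → M = L c) ∧
      -- the `L c` represent the irreducible `ℕ`-graded modules with finite-dimensional
      -- degree-zero space
      (∀ c : ℂ, (L c).IsGraded (VB.gr A B) (SimpleL.gr (C c)) ∧ (L c).IsSimple ∧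
        SimpleL.gr (C c) 0 ≠ ⊥ ∧ FiniteDimensional ℂ (SimpleL.gr (C c) 0)) ∧
      (∀ c c' : ℂ, (L c).Iso (L c') → c = c') ∧
      (∀ (W : Type w) [AddCommGroup W] [Module ℂ W] (M : VertexModule 𝒱 W)
        (gr : ℕ → Submodule ℂ W), M.IsGraded (VB.gr A B) gr → M.IsGradedSimple gr →
        gr 0 ≠ ⊥ → FiniteDimensional ℂ (gr 0) →
        ∃ c : ℂ, M.GradedIso gr (L c) (SimpleL.gr (C c))) := by

  -- `finrank` is `0` by convention for infinite-dimensional spaces, so a positive value gives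
  -- finite dimension.
  have : FiniteDimensional ℂ B := Module.finite_of_finrank_pos (by omega)
  obtain ⟨S, rfl, hmax⟩ := exists_localSplitting hAdA hker hb
  have h𝒱 := VB.isVBStructure (A := A) (B := B)
  refine ⟨RingHom.ker S.χ, S.charModule, VB.vertexAlgebra A B, fun c => S.vertexModule c h𝒱, hmax,
    ?_, ?_, S.charModule_isIrreducible, fun c c' => S.eq_of_charModule_iso, ?_,
    ⟨h𝒱, fun 𝒱' h' => h'.unique h𝒱⟩, ?_, ?_, fun c c' => S.eq_of_vertexModule_iso h𝒱, ?_⟩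
  · intro U _ _ _ ρ hρ
    obtain ⟨v, hv, htop, h1, c, h2⟩ := S.exists_span_eq_top hρ
    refine ⟨v, hv, htop, fun a ha => ?_, c, ?_⟩
    · rw [h1, show S.χ a = 0 from ha, zero_smul]
    · rw [h2, S.ℓ_b, one_mul]
  · intro c
    refine ⟨fun a ha => LinearMap.ext fun y => ?_, fun v => ?_⟩
    · rw [S.charModule_aAct, show S.χ a = 0 from ha, zero_mul, LinearMap.zero_apply]
    · rw [S.charModule_gAct, S.ℓ_b, one_mul, smul_eq_mul]
  · intro U _ _ _ ρ hρ
    exact S.exists_iso_charModule hρ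
  · exact fun c => ⟨S.isLStructure_vertexModule c h𝒱,
      fun M hM => hM.unique h𝒱 (S.isLStructure_vertexModule c h𝒱)⟩
  · exact fun c => ⟨SimpleL.isGraded h𝒱 (S.isLStructure_vertexModule c h𝒱),
      S.isSimple_vertexModule c h𝒱, S.gr_zero_ne_bot c, S.finiteDimensional_gr_zero c⟩
  · intro W _ _ M gr hgr hM h0 _
    obtain ⟨c, v, hv0, hv⟩ := S.exists_isLowestWeight h𝒱 hgr h0
    exact ⟨c, hv.gradedIso h𝒱 hgr hM hv0⟩
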